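/- **Setting.** Let $F_n$ be the free group on $x_1,\dots,x_n$, let $H=H_1(F_n,\mathbb Q)=\mathbb Q^n$ with basis $e_1,\dots,e_n$, $H^*=\mathrm{Hom}(H,\mathbb Q)$, and let $\mathrm{IA}_n=\ker(\mathrm{Aut}(F_n)\to \mathrm{GL}(n,\mathbb Z))$ and $\mathrm{IO}_n=\ker(\mathrm{Out}(F_n)\to \mathrm{GL}(n,\mathbb Z))$. For a group $G$, its $i$-th Albanese homology is $$H^A_i(G,\mathbb Q)=\mathrm{im}\bigl(H_i(G,\mathbb Q)\to H_i(H_1(G,\mathbb Z),\mathbb Q)\bigr),$$ the map being induced by $G\twoheadrightarrow H_1(G,\mathbb Z)$. Let $U=\mathrm{Hom}(H,\bigwedge^2H)\cong \bigwedge^2 H\otimes H^*$ and $U^O=U/H$, where $H\subset U$ via $h\mapsto (x\mapsto h\wedge x)$, and let $\mathrm{pr}:U\to U^O$ be the projection. For a rational vector space $V$ identify $H_i(V,\mathbb Q)=\bigwedge^iV$. The Johnson homomorphism $\tau^O:\mathrm{IO}_n\to U^O$ sends the class of $\varphi\in \mathrm{IA}_n$ to the class of the homomorphism $e_j\mapsto[\varphi(x_j)x_j^{-1}]\in(\Gamma_2F_n/\Gamma_3F_n)\otimes\mathbb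 Q=\bigwedge^2H$. It induces a map $\tau^O_*:H^A_i(\mathrm{IO}_n,\mathbb Q)\to H_i(U^O,\mathbb Q)=\bigwedge^iU^O$, and $H^A_i(\mathrm{IO}_n,\mathbb Q)$ is a $\mathrm{GL}(n,\mathbb Q)$-representation through $\tau^O_*$, that is, with an action for which $\tau^O_*$ is $\mathrm{GL}(n,\mathbb Q)$-equivariant. Let $T_{p,q}\subset H^{\otimes p}\otimes(H^*)^{\otimes q}$ be the intersection of the kernels of all contraction maps between a factor $H$ and a factor $H^*$. The traceless part of $H_i(U,\mathbb Q)=\bigwedge^iU$ is the subrepresentation $H_i(U,\mathbb Q)^{\mathrm{tl}}=\pi(T_{2i,i})$, where $$\pi:H^{\otimes 2i}\otimes(H^*)^{\otimes i}\to\textstyle\bigwedge^iU,\qquad \Bigl(\bigotimes_{j=1}^i (a_j\otimes b_j)\Bigr)\otimes\Bigl(\bigotimes_{j=1}^i c_j\Bigr)\mapsto\bigwedge_{j=1}^i\bigl((a_j\wedge b_j)\otimes c_j\bigr).$$ **Theorem.** For every $i\ge 0$ there is a polynomial $P'_i(T)\in\mathbb Q[T]$ of degree exactly $3i$ such that for all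 $n\ge 3i$: 1. the $\mathrm{GL}(n,\mathbb Q)$-representation $H^A_i(\mathrm{IO}_n,\mathbb Q)$ contains a subrepresentation isomorphic to $H_i(U,\mathbb Q)^{\mathrm{tl}}$; more precisely, there is an isomorphism $e$ of $H_i(U,\mathbb Q)^{\mathrm{tl}}$ onto a subrepresentation of $H^A_i(\mathrm{IO}_n,\mathbb Q)$ with $\tau^O_*(e(x))=(\bigwedge^i\mathrm{pr})(x)$ for all $x$; 2. $\dim_{\mathbb Q}H_i(U,\mathbb Q)^{\mathrm{tl}}=P'_i(n)$, and hence $\dim_{\mathbb Q}H^A_i(\mathrm{IO}_n,\mathbb Q)\ge P'_i(n)$. -/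

import Mathlib

open scoped TensorProduct

noncomputable section

namespace OuterTorelli

/-! ### Exterior powers as representations -/

section Exterior

theorem update_pair_zero {V : Type} (a b x : V) : Function.update ![a, b] 0 x = ![x, b] := by
  funext i; fin_cases i <;> rfl

theorem update_pair_one {V : Type} (a b x : V) : Function.update ![a, b] 1 x = ![a, x] := by
  funext i; fin_cases i <;> rfl

/-- The bilinear map `(a, b) ↦ a ∧ b` from `V × V` to `⋀² V`. -/
def wedge (V : Type) [AddCommGroup V] [Module ℚ V] : V →ₗ[ℚ] V →ₗ[ℚ] ⋀[ℚ]^2 V :=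
  LinearMap.mk₂ ℚ (fun a b => exteriorPower.ιMulti ℚ 2 ![a, b])
    (fun a a' b => by
      have := (exteriorPower.ιMulti ℚ 2).map_update_add ![a, b] 0 a a'
      simpa only [update_pair_zero] using this)
    (fun c a b => by
      have := (exteriorPower.ιMulti ℚ 2).map_update_smul ![a, b] 0 c a
      simpa only [update_pair_zero] using this)
    (fun a b b' => by
      have := (exteriorPower.ιMulti ℚ 2).map_update_add ![a, b] 1 b b'
      simpa only [update_pair_one] using this)
    (fun c a b => by
      have := (exteriorPower.ιMulti ℚ 2).map_update_smul ![a, b] 1 c b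
      simpa only [update_pair_one] using this)

variable {V : Type} [AddCommGroup V] [Module ℚ V]

theorem wedge_apply (a b : V) : wedge V a b = exteriorPower.ιMulti ℚ 2 ![a, b] := rfl

theorem wedge_self (a : V) : wedge V a a = 0 :=
  (exteriorPower.ιMulti ℚ 2).map_eq_zero_of_eq ![a, a] (i := 0) (j := 1) rfl (by decide)

theorem wedge_swap (a b : V) : wedge V b a = - wedge V a b := by
  have h := wedge_self (a + b)
  simp only [map_add, LinearMap.add_apply, wedge_self, zero_add, add_zero] at h
  exact eq_neg_of_add_eq_zero_left h

theorem map_wedge {W : Type} [AddCommGroup W] [Module ℚ W] (f : V →ₗ[ℚ] W) (a b : V) :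
    exteriorPower.map 2 f (wedge V a b) = wedge W (f a) (f b) := by
  rw [wedge_apply, wedge_apply, exteriorPower.map_apply_ιMulti]
  congr 1
  ext i
  fin_cases i <;> rfl

/-- The `i`-th exterior power of a representation. -/
def extRep {G : Type} [Group G] (ρ : Representation ℚ G V) (i : ℕ) :
    Representation ℚ G (⋀[ℚ]^i V) where
  toFun g := exteriorPower.map i (ρ g)
  map_one' := by
    rw [map_one, Module.End.one_eq_id, exteriorPower.map_id, Module.End.one_eq_id]
  map_mul' g h := by
    rw [map_mul, Module.End.mul_eq_comp, exteriorPower.map_comp, Module.End.mul_eq_comp]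

end Exterior

/-! ### The representations `H`, `U = Hom(H, ⋀² H)` and `Uᴼ = U / H` of `GL(n, ℚ)` -/

/-- `H = H₁(Fₙ; ℚ)`, with its basis given by the free generators. -/
abbrev H (n : ℕ) : Type := Fin n → ℚ

/-- The standard representation of `GL(n, ℚ)` on `H`. -/
def stdRep (n : ℕ) : Representation ℚ (GL (Fin n) ℚ) (H n) where
  toFun g := Matrix.toLin' (g : Matrix (Fin n) (Fin n) ℚ)
  map_one' := by simp [Module.End.one_eq_id]
  map_mul' g h := by simp [Matrix.toLin'_mul, Module.End.mul_eq_comp]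

/-- `U = Hom(H, ⋀² H)`. -/
abbrev U (n : ℕ) : Type := H n →ₗ[ℚ] ⋀[ℚ]^2 (H n)

instance instAddCommGroupU (n : ℕ) : AddCommGroup (U n) := LinearMap.addCommGroup

instance instModuleU (n : ℕ) : Module ℚ (U n) := LinearMap.module

/-- The action of `GL(n, ℚ)` on `U`: `g` sends `f` to `⋀² g ∘ f ∘ g⁻¹`. -/
def uRep (n : ℕ) : Representation ℚ (GL (Fin n) ℚ) (U n) :=
  Representation.linHom (stdRep n) (extRep (stdRep n) 2)

/-- The copy of `H` in `U`: the range of `h ↦ (x ↦ h ∧ x)`. -/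
def hInU (n : ℕ) : Submodule ℚ (U n) := LinearMap.range (wedge (H n))

theorem hInU_le_comap (n : ℕ) (g : GL (Fin n) ℚ) :
    hInU n ≤ (hInU n).comap (uRep n g) := by
  rintro _ ⟨h, rfl⟩
  refine ⟨stdRep n g h, ?_⟩
  refine LinearMap.ext fun x => ?_
  change _ = exteriorPower.map 2 (stdRep n g) (wedge (H n) h (stdRep n g⁻¹ x))
  rw [map_wedge, ← Module.End.mul_apply, ← map_mul, mul_inv_cancel, map_one, Module.End.one_apply]

/-- `Uᴼ = Hom(H, ⋀² H) / H`. -/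
abbrev UO (n : ℕ) : Type := U n ⧸ hInU n

/-- The action of `GL(n, ℚ)` on `Uᴼ`. -/
def uoRep (n : ℕ) : Representation ℚ (GL (Fin n) ℚ) (UO n) :=
  (uRep n).quotient (hInU n) (hInU_le_comap n)

/-! ### The traceless part of `⋀^i U` -/

section Traceless

/-- `H^{⊗ p} ⊗ (H*)^{⊗ q}`. -/
abbrev Mixed (n p q : ℕ) : Type :=
  (⨂[ℚ] _ : Fin p, H n) ⊗[ℚ] (⨂[ℚ] _ : Fin q, Module.Dual ℚ (H n))

/-- The action of `GL(n, ℚ)` on `H^{⊗ p} ⊗ (H*)^{⊗ q}`. -/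
def mixedMap (n p q : ℕ) (g : GL (Fin n) ℚ) : Mixed n p q →ₗ[ℚ] Mixed n p q :=
  TensorProduct.map (PiTensorProduct.map fun _ => stdRep n g)
    (PiTensorProduct.map fun _ => (stdRep n).dual g)

/-- The map `V^{⊗ (p+1)} → V ⊗ V^{⊗ p}` which pulls out the `k`-th factor:
`v₀ ⊗ ⋯ ⊗ v_p ↦ v_k ⊗ (v₀ ⊗ ⋯ v̂_k ⋯ ⊗ v_p)`. -/
def pullOut (V : Type) [AddCommGroup V] [Module ℚ V] {p : ℕ} (k : Fin (p + 1)) :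
    (⨂[ℚ] _ : Fin (p + 1), V) →ₗ[ℚ] V ⊗[ℚ] (⨂[ℚ] _ : Fin p, V) :=
  PiTensorProduct.lift (LinearMap.uncurryMid k
    (LinearMap.mk
      ⟨fun v => (TensorProduct.mk ℚ V (⨂[ℚ] _ : Fin p, V) v).compMultilinearMap
          (PiTensorProduct.tprod ℚ),
        fun v w => by ext m; simp⟩
      fun c v => by ext m; simp [TensorProduct.smul_tmul']))

theorem pullOut_tprod (V : Type) [AddCommGroup V] [Module ℚ V] {p : ℕ} (k : Fin (p + 1))
    (v : Fin (p + 1) → V) :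
    pullOut V k (PiTensorProduct.tprod ℚ v) =
      v k ⊗ₜ[ℚ] PiTensorProduct.tprod ℚ (fun j => v (k.succAbove j)) := by
  simp [pullOut]
  rfl

/-- The contraction map `c_{k,l} : H^{⊗ (p+1)} ⊗ (H*)^{⊗ (q+1)} → H^{⊗ p} ⊗ (H*)^{⊗ q}`. -/
def contraction (n : ℕ) {p q : ℕ} (k : Fin (p + 1)) (l : Fin (q + 1)) :
    Mixed n (p + 1) (q + 1) →ₗ[ℚ] Mixed n p q :=
  (TensorProduct.lid ℚ (Mixed n p q)).toLinearMap ∘ₗ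
    (contractRight ℚ (H n)).rTensor (Mixed n p q) ∘ₗ
    (TensorProduct.tensorTensorTensorComm ℚ (H n) (⨂[ℚ] _ : Fin p, H n)
      (Module.Dual ℚ (H n)) (⨂[ℚ] _ : Fin q, Module.Dual ℚ (H n))).toLinearMap ∘ₗ
    TensorProduct.map (pullOut (H n) k) (pullOut (Module.Dual ℚ (H n)) l)

theorem contraction_tmul (n : ℕ) {p q : ℕ} (k : Fin (p + 1)) (l : Fin (q + 1))
    (v : Fin (p + 1) → H n) (f : Fin (q + 1) → Module.Dual ℚ (H n)) :
    contraction n k l (PiTensorProduct.tprod ℚ v ⊗ₜ[ℚ] PiTensorProduct.tprod ℚ f) =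
      f l (v k) • (PiTensorProduct.tprod ℚ (fun j => v (k.succAbove j)) ⊗ₜ[ℚ]
        PiTensorProduct.tprod ℚ (fun j => f (l.succAbove j))) := by
  simp [contraction, pullOut_tprod]

theorem mixed_ext {n p q : ℕ} {E : Type} [AddCommGroup E] [Module ℚ E]
    {φ ψ : Mixed n p q →ₗ[ℚ] E}
    (h : ∀ (v : Fin p → H n) (f : Fin q → Module.Dual ℚ (H n)),
      φ (PiTensorProduct.tprod ℚ v ⊗ₜ[ℚ] PiTensorProduct.tprod ℚ f) =
        ψ (PiTensorProduct.tprod ℚ v ⊗ₜ[ℚ] PiTensorProduct.tprod ℚ f)) : φ = ψ := by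
  refine TensorProduct.ext ?_
  refine PiTensorProduct.ext (MultilinearMap.ext fun v => ?_)
  exact PiTensorProduct.ext (MultilinearMap.ext fun f => h v f)

theorem contraction_equivariant (n : ℕ) {p q : ℕ} (k : Fin (p + 1)) (l : Fin (q + 1))
    (g : GL (Fin n) ℚ) :
    contraction n k l ∘ₗ mixedMap n (p + 1) (q + 1) g =
      mixedMap n p q g ∘ₗ contraction n k l := by
  refine mixed_ext (E := Mixed n p q) fun v f => ?_
  have key : (stdRep n).dual g (f l) (stdRep n g (v k)) = f l (v k) := by
    change f l (stdRep n g⁻¹ (stdRep n g (v k))) = f l (v k)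
    rw [← Module.End.mul_apply, ← map_mul, inv_mul_cancel, map_one, Module.End.one_apply]
  simp only [LinearMap.comp_apply, mixedMap, TensorProduct.map_tmul, PiTensorProduct.map_tprod,
    contraction_tmul, key, map_smul]

/-- The traceless part `T_{p,q}` of `H^{⊗ p} ⊗ (H*)^{⊗ q}`: the intersection of the kernels of all
contraction maps (all of the space when `p = 0` or `q = 0`). -/
def traceless (n : ℕ) : (p q : ℕ) → Submodule ℚ (Mixed n p q)
  | p + 1, q + 1 => ⨅ (k : Fin (p + 1)) (l : Fin (q + 1)), LinearMap.ker (contraction n k l)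
  | 0, _ => ⊤
  | _ + 1, 0 => ⊤

theorem mixedMap_mem_traceless (n : ℕ) (g : GL (Fin n) ℚ) :
    (p q : ℕ) → (t : Mixed n p q) → t ∈ traceless n p q → mixedMap n p q g t ∈ traceless n p q
  | p + 1, q + 1, t, ht => by
    simp only [traceless, Submodule.mem_iInf, LinearMap.mem_ker] at ht ⊢
    intro k l
    rw [← LinearMap.comp_apply, contraction_equivariant, LinearMap.comp_apply, ht, map_zero]
  | 0, _, _, _ => Submodule.mem_top
  | _ + 1, 0, _, _ => Submodule.mem_top

/-- The index (counted from zero) of the vector `a_j` in `a_0 ⊗ b_0 ⊗ a_1 ⊗ b_1 ⊗ ⋯`. -/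
def evenIdx {i : ℕ} (j : Fin i) : Fin (2 * i) := ⟨2 * j, by omega⟩

/-- The index (counted from zero) of the vector `b_j` in `a_0 ⊗ b_0 ⊗ a_1 ⊗ b_1 ⊗ ⋯`. -/
def oddIdx {i : ℕ} (j : Fin i) : Fin (2 * i) := ⟨2 * j + 1, by omega⟩

theorem pair_update {n i : ℕ} (v : Fin (2 * i) → H n) (m : Fin (2 * i)) (x : H n) :
    (fun j : Fin i => wedge (H n) (Function.update v m x (evenIdx j))
      (Function.update v m x (oddIdx j))) =
    Function.update (fun j : Fin i => wedge (H n) (v (evenIdx j)) (v (oddIdx j)))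
      ⟨m / 2, by omega⟩
      (if (m : ℕ) % 2 = 0 then wedge (H n) x (v (oddIdx ⟨m / 2, by omega⟩))
        else wedge (H n) (v (evenIdx ⟨m / 2, by omega⟩)) x) := by
  funext j
  by_cases hj : j = ⟨m / 2, by omega⟩
  · subst hj
    rw [Function.update_self]
    split_ifs with h
    · have h1 : evenIdx (i := i) ⟨m / 2, by omega⟩ = m := Fin.ext (by simp [evenIdx]; omega)
      have h2 : oddIdx (i := i) ⟨m / 2, by omega⟩ ≠ m := by
        intro h2; have := congrArg Fin.val h2; simp [oddIdx] at this; omega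
      rw [Function.update_of_ne h2]
      nth_rewrite 1 [h1]
      rw [Function.update_self]
    · have h1 : oddIdx (i := i) ⟨m / 2, by omega⟩ = m := Fin.ext (by simp [oddIdx]; omega)
      have h2 : evenIdx (i := i) ⟨m / 2, by omega⟩ ≠ m := by
        intro h2; have := congrArg Fin.val h2; simp [evenIdx] at this; omega
      rw [Function.update_of_ne h2]
      nth_rewrite 1 [h1]
      rw [Function.update_self]
  · have hj' : (j : ℕ) ≠ m / 2 := fun h => hj (Fin.ext h)
    have h1 : evenIdx j ≠ m := by
      intro h2; have := congrArg Fin.val h2; simp [evenIdx] at this; omega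
    have h2 : oddIdx j ≠ m := by
      intro h2; have := congrArg Fin.val h2; simp [oddIdx] at this; omega
    rw [Function.update_of_ne hj, Function.update_of_ne h1, Function.update_of_ne h2]

/-- The map `H^{⊗ 2i} → (⋀² H)^{⊗ i}`, `⨂_j (a_j ⊗ b_j) ↦ ⨂_j (a_j ∧ b_j)`. -/
def pairUp (n i : ℕ) : (⨂[ℚ] _ : Fin (2 * i), H n) →ₗ[ℚ] ⨂[ℚ] _ : Fin i, ⋀[ℚ]^2 (H n) :=
  PiTensorProduct.lift (MultilinearMap.mk'
    (fun v => PiTensorProduct.tprod ℚ fun j => wedge (H n) (v (evenIdx j)) (v (oddIdx j)))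
    (fun v m x y => by
      rw [pair_update, pair_update, pair_update, ← MultilinearMap.map_update_add]
      split_ifs <;> simp)
    (fun v m c x => by
      rw [pair_update, pair_update, ← MultilinearMap.map_update_smul]
      split_ifs <;> simp))

theorem pairUp_tprod (n i : ℕ) (v : Fin (2 * i) → H n) :
    pairUp n i (PiTensorProduct.tprod ℚ v) =
      PiTensorProduct.tprod ℚ fun j => wedge (H n) (v (evenIdx j)) (v (oddIdx j)) := by
  simp [pairUp]

/-- The map `π : H^{⊗ 2i} ⊗ (H*)^{⊗ i} → ⋀^i U`,
`(⨂_j (a_j ⊗ b_j)) ⊗ (⨂_j c_j) ↦ ⋀_j ((a_j ∧ b_j) ⊗ c_j)`, where `(a ∧ b) ⊗ c` stands for the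
homomorphism `x ↦ c(x) • (a ∧ b)`. -/
def toExtU (n i : ℕ) : Mixed n (2 * i) i →ₗ[ℚ] ⋀[ℚ]^i (U n) :=
  TensorProduct.lift
    (((PiTensorProduct.map₂ fun _ : Fin i =>
        (LinearMap.smulRightₗ (R := ℚ) (M := ⋀[ℚ]^2 (H n)) (M₂ := H n)).flip).compr₂
      (PiTensorProduct.lift (exteriorPower.ιMulti ℚ i (M := U n)).toMultilinearMap)) ∘ₗ pairUp n i)

theorem toExtU_tmul (n i : ℕ) (v : Fin (2 * i) → H n) (f : Fin i → Module.Dual ℚ (H n)) :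
    toExtU n i (PiTensorProduct.tprod ℚ v ⊗ₜ[ℚ] PiTensorProduct.tprod ℚ f) =
      exteriorPower.ιMulti ℚ i fun j =>
        (f j).smulRight (wedge (H n) (v (evenIdx j)) (v (oddIdx j))) := by
  simp only [toExtU, TensorProduct.lift.tmul, LinearMap.comp_apply, LinearMap.compr₂_apply,
    pairUp_tprod, PiTensorProduct.map₂_tprod_tprod, PiTensorProduct.lift.tprod]
  rfl

theorem toExtU_equivariant (n i : ℕ) (g : GL (Fin n) ℚ) :
    toExtU n i ∘ₗ mixedMap n (2 * i) i g = extRep (uRep n) i g ∘ₗ toExtU n i := by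
  refine mixed_ext fun v f => ?_
  simp only [LinearMap.comp_apply, mixedMap, TensorProduct.map_tmul, PiTensorProduct.map_tprod,
    toExtU_tmul]
  change _ = exteriorPower.map i (uRep n g) _
  rw [exteriorPower.map_apply_ιMulti]
  congr 1
  funext j
  refine LinearMap.ext fun x => ?_
  change f j (stdRep n g⁻¹ x) • wedge (H n) (stdRep n g (v (evenIdx j)))
      (stdRep n g (v (oddIdx j))) =
    exteriorPower.map 2 (stdRep n g)
      (f j (stdRep n g⁻¹ x) • wedge (H n) (v (evenIdx j)) (v (oddIdx j)))
  rw [map_smul, map_wedge]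

/-- The traceless part `Hᵢ(U; ℚ)^tl = π(T_{2i,i})` of `Hᵢ(U; ℚ) = ⋀^i U`, as a subrepresentation
of `⋀^i U`. -/
def tl (n i : ℕ) : Subrepresentation (extRep (uRep n) i) where
  toSubmodule := (traceless n (2 * i) i).map (toExtU n i)
  apply_mem_toSubmodule g := by
    rintro _ ⟨t, ht, rfl⟩
    refine ⟨mixedMap n (2 * i) i g t, mixedMap_mem_traceless n g _ _ t ht, ?_⟩
    rw [← LinearMap.comp_apply, toExtU_equivariant, LinearMap.comp_apply]

end Traceless

/-! ### The groups `IAₙ`, `Out(Fₙ)` and `IOₙ` -/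

/-- The free group `Fₙ`. -/
abbrev Fr (n : ℕ) : Type := FreeGroup (Fin n)

/-- The action of `Aut(Fₙ)` on `H₁(Fₙ; ℤ) = Fₙ^ab ≅ ℤⁿ`, i.e. the map `Aut(Fₙ) → GL(n, ℤ)`. -/
def autToAb (n : ℕ) : MulAut (Fr n) →* MulAut (Abelianization (Fr n)) where
  toFun φ := φ.abelianizationCongr
  map_one' := abelianizationCongr_refl
  map_mul' φ ψ := (abelianizationCongr_trans ψ φ).symm

/-- The IA-automorphism group `IAₙ`. -/
def IA (n : ℕ) : Subgroup (MulAut (Fr n)) := (autToAb n).ker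

/-- The inner automorphism group `Inn(Fₙ)`. -/
def Inn (n : ℕ) : Subgroup (MulAut (Fr n)) := (MulAut.conj (G := Fr n)).range

instance instNormalInn (n : ℕ) : (Inn n).Normal where
  conj_mem := by
    rintro _ ⟨w, rfl⟩ φ
    refine ⟨φ w, ?_⟩
    ext x
    simp [MulAut.mul_apply]

/-- The outer automorphism group `Out(Fₙ)`. -/
abbrev OutF (n : ℕ) : Type := MulAut (Fr n) ⧸ Inn n

theorem mem_IA {n : ℕ} {φ : MulAut (Fr n)} :
    φ ∈ IA n ↔ ∀ w, Abelianization.of (φ w) = Abelianization.of w := by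
  constructor
  · intro h w
    have := DFunLike.congr_fun (MonoidHom.mem_ker.1 h) (Abelianization.of w)
    simpa [autToAb] using this
  · intro h
    refine MonoidHom.mem_ker.2 (MulEquiv.ext fun x => ?_)
    obtain ⟨w, rfl⟩ := QuotientGroup.mk_surjective x
    exact h w

theorem Inn_le_IA (n : ℕ) : Inn n ≤ IA n := by
  rintro _ ⟨w, rfl⟩
  refine mem_IA.2 fun x => ?_
  simp [MulAut.conj_apply, mul_comm (Abelianization.of w)]

/-- The map `Out(Fₙ) → Aut(Fₙ^ab) = GL(n, ℤ)`. -/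
def outToAb (n : ℕ) : OutF n →* MulAut (Abelianization (Fr n)) :=
  QuotientGroup.lift (Inn n) (autToAb n) (Inn_le_IA n)

/-- The group `IOₙ`, the kernel of `Out(Fₙ) → GL(n, ℤ)`. -/
def OutIA (n : ℕ) : Subgroup (OutF n) := (outToAb n).ker

/-- The canonical projection `π : IAₙ → IOₙ`. -/
def projIA (n : ℕ) : IA n →* OutIA n :=
  ((QuotientGroup.mk' (Inn n)).comp (IA n).subtype).codRestrict (OutIA n) fun φ => φ.2

theorem projIA_surjective (n : ℕ) : Function.Surjective (projIA n) := by
  rintro ⟨x, hx⟩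
  obtain ⟨φ, rfl⟩ := QuotientGroup.mk_surjective x
  exact ⟨⟨φ, hx⟩, rfl⟩

/-! ### The Johnson homomorphism -/

/-- The free two-step nilpotent group `H × ⋀² H` over `ℚ`, with multiplication
`(a, u) (b, v) = (a + b, u + v + ½ a ∧ b)`. The commutator of `(a, u)` and `(b, v)` is
`(0, a ∧ b)`. -/
@[ext]
structure Nil (n : ℕ) where
  /-- The component in `H`. -/
  fst : H n
  /-- The component in `⋀² H`. -/
  snd : ⋀[ℚ]^2 (H n)

namespace Nil

variable {n : ℕ}

instance instMul : Mul (Nil n) :=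
  ⟨fun x y => ⟨x.fst + y.fst, x.snd + y.snd + (1 / 2 : ℚ) • wedge (H n) x.fst y.fst⟩⟩

instance instOne : One (Nil n) := ⟨⟨0, 0⟩⟩

instance instInv : Inv (Nil n) := ⟨fun x => ⟨-x.fst, -x.snd⟩⟩

theorem mul_fst (x y : Nil n) : (x * y).fst = x.fst + y.fst := rfl

theorem mul_snd (x y : Nil n) :
    (x * y).snd = x.snd + y.snd + (1 / 2 : ℚ) • wedge (H n) x.fst y.fst := rfl

theorem one_fst : (1 : Nil n).fst = 0 := rfl

theorem one_snd : (1 : Nil n).snd = 0 := rfl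

theorem inv_fst (x : Nil n) : (x⁻¹).fst = -x.fst := rfl

theorem inv_snd (x : Nil n) : (x⁻¹).snd = -x.snd := rfl

instance instGroup : Group (Nil n) :=
  Group.ofLeftAxioms
    (fun x y z => by
      ext1
      · simp only [mul_fst, add_assoc]
      · simp only [mul_fst, mul_snd, map_add, LinearMap.add_apply, smul_add]
        abel)
    (fun x => by
      ext1
      · simp only [mul_fst, one_fst, zero_add]
      · simp only [mul_snd, one_fst, one_snd, map_zero, LinearMap.zero_apply, smul_zero, zero_add,
          add_zero])
    (fun x => by
      ext1
      · simp only [mul_fst, inv_fst, one_fst, neg_add_cancel]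
      · simp only [mul_snd, inv_fst, inv_snd, one_snd, map_neg, LinearMap.neg_apply, wedge_self,
          neg_zero, smul_zero, add_zero, neg_add_cancel])

/-- The automorphism `(a, u) ↦ (a, u + T a)` attached to `T : H → ⋀² H`. -/
def shear (T : U n) : Nil n →* Nil n where
  toFun x := ⟨x.fst, x.snd + T x.fst⟩
  map_one' := by
    ext1
    · rfl
    · change (0 : ⋀[ℚ]^2 (H n)) + T 0 = 0
      rw [map_zero, add_zero]
  map_mul' x y := by
    ext1
    · rfl
    · simp only [mul_snd, mul_fst, map_add]
      abel

end Nil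

/-- The homomorphism `Fₙ → H × ⋀² H` which sends the `j`-th generator to `(e_j, 0)`. It induces the
embedding of `Fₙ / Γ₃Fₙ`; on the commutator subgroup it is `[x, y] ↦ (0, [x] ∧ [y])`. -/
def theta (n : ℕ) : Fr n →* Nil n := FreeGroup.lift fun j => ⟨Pi.single j 1, 0⟩

/-- The homomorphism `T : H → ⋀² H` which sends `e_j` to the class of `φ(x_j) x_j⁻¹` in
`Γ₂Fₙ / Γ₃Fₙ ⊗ ℚ = ⋀² H`. -/
def johnsonFun (n : ℕ) (φ : MulAut (Fr n)) : U n :=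
  (Pi.basisFun ℚ (Fin n)).constr ℚ fun j =>
    (theta n (φ (FreeGroup.of j) * (FreeGroup.of j)⁻¹)).snd

theorem johnsonFun_single (n : ℕ) (φ : MulAut (Fr n)) (j : Fin n) :
    johnsonFun n φ (Pi.single j 1) = (theta n (φ (FreeGroup.of j) * (FreeGroup.of j)⁻¹)).snd := by
  have := (Pi.basisFun ℚ (Fin n)).constr_basis ℚ
    (fun j => (theta n (φ (FreeGroup.of j) * (FreeGroup.of j)⁻¹)).snd) j
  rwa [Pi.basisFun_apply] at this

theorem theta_of (n : ℕ) (j : Fin n) : theta n (FreeGroup.of j) = ⟨Pi.single j 1, 0⟩ := by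
  simp [theta]

/-- The map `(a, u) ↦ a`. -/
def nilFst (n : ℕ) : Nil n →* Multiplicative (H n) where
  toFun x := Multiplicative.ofAdd x.fst
  map_one' := rfl
  map_mul' _ _ := rfl

theorem theta_fst {n : ℕ} {φ : MulAut (Fr n)} (hφ : φ ∈ IA n) (w : Fr n) :
    (theta n (φ w)).fst = (theta n w).fst := by
  have h := mem_IA.1 hφ w
  have := congrArg (Abelianization.lift ((nilFst n).comp (theta n))) h
  simpa [nilFst] using this

theorem theta_IA {n : ℕ} {φ : MulAut (Fr n)} (hφ : φ ∈ IA n) (w : Fr n) :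
    theta n (φ w) = Nil.shear (johnsonFun n φ) (theta n w) := by
  have : (theta n).comp φ.toMonoidHom = (Nil.shear (johnsonFun n φ)).comp (theta n) := by
    refine FreeGroup.ext_hom _ _ fun j => ?_
    change theta n (φ (FreeGroup.of j)) = Nil.shear (johnsonFun n φ) (theta n (FreeGroup.of j))
    have h1 := theta_fst hφ (FreeGroup.of j)
    have h2 := johnsonFun_single n φ j
    rw [map_mul, map_inv] at h2
    rw [theta_of] at h1 h2 ⊢
    simp only [Nil.mul_snd, Nil.inv_fst, Nil.inv_snd, h1, map_neg, wedge_self, neg_zero, smul_zero,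
      add_zero] at h2
    ext1
    · exact h1
    · change _ = 0 + johnsonFun n φ (Pi.single j 1)
      rw [h2, zero_add]
  exact DFunLike.congr_fun this w

/-- The Johnson homomorphism `τ : IAₙ → U = Hom(H, ⋀² H)`. -/
def johnson (n : ℕ) : IA n →* Multiplicative (U n) where
  toFun φ := Multiplicative.ofAdd (johnsonFun n φ)
  map_one' := by
    refine congrArg Multiplicative.ofAdd ((Pi.basisFun ℚ (Fin n)).ext fun j => ?_)
    rw [Pi.basisFun_apply, johnsonFun_single]
    simp [Nil.one_snd]
  map_mul' φ ψ := by
    refine congrArg Multiplicative.ofAdd ((Pi.basisFun ℚ (Fin n)).ext fun j => ?_)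
    have h1 := theta_IA (φ * ψ).2 (FreeGroup.of j)
    change theta n ((φ : MulAut (Fr n)) ((ψ : MulAut (Fr n)) (FreeGroup.of j))) = _ at h1
    rw [theta_IA φ.2, theta_IA ψ.2, theta_of] at h1
    have h2 := congrArg Nil.snd h1
    change 0 + johnsonFun n ψ (Pi.single j 1) + johnsonFun n φ (Pi.single j 1) =
      0 + johnsonFun n (φ * ψ : IA n) (Pi.single j 1) at h2
    rw [zero_add, zero_add] at h2
    rw [Pi.basisFun_apply, ← h2, add_comm]
    rfl

theorem johnson_conj (n : ℕ) (w : Fr n) :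
    johnsonFun n (MulAut.conj w) = wedge (H n) (theta n w).fst := by
  refine (Pi.basisFun ℚ (Fin n)).ext fun j => ?_
  rw [Pi.basisFun_apply, johnsonFun_single, MulAut.conj_apply]
  simp only [map_mul, map_inv, theta_of, Nil.mul_snd, Nil.mul_fst, Nil.inv_fst, Nil.inv_snd,
    map_neg, map_add, LinearMap.add_apply, LinearMap.neg_apply, wedge_self]
  rw [wedge_swap (theta n w).fst (Pi.single j 1)]
  module

/-- The composite `IAₙ → U → Uᴼ`. -/
def johnsonQuot (n : ℕ) : IA n →* Multiplicative (UO n) :=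
  (AddMonoidHom.toMultiplicative (hInU n).mkQ.toAddMonoidHom).comp (johnson n)

theorem ker_projIA_le (n : ℕ) : (projIA n).ker ≤ (johnsonQuot n).ker := by
  rintro ⟨φ, hφ⟩ h
  have h' : QuotientGroup.mk' (Inn n) φ = 1 := congrArg Subtype.val (MonoidHom.mem_ker.1 h)
  obtain ⟨w, hw⟩ := (QuotientGroup.eq_one_iff φ).1 h'
  refine MonoidHom.mem_ker.2 (congrArg Multiplicative.ofAdd ?_)
  refine (Submodule.Quotient.mk_eq_zero (hInU n)).2 ?_
  change johnsonFun n φ ∈ hInU n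
  rw [← hw, johnson_conj]
  exact ⟨_, rfl⟩

/-- The Johnson homomorphism `τᴼ : IOₙ → Uᴼ`, the unique homomorphism with `τᴼ ∘ π = pr ∘ τ`. -/
def johnsonOut (n : ℕ) : OutIA n →* Multiplicative (UO n) :=
  (projIA n).liftOfSurjective (projIA_surjective n) ⟨johnsonQuot n, ker_projIA_le n⟩

theorem johnsonOut_projIA (n : ℕ) (φ : IA n) :
    johnsonOut n (projIA n φ) =
      Multiplicative.ofAdd (Submodule.Quotient.mk (johnsonFun n φ) : UO n) :=
  MonoidHom.liftOfRightInverse_comp_apply _ _ _ ⟨johnsonQuot n, ker_projIA_le n⟩ φ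

/-! ### Rational group homology and Albanese homology -/

/-- `Hᵢ(G; ℚ)`. -/
abbrev Homology (G : Type) [Group G] (i : ℕ) : Type := groupHomology (Rep.trivial ℚ G ℚ) i

/-- The map `Hᵢ(G; ℚ) → Hᵢ(K; ℚ)` induced by a group homomorphism. -/
def homologyMap {G K : Type} [Group G] [Group K] (f : G →* K) (i : ℕ) :
    Homology G i →ₗ[ℚ] Homology K i :=
  (groupHomology.map (A := Rep.trivial ℚ G ℚ) (B := Rep.trivial ℚ K ℚ) f
    (Rep.ofHom ⟨LinearMap.id, fun _ => rfl⟩) i).hom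

/-- The Albanese homology `Hᴬᵢ(G; ℚ)`, the image of `Hᵢ(G; ℚ) → Hᵢ(H₁(G; ℤ); ℚ)`. -/
def Albanese (G : Type) [Group G] (i : ℕ) : Submodule ℚ (Homology (Abelianization G) i) :=
  LinearMap.range (homologyMap (Abelianization.of (G := G)) i)

section ExtClass

open CategoryTheory

variable {V : Type} [AddCommGroup V] [Module ℚ V]

/-- On inhomogeneous chains: `[v₁ | ⋯ | vᵢ] ↦ (1 / i!) v₁ ∧ ⋯ ∧ vᵢ`. -/
def extChain (V : Type) [AddCommGroup V] [Module ℚ V] (i : ℕ) :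
    ((Fin i → Multiplicative V) →₀ ℚ) →ₗ[ℚ] ⋀[ℚ]^i V :=
  Finsupp.lsum ℚ fun v => LinearMap.toSpanSingleton ℚ _
    ((1 / (i.factorial : ℚ)) • exteriorPower.ιMulti ℚ i fun j => (v j).toAdd)

theorem extChain_single (i : ℕ) (v : Fin i → Multiplicative V) (a : ℚ) :
    extChain V i (Finsupp.single v a) =
      a • (1 / (i.factorial : ℚ)) • exteriorPower.ιMulti ℚ i fun j => (v j).toAdd := by
  simp [extChain]

theorem contractNth_castSucc (i : ℕ) (v : Fin (i + 1) → V) (j : Fin i) :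
    exteriorPower.ιMulti ℚ i (Fin.contractNth j.castSucc (· + ·) v) =
      exteriorPower.ιMulti ℚ i (j.succ.removeNth v) +
        exteriorPower.ιMulti ℚ i (j.castSucc.removeNth v) := by
  have h1 : Fin.contractNth j.castSucc (· + ·) v =
      Function.update (j.castSucc.removeNth v) j (v j.castSucc + v j.succ) := by
    funext k
    by_cases hk : k = j
    · subst hk
      rw [Fin.contractNth_apply_of_eq _ _ _ _ (by simp), Function.update_self]
    · rw [Function.update_of_ne hk, Fin.contractNth_apply_of_ne]
      · rfl
      · intro h; exact hk (Fin.ext (by simpa using h.symm))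
  have h2 : Function.update (j.castSucc.removeNth v) j (v j.castSucc) = j.succ.removeNth v := by
    funext k
    by_cases hk : k = j
    · subst hk
      rw [Function.update_self]
      simp [Fin.removeNth]
    · rw [Function.update_of_ne hk]
      simp only [Fin.removeNth]
      rcases lt_or_gt_of_ne hk with h | h
      · rw [Fin.succAbove_of_castSucc_lt _ _ (by simpa using h),
          Fin.succAbove_of_castSucc_lt _ _ (by
            rw [Fin.lt_def] at h ⊢; simp; omega)]
      · rw [Fin.succAbove_of_le_castSucc _ _ (by
            rw [Fin.lt_def] at h; rw [Fin.le_def]; simp; omega),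
          Fin.succAbove_of_le_castSucc _ _ (by
            rw [Fin.lt_def] at h; rw [Fin.le_def]; simp; omega)]
  have h3 : Function.update (j.castSucc.removeNth v) j (v j.succ) = j.castSucc.removeNth v := by
    conv_rhs => rw [← Function.update_eq_self j (j.castSucc.removeNth v)]
    congr 1
    simp [Fin.removeNth]
  rw [h1, AlternatingMap.map_update_add, h2, h3]

theorem ext_boundary (i : ℕ) (v : Fin (i + 1) → V) :
    exteriorPower.ιMulti ℚ i (fun j => v j.succ) +
      ∑ j : Fin (i + 1), (-1 : ℚ) ^ ((j : ℕ) + 1) •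
        exteriorPower.ιMulti ℚ i (Fin.contractNth j (· + ·) v) = 0 := by
  rw [Fin.sum_univ_castSucc]
  simp only [contractNth_castSucc]
  have hlast : Fin.contractNth (Fin.last i) (· + ·) v = (Fin.last i).removeNth v := by
    funext k
    rw [Fin.contractNth_apply_of_ne _ _ _ _ (by simpa using k.2.ne')]
    rfl
  have htail : (fun j : Fin i => v j.succ) = (0 : Fin (i + 1)).removeNth v := by
    simp [Fin.removeNth_zero, Fin.tail_def]
  rw [hlast, htail]
  set a : Fin (i + 1) → ⋀[ℚ]^i V := fun j => exteriorPower.ιMulti ℚ i (j.removeNth v) with ha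
  change a 0 + (∑ j : Fin i, (-1 : ℚ) ^ ((j.castSucc : ℕ) + 1) • (a j.succ + a j.castSucc) +
    (-1 : ℚ) ^ ((Fin.last i : ℕ) + 1) • a (Fin.last i)) = 0
  have h1 : ∀ j : Fin i, (-1 : ℚ) ^ ((j.castSucc : ℕ) + 1) • (a j.succ + a j.castSucc) =
      (-1 : ℚ) ^ (j.succ : ℕ) • a j.succ - (-1 : ℚ) ^ (j.castSucc : ℕ) • a j.castSucc := by
    intro j
    simp only [Fin.val_castSucc, Fin.val_succ, pow_succ]
    module
  simp only [h1, Finset.sum_sub_distrib]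
  have e1 := Fin.sum_univ_succ (fun j : Fin (i + 1) => (-1 : ℚ) ^ (j : ℕ) • a j)
  have e2 := Fin.sum_univ_castSucc (fun j : Fin (i + 1) => (-1 : ℚ) ^ (j : ℕ) • a j)
  rw [e1] at e2
  simp only [Fin.val_zero, pow_zero, one_smul] at e2
  rw [← sub_eq_zero] at e2
  rw [← e2, pow_succ]
  module

theorem d_extChain (V : Type) [AddCommGroup V] [Module ℚ V] (i : ℕ) :
    (groupHomology.inhomogeneousChains (Rep.trivial ℚ (Multiplicative V) ℚ)).d (i + 1) i ≫
      ModuleCat.ofHom (extChain V i) = 0 := by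
  rw [groupHomology.inhomogeneousChains.d_def]
  refine groupHomology.inhomogeneousChains.ext (A := Rep.trivial ℚ (Multiplicative V) ℚ)
    fun v => ModuleCat.hom_ext (LinearMap.ext fun a => ?_)
  change extChain V i (groupHomology.inhomogeneousChains.d (Rep.trivial ℚ (Multiplicative V) ℚ) i
    (Finsupp.single v a)) = 0
  rw [groupHomology.inhomogeneousChains.d_single]
  have h := ext_boundary i fun j => (v j).toAdd
  have h' := congrArg (fun x => a • (1 / (i.factorial : ℚ)) • x) h
  simp only [smul_zero, smul_add, Finset.smul_sum] at h'
  rw [← h', map_add, map_sum, extChain_single]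
  congr 1
  refine Finset.sum_congr rfl fun j _ => ?_
  rw [map_smul, extChain_single, smul_comm, smul_comm (1 / (i.factorial : ℚ))]
  congr 4

/-- The isomorphism `Hᵢ(V; ℚ) ≅ ⋀^i V` for a rational vector space `V`, regarded as an abelian
group: it sends the class of the cycle `∑_σ sgn(σ) [v_σ(1) | ⋯ | v_σ(i)]` to `v₁ ∧ ⋯ ∧ vᵢ`. -/
def homologyToExt (V : Type) [AddCommGroup V] [Module ℚ V] (i : ℕ) :
    Homology (Multiplicative V) i →ₗ[ℚ] ⋀[ℚ]^i V :=
  ((groupHomology.inhomogeneousChains (Rep.trivial ℚ (Multiplicative V) ℚ)).homologyι i ≫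
    (groupHomology.inhomogeneousChains (Rep.trivial ℚ (Multiplicative V) ℚ)).descOpcycles
      (ModuleCat.ofHom (extChain V i)) (i + 1) (ChainComplex.prev ℕ i) (d_extChain V i)).hom

theorem homologyToExt_π (V : Type) [AddCommGroup V] [Module ℚ V] (i : ℕ)
    (z : groupHomology.cycles (Rep.trivial ℚ (Multiplicative V) ℚ) i) :
    homologyToExt V i (groupHomology.π (Rep.trivial ℚ (Multiplicative V) ℚ) i z) =
      extChain V i (groupHomology.iCycles (Rep.trivial ℚ (Multiplicative V) ℚ) i z) := by
  have h : (groupHomology.inhomogeneousChains (Rep.trivial ℚ (Multiplicative V) ℚ)).homologyπ i ≫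
      ((groupHomology.inhomogeneousChains (Rep.trivial ℚ (Multiplicative V) ℚ)).homologyι i ≫
      (groupHomology.inhomogeneousChains (Rep.trivial ℚ (Multiplicative V) ℚ)).descOpcycles
        (ModuleCat.ofHom (extChain V i)) (i + 1) (ChainComplex.prev ℕ i) (d_extChain V i)) =
      (groupHomology.inhomogeneousChains (Rep.trivial ℚ (Multiplicative V) ℚ)).iCycles i ≫
        ModuleCat.ofHom (extChain V i) := by
    rw [← Category.assoc, HomologicalComplex.homology_π_ι, Category.assoc,
      HomologicalComplex.p_descOpcycles]
  exact congrArg (fun φ => φ.hom z) h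

end ExtClass

/-- The map `Hᵢ(IOₙ^ab; ℚ) → Hᵢ(Uᴼ; ℚ) = ⋀^i Uᴼ` induced by the Johnson homomorphism `τᴼ`. -/
def johnsonHom (n i : ℕ) : Homology (Abelianization (OutIA n)) i →ₗ[ℚ] ⋀[ℚ]^i (UO n) :=
  homologyToExt (UO n) i ∘ₗ homologyMap (Abelianization.lift (johnsonOut n)) i

end OuterTorelli

end

/-! Let I be the image of Hᵢ(IOₙ; ℚ) in ⋀^i Uᴼ under τᴼ; it is also the image of the Albanese
homology. The theorem reduces to four facts: I is stable under GL(n, ℚ), I contains the image of the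
traceless part, the traceless part embeds in ⋀^i Uᴼ, and its dimension is a polynomial in n of
degree 3i.

Abelian cycles. If c is injective and its letters do not occur among the a_j and b_j, the
automorphisms x_{c_j} ↦ [x_{a_j}, x_{b_j}] x_{c_j} lie in IAₙ and commute. Commuting elements give
an antisymmetrised cycle, whose image is the wedge of the classes of (a_j ∧ b_j) ⊗ c_j*
(`basisTensor_mem_albanesePreimage`).

Stability. Conjugation by Aut(Fₙ) makes I stable under elementary matrices with entry 1. The action
is polynomial in the entry, so stability extends to all rational entries and to the Lie algebra
(`elemGL_stable`), and then to diagonal matrices (`mixedStabilizer_eq_top`).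

Generation. For p + q ≤ n, the basis tensors with distinct letters generate all traceless tensors
under gl (`traceless_le`). The coordinate form is positive definite and the elementary operators x,
y and y, x are adjoint, so it is enough that a gl-stable space of traceless tensors whose
coordinates vanish on disjoint words is zero. There invariance turns a trace relation into an
expression of n times a coordinate by p + q - 2 or fewer coordinates of the same kind, and a
coordinate of maximal absolute value must vanish (`onePair_eq_zero`).

Injectivity. The contraction U → H is multiplication by 1 - n on H ⊂ U and vanishes on traceless
decomposables. It therefore gives a projection of U which kills H and whose exterior power fixes the
traceless part (`map_kernelProj_of_mem_tl`).

Dimension. The traceless part is the image of T_{2i,i} under a signed symmetrizer over a group of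
order 2^i i!, so its dimension is a signed average of traces of permutations of tensor factors.
Restriction from n + 1 to n letters decomposes such a trace over subsets of the positions
(`permTrace_option`). Hence its difference in n is a sum of traces with fewer factors, and by
induction it is a polynomial; only the identity contributes in degree 3i
(`permTrace_eq_polynomial`).

Injectivity of τᴼ_* on Albanese homology is never needed: GL(n, ℚ) is made to act trivially on the
kernel. -/

noncomputable section

namespace OuterTorelli

/-! ### Mixed tensors in coordinates -/

section Words

set_option linter.unusedSectionVars false

open Function

/-- The coordinates of mixed tensors: functions on pairs of words in the alphabet `L`. -/
abbrev Words (P Q L : Type) : Type := (P → L) × (Q → L) → ℚ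

variable {P Q L : Type} [Fintype P] [DecidableEq P] [Fintype Q] [DecidableEq Q]
  [Fintype L] [DecidableEq L]

variable (P Q L) in
/-- The traceless tensors in coordinates. -/
def tracelessWords : Submodule ℚ (Words P Q L) where
  carrier := {F | ∀ k l a c, ∑ x, F (update a k x, update c l x) = 0}
  zero_mem' := by intro k l a c; simp
  add_mem' := by
    intro F G hF hG k l a c
    simp only [Pi.add_apply, Finset.sum_add_distrib, hF k l a c, hG k l a c, add_zero]
  smul_mem' := by
    intro r F hF k l a c
    simp only [Pi.smul_apply, ← Finset.smul_sum, hF k l a c, smul_zero]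

theorem mem_tracelessWords {F : Words P Q L} :
    F ∈ tracelessWords P Q L ↔ ∀ k l a c, ∑ x, F (update a k x, update c l x) = 0 := Iff.rfl

/-- The action of the elementary matrix which sends `e_y` to `e_x`, as a derivation. -/
def glOp (x y : L) : Words P Q L →ₗ[ℚ] Words P Q L where
  toFun F w := (∑ k, if w.1 k = x then F (update w.1 k y, w.2) else 0) -
    ∑ l, if w.2 l = y then F (w.1, update w.2 l x) else 0
  map_add' F G := by
    funext w
    simp only [Pi.add_apply]
    rw [← add_sub_add_comm, ← Finset.sum_add_distrib, ← Finset.sum_add_distrib]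
    congr 1 <;> refine Finset.sum_congr rfl fun k _ => ?_ <;> split_ifs <;> simp
  map_smul' r F := by
    funext w
    simp only [Pi.smul_apply, smul_eq_mul, RingHom.id_apply, mul_sub, Finset.mul_sum]
    congr 1 <;> refine Finset.sum_congr rfl fun k _ => ?_ <;> split_ifs <;> simp

theorem glOp_apply (x y : L) (F : Words P Q L) (a : P → L) (c : Q → L) :
    glOp x y F (a, c) = (∑ k, if a k = x then F (update a k y, c) else 0) -
      ∑ l, if c l = y then F (a, update c l x) else 0 := rfl

/-- A pair of words in which the letters of the first word at the positions outside `Φ` do not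
occur in the second one. -/
def DisjOff (Φ : Finset P) (a : P → L) (c : Q → L) : Prop := ∀ k ∉ Φ, ∀ l, a k ≠ c l

/-- A pair of words which is disjoint outside `Φ` up to a single coincidence, at `(k, l)`. -/
def OnePair (Φ : Finset P) (k : P) (l : Q) (a : P → L) (c : Q → L) : Prop :=
  k ∉ Φ ∧ a k = c l ∧ (∀ k' ∉ Φ, k' ≠ k → ∀ l', a k' ≠ c l') ∧ ∀ l', l' ≠ l → c l' ≠ a k

/-- Invariance replaces the coincident letter `a k` by another letter x at both places, at the price
of correction terms. When x already occurs, each correction swaps the coincidence with another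
occurrence of x, so it is again a coordinate with a single coincidence. -/
theorem onePair_expand {Φ : Finset P} {F : Words P Q L}
    (hE : ∀ x y, x ≠ y → ∀ a c, DisjOff Φ a c → glOp x y F (a, c) = 0)
    (hF : ∀ a c, DisjOff Φ a c → F (a, c) = 0)
    {k : P} {l : Q} {a : P → L} {c : Q → L} (h : OnePair Φ k l a c) (x : L) :
    F (update a k x, update c l x) = F (a, c) +
      (∑ l', if l' ≠ l ∧ c l' = x then F (a, update (update c l x) l' (a k)) else 0) +
      ∑ k', if (k' ∉ Φ ∧ k' ≠ k) ∧ a k' = x then F (update (update a k x) k' (a k), c) else 0 := by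
  obtain ⟨hk, hkl, h1, h2⟩ := h
  by_cases hx : x = a k
  · subst hx
    have e1 : update a k (a k) = a := update_eq_self k a
    have e2 : update c l (a k) = c := by rw [hkl]; exact update_eq_self l c
    rw [e1, e2, Finset.sum_eq_zero, Finset.sum_eq_zero, add_zero, add_zero]
    · intro k' _
      rw [if_neg]
      rintro ⟨⟨h3, h4⟩, h5⟩
      exact h1 k' h3 h4 l (h5.trans hkl)
    · intro l' _
      rw [if_neg]
      rintro ⟨h3, h4⟩
      exact h2 l' h3 h4
  · by_cases hxa : ∃ k', (k' ∉ Φ ∧ k' ≠ k) ∧ a k' = x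
    · obtain ⟨k₁, ⟨hk₁, hk₁'⟩, hk₁x⟩ := hxa
      have hd : DisjOff Φ (update a k x) c := by
        intro k' hk' l'
        by_cases hkk : k' = k
        · subst hkk
          rw [update_self, ← hk₁x]
          exact h1 k₁ hk₁ hk₁' l'
        · rw [update_of_ne hkk]
          exact h1 k' hk' hkk l'
      have key := hE x (a k) hx _ _ hd
      rw [glOp_apply] at key
      have s1 : (∑ l', if c l' = a k then F (update a k x, update c l' x) else 0) =
          F (update a k x, update c l x) := by
        rw [Finset.sum_eq_single l]
        · rw [if_pos hkl.symm]
        · intro l' _ hl'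
          rw [if_neg (h2 l' hl')]
        · simp
      have s2 : (∑ k', if update a k x k' = x then F (update (update a k x) k' (a k), c) else 0) =
          F (a, c) + ∑ k', if (k' ∉ Φ ∧ k' ≠ k) ∧ a k' = x then
            F (update (update a k x) k' (a k), c) else 0 := by
        rw [← Finset.add_sum_erase _ _ (Finset.mem_univ k),
          ← Finset.add_sum_erase (f := fun k' => if (k' ∉ Φ ∧ k' ≠ k) ∧ a k' = x then
            F (update (update a k x) k' (a k), c) else 0) _ (Finset.mem_univ k)]
        rw [if_neg (by simp : ¬ ((k ∉ Φ ∧ k ≠ k) ∧ a k = x)), zero_add, update_self, if_pos rfl,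
          update_idem, update_eq_self]
        congr 1
        refine Finset.sum_congr rfl fun k' hk' => ?_
        have hne : k' ≠ k := (Finset.mem_erase.1 hk').1
        rw [update_of_ne hne]
        -- A change at a position of `Φ` leaves the pair disjoint off `Φ`, so `hF` kills this term.
        by_cases hΦ : k' ∈ Φ
        · rw [if_neg (by tauto : ¬ ((k' ∉ Φ ∧ k' ≠ k) ∧ a k' = x))]
          split_ifs
          · apply hF
            intro k'' hk'' l'
            rw [update_of_ne (by rintro rfl; exact hk'' hΦ)]
            exact hd k'' hk'' l'
          · rfl
        · simp [hΦ, hne]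
      have s3 : (∑ l', if l' ≠ l ∧ c l' = x then F (a, update (update c l x) l' (a k)) else 0)
          = 0 := by
        refine Finset.sum_eq_zero fun l' _ => if_neg ?_
        rintro ⟨_, h4⟩
        exact h1 k₁ hk₁ hk₁' l' (hk₁x.trans h4.symm)
      rw [s1, s2] at key
      rw [s3]
      linarith
    · have s3 : (∑ k', if (k' ∉ Φ ∧ k' ≠ k) ∧ a k' = x then
          F (update (update a k x) k' (a k), c) else 0) = 0 :=
        Finset.sum_eq_zero fun k' _ => if_neg fun h => hxa ⟨k', h⟩
      have hd : DisjOff Φ a (update c l x) := by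
        intro k' hk' l'
        by_cases hll : l' = l
        · subst hll
          rw [update_self]
          intro h
          by_cases hkk : k' = k
          · exact hx (by rw [← h, hkk])
          · exact hxa ⟨k', ⟨hk', hkk⟩, h⟩
        · rw [update_of_ne hll]
          by_cases hkk : k' = k
          · rw [hkk]; exact (h2 l' hll).symm
          · exact h1 k' hk' hkk l'
      have key := hE (a k) x (Ne.symm hx) _ _ hd
      rw [glOp_apply] at key
      have s1 : (∑ k', if a k' = a k then F (update a k' x, update c l x) else 0) =
          F (update a k x, update c l x) := by
        rw [Finset.sum_eq_single k]
        · rw [if_pos rfl]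
        · intro k' _ hk'
          split_ifs with h
          · by_cases hΦ : k' ∈ Φ
            · apply hF
              intro k'' hk'' l'
              rw [update_of_ne (by rintro rfl; exact hk'' hΦ)]
              exact hd k'' hk'' l'
            · exact absurd (h.trans hkl) (h1 k' hΦ hk' l)
          · rfl
        · simp
      have s2 : (∑ l', if update c l x l' = x then F (a, update (update c l x) l' (a k)) else 0) =
          F (a, c) + ∑ l', if l' ≠ l ∧ c l' = x then
            F (a, update (update c l x) l' (a k)) else 0 := by
        rw [← Finset.add_sum_erase _ _ (Finset.mem_univ l),
          ← Finset.add_sum_erase (f := fun l' => if l' ≠ l ∧ c l' = x then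
            F (a, update (update c l x) l' (a k)) else 0) _ (Finset.mem_univ l)]
        rw [if_neg (by simp : ¬ (l ≠ l ∧ c l = x)), zero_add, update_self, if_pos rfl,
          update_idem, hkl, update_eq_self]
        congr 1
        refine Finset.sum_congr rfl fun l' hl' => ?_
        have hne : l' ≠ l := (Finset.mem_erase.1 hl').1
        rw [update_of_ne hne]
        simp [hne]
      rw [s1, s2] at key
      rw [s3]
      linarith

theorem onePair_swap_right {Φ : Finset P} {k : P} {l : Q} {a : P → L} {c : Q → L}
    (h : OnePair Φ k l a c) {l' : Q} (hl : l' ≠ l) :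
    OnePair Φ k l' a (update (update c l (c l')) l' (a k)) := by
  obtain ⟨hk, hkl, h1, h2⟩ := h
  refine ⟨hk, by rw [update_self], fun k' hk' hkk l'' => ?_, fun l'' hl'' => ?_⟩
  · by_cases e1 : l'' = l'
    · rw [e1, update_self, hkl]; exact h1 k' hk' hkk l
    · rw [update_of_ne e1]
      by_cases e2 : l'' = l
      · rw [e2, update_self]; exact h1 k' hk' hkk l'
      · rw [update_of_ne e2]; exact h1 k' hk' hkk l''
  · rw [update_of_ne hl'']
    by_cases e2 : l'' = l
    · rw [e2, update_self]; exact h2 l' hl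
    · rw [update_of_ne e2]; exact h2 l'' e2

theorem onePair_swap_left {Φ : Finset P} {k : P} {l : Q} {a : P → L} {c : Q → L}
    (h : OnePair Φ k l a c) {k' : P} (hΦ : k' ∉ Φ) (hl : k' ≠ k) :
    OnePair Φ k' l (update (update a k (a k')) k' (a k)) c := by
  obtain ⟨hk, hkl, h1, h2⟩ := h
  refine ⟨hΦ, by rw [update_self, hkl], fun k'' hk'' hkk l'' => ?_, fun l'' hl'' => ?_⟩
  · rw [update_of_ne hkk]
    by_cases e2 : k'' = k
    · rw [e2, update_self]; exact h1 k' hΦ hl l''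
    · rw [update_of_ne e2]; exact h1 k'' hk'' e2 l''
  · rw [update_self]; exact h2 l'' hl''

/-- A maximum principle. Summing `onePair_expand` over all letters and using the vanishing
contraction, |L| times a coordinate equals minus a sum of at most (|Q| - 1) + (|P| - 1) coordinates
of the same kind. Since |P| + |Q| - 2 < |L|, the largest absolute value is zero. -/
theorem onePair_eq_zero {Φ : Finset P} {F : Words P Q L} (hT : F ∈ tracelessWords P Q L)
    (hE : ∀ x y, x ≠ y → ∀ a c, DisjOff Φ a c → glOp x y F (a, c) = 0)
    (hF : ∀ a c, DisjOff Φ a c → F (a, c) = 0)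
    (hcard : Fintype.card P + Fintype.card Q ≤ Fintype.card L + 1)
    {k : P} {l : Q} {a : P → L} {c : Q → L} (h : OnePair Φ k l a c) : F (a, c) = 0 := by
  classical
  let S : Finset (P × Q × (P → L) × (Q → L)) :=
    Finset.univ.filter fun s => OnePair Φ s.1 s.2.1 s.2.2.1 s.2.2.2
  obtain ⟨⟨k₀, l₀, a₀, c₀⟩, hs, hmax⟩ := S.exists_max_image
    (fun s => |F (s.2.2.1, s.2.2.2)|) ⟨(k, l, a, c), by simpa [S] using h⟩
  replace hs : OnePair Φ k₀ l₀ a₀ c₀ := by simpa [S] using hs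
  set m := |F (a₀, c₀)| with hm
  have hle : ∀ {k l a c}, OnePair Φ k l a c → |F (a, c)| ≤ m := by
    intro k l a c h
    exact hmax (k, l, a, c) (by simpa [S] using h)
  have hsum := hT k₀ l₀ a₀ c₀
  simp only [onePair_expand hE hF hs, Finset.sum_add_distrib, Finset.sum_const, Finset.card_univ,
    nsmul_eq_mul] at hsum
  rw [Finset.sum_comm (s := (Finset.univ : Finset L)) (t := (Finset.univ : Finset Q)),
    Finset.sum_comm (s := (Finset.univ : Finset L)) (t := (Finset.univ : Finset P))] at hsum
  have e1 : ∀ l', (∑ x, if l' ≠ l₀ ∧ c₀ l' = x then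
      F (a₀, update (update c₀ l₀ x) l' (a₀ k₀)) else 0) =
      if l' ≠ l₀ then F (a₀, update (update c₀ l₀ (c₀ l')) l' (a₀ k₀)) else 0 := by
    intro l'
    by_cases hl : l' = l₀ <;> simp [hl]
  have e2 : ∀ k', (∑ x, if (k' ∉ Φ ∧ k' ≠ k₀) ∧ a₀ k' = x then
      F (update (update a₀ k₀ x) k' (a₀ k₀), c₀) else 0) =
      if k' ∉ Φ ∧ k' ≠ k₀ then F (update (update a₀ k₀ (a₀ k')) k' (a₀ k₀), c₀) else 0 := by
    intro k'
    by_cases hk : k' ∉ Φ ∧ k' ≠ k₀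
    · simp [hk]
    · simp only [hk, false_and, if_false, Finset.sum_const_zero]
  simp only [e1, e2] at hsum
  have b1 : |∑ l', if l' ≠ l₀ then F (a₀, update (update c₀ l₀ (c₀ l')) l' (a₀ k₀)) else 0| ≤
      ((Fintype.card Q : ℚ) - 1) * m := by
    refine (Finset.abs_sum_le_sum_abs _ _).trans ?_
    rw [← Finset.add_sum_erase _ _ (Finset.mem_univ l₀)]
    simp only [ne_eq, not_true_eq_false, if_false, abs_zero, zero_add]
    refine (Finset.sum_le_card_nsmul _ _ m fun l' hl' => ?_).trans ?_
    · have hne : l' ≠ l₀ := (Finset.mem_erase.1 hl').1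
      rw [if_pos hne]
      exact hle (onePair_swap_right hs hne)
    · rw [Finset.card_erase_of_mem (Finset.mem_univ _), Finset.card_univ, nsmul_eq_mul,
        Nat.cast_sub (Fintype.card_pos_iff.2 ⟨l₀⟩), Nat.cast_one]
  have b2 : |∑ k', if k' ∉ Φ ∧ k' ≠ k₀ then
      F (update (update a₀ k₀ (a₀ k')) k' (a₀ k₀), c₀) else 0| ≤
      ((Fintype.card P : ℚ) - 1) * m := by
    refine (Finset.abs_sum_le_sum_abs _ _).trans ?_
    rw [← Finset.add_sum_erase _ _ (Finset.mem_univ k₀)]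
    simp only [ne_eq, not_true_eq_false, and_false, if_false, abs_zero, zero_add]
    refine (Finset.sum_le_card_nsmul _ _ m fun k' hk' => ?_).trans ?_
    · have hne : k' ≠ k₀ := (Finset.mem_erase.1 hk').1
      split_ifs with hc
      · exact hle (onePair_swap_left hs hc.1 hne)
      · rw [abs_zero]; exact abs_nonneg _
    · rw [Finset.card_erase_of_mem (Finset.mem_univ _), Finset.card_univ, nsmul_eq_mul,
        Nat.cast_sub (Fintype.card_pos_iff.2 ⟨k₀⟩), Nat.cast_one]
  have hnm : (Fintype.card L : ℚ) * m ≤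
      ((Fintype.card Q : ℚ) - 1) * m + ((Fintype.card P : ℚ) - 1) * m := by
    rw [hm, ← Nat.abs_cast (Fintype.card L), ← abs_mul]
    rw [add_assoc] at hsum
    rw [eq_neg_of_add_eq_zero_left hsum, abs_neg]
    exact (abs_add_le _ _).trans (add_le_add b1 b2)
  have hm0 : 0 ≤ m := abs_nonneg _
  have hc : (Fintype.card P : ℚ) + Fintype.card Q ≤ Fintype.card L + 1 := by exact_mod_cast hcard
  have : m = 0 := by nlinarith
  have h0 := hle h
  rw [this] at h0
  exact abs_eq_zero.1 (le_antisymm h0 (abs_nonneg _))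

/-- This frees one more position from the disjointness condition. The letter `a k` may occur several
times in `c`; replacing it at k and at one l by a fresh letter leaves a single coincidence, and
`onePair_expand` leads back from there through terms which all vanish. -/
theorem eq_zero_of_disjOff_insert {Φ : Finset P} {F : Words P Q L}
    (hT : F ∈ tracelessWords P Q L)
    (hE : ∀ x y, x ≠ y → ∀ a c, DisjOff Φ a c → glOp x y F (a, c) = 0)
    (hF : ∀ a c, DisjOff Φ a c → F (a, c) = 0)
    (hcard : Fintype.card P + Fintype.card Q ≤ Fintype.card L + 1)
    {k : P} (hk : k ∉ Φ) {a : P → L} {c : Q → L} (h : DisjOff (insert k Φ) a c) :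
    F (a, c) = 0 := by
  classical
  have hact : ∀ k' ∉ Φ, k' ≠ k → ∀ l', a k' ≠ c l' := fun k' hk' hne l' =>
    h k' (by simp [hne, hk']) l'
  by_cases hx : ∃ l, a k = c l
  · obtain ⟨l, hl⟩ := hx
    -- Only (|Q| - 1) + (|P| - 1) < |L| positions have to be avoided.
    obtain ⟨y, hy⟩ : ∃ y, y ∉ (Finset.univ.erase l).image c ∪ (Finset.univ.erase k).image a := by
      by_contra! hall
      have h1 : Fintype.card L ≤ (Fintype.card Q - 1) + (Fintype.card P - 1) := by
        rw [← Finset.card_univ, ← Finset.eq_univ_iff_forall.2 hall]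
        refine (Finset.card_union_le _ _).trans (add_le_add ?_ ?_) <;>
        · refine Finset.card_image_le.trans ?_
          rw [Finset.card_erase_of_mem (Finset.mem_univ _), Finset.card_univ]
      have h2 : 0 < Fintype.card Q := Fintype.card_pos_iff.2 ⟨l⟩
      have h3 : 0 < Fintype.card P := Fintype.card_pos_iff.2 ⟨k⟩
      omega
    simp only [Finset.mem_union, Finset.mem_image, Finset.mem_erase, Finset.mem_univ, and_true,
      not_or, not_exists, not_and] at hy
    have hS : OnePair Φ k l (update a k y) (update c l y) := by
      refine ⟨hk, by simp, fun k' hk' hne l' => ?_, fun l' hne => ?_⟩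
      · rw [update_of_ne hne]
        by_cases hl' : l' = l
        · rw [hl', update_self]; exact hy.2 k' hne
        · rw [update_of_ne hl']; exact hact k' hk' hne l'
      · rw [update_self, update_of_ne hne]; exact hy.1 l' hne
    have hexp := onePair_expand hE hF hS (a k)
    have e1 : update (update a k y) k (a k) = a := by simp
    have e2 : update (update c l y) l (a k) = c := by rw [hl]; simp
    nth_rewrite 1 [e1, e2] at hexp
    rw [hexp, onePair_eq_zero hT hE hF hcard hS, Finset.sum_eq_zero, Finset.sum_eq_zero]
    · simp
    · intro k' _
      split_ifs with hc
      · have := onePair_swap_left hS hc.1.1 hc.1.2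
        rw [hc.2, e1] at this
        rw [e1]
        exact onePair_eq_zero hT hE hF hcard this
      · rfl
    · intro l' _
      split_ifs with hc
      · have := onePair_swap_right hS hc.1
        rw [hc.2, e2] at this
        rw [e2]
        exact onePair_eq_zero hT hE hF hcard this
      · rfl
  · refine hF a c fun k' hk' l' => ?_
    by_cases hne : k' = k
    · rw [hne]; exact fun h => hx ⟨l', h⟩
    · exact hact k' hk' hne l'

/-- Induction on the set `Φ` of positions exempt from disjointness. The inductive statement is made
for all of `N` at once because the step uses it for the images of F under the elementary operators
as well. -/
theorem eq_bot_of_glOp_stable {N : Submodule ℚ (Words P Q L)} (hT : N ≤ tracelessWords P Q L)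
    (hE : ∀ x y, x ≠ y → ∀ F ∈ N, glOp x y F ∈ N)
    (hF : ∀ F ∈ N, ∀ a c, (∀ k l, a k ≠ c l) → F (a, c) = 0)
    (hcard : Fintype.card P + Fintype.card Q ≤ Fintype.card L + 1) : N = ⊥ := by
  classical
  have key : ∀ Φ : Finset P, ∀ F ∈ N, ∀ a c, DisjOff Φ a c → F (a, c) = 0 := by
    intro Φ
    induction Φ using Finset.induction_on with
    | empty => exact fun F hFN a c h => hF F hFN a c fun k l => h k (Finset.notMem_empty k) l
    | insert k Φ hk ih =>
      intro F hFN a c h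
      exact eq_zero_of_disjOff_insert (hT hFN)
        (fun x y hxy a c h => ih _ (hE x y hxy F hFN) a c h) (ih F hFN) hcard hk h
  rw [Submodule.eq_bot_iff]
  intro F hFN
  funext w
  exact key Finset.univ F hFN w.1 w.2 fun k hk => absurd (Finset.mem_univ k) hk

end Words

/-! ### Duality: generation of the traceless tensors under gl -/

section WordsDuality

set_option linter.unusedSectionVars false

open Function

variable {P Q L : Type} [Fintype P] [DecidableEq P] [Fintype Q] [DecidableEq Q]
  [Fintype L] [DecidableEq L]

theorem sum_update_swap (k : P) (x y : L) (f g : (P → L) → ℚ) :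
    (∑ a, (if a k = x then f (update a k y) else 0) * g a) =
      ∑ a, f a * (if a k = y then g (update a k x) else 0) := by
  simp only [ite_mul, zero_mul, mul_ite, mul_zero, ← Finset.sum_filter]
  refine Finset.sum_nbij' (fun a => update a k y) (fun a => update a k x) ?_ ?_ ?_ ?_ ?_
  · simp
  · simp
  · intro a ha
    rw [update_idem, ← (Finset.mem_filter.1 ha).2, update_eq_self]
  · intro a ha
    rw [update_idem, ← (Finset.mem_filter.1 ha).2, update_eq_self]
  · intro a ha
    congr 1
    rw [update_idem, ← (Finset.mem_filter.1 ha).2, update_eq_self]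

theorem glOp_adjoint (x y : L) (F G : Words P Q L) :
    ∑ w, glOp x y F w * G w = ∑ w, F w * glOp y x G w := by
  simp only [Fintype.sum_prod_type, glOp_apply, sub_mul, mul_sub, Finset.sum_sub_distrib]
  congr 1
  · rw [Finset.sum_comm]
    conv_rhs => rw [Finset.sum_comm]
    refine Finset.sum_congr rfl fun c _ => ?_
    simp only [Finset.sum_mul, Finset.mul_sum]
    rw [Finset.sum_comm]
    conv_rhs => rw [Finset.sum_comm]
    exact Finset.sum_congr rfl fun k _ =>
      sum_update_swap k x y (fun a => F (a, c)) (fun a => G (a, c))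
  · refine Finset.sum_congr rfl fun a _ => ?_
    simp only [Finset.sum_mul, Finset.mul_sum]
    rw [Finset.sum_comm]
    conv_rhs => rw [Finset.sum_comm]
    exact Finset.sum_congr rfl fun l _ =>
      sum_update_swap l y x (fun c => F (a, c)) (fun c => G (a, c))

/-- The operator commutes with contractions. Where it acts on a position not being contracted, the
trace condition applies directly; the two terms at the contracted positions k and l are equal and
cancel. -/
theorem glOp_mem_tracelessWords (x y : L) {F : Words P Q L} (hF : F ∈ tracelessWords P Q L) :
    glOp x y F ∈ tracelessWords P Q L := by
  intro k l a c
  simp only [glOp_apply, Finset.sum_sub_distrib]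
  have h1 : (∑ z, ∑ k', if update a k z k' = x then
      F (update (update a k z) k' y, update c l z) else 0) =
      F (update a k y, update c l x) := by
    rw [Finset.sum_comm, Finset.sum_eq_single k]
    · simp
    · intro k' _ hne
      have : ∀ z, update (update a k z) k' y = update (update a k' y) k z := fun z =>
        update_comm hne.symm _ _ _
      simp only [update_of_ne hne, this]
      split_ifs
      · exact hF k l (update a k' y) c
      · simp
    · simp
  have h2 : (∑ z, ∑ l', if update c l z l' = y then
      F (update a k z, update (update c l z) l' x) else 0) =
      F (update a k y, update c l x) := by
    rw [Finset.sum_comm, Finset.sum_eq_single l]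
    · simp
    · intro l' _ hne
      have : ∀ z, update (update c l z) l' x = update (update c l' x) l z := fun z =>
        update_comm hne.symm _ _ _
      simp only [update_of_ne hne, this]
      split_ifs
      · exact hF k l a (update c l' x)
      · simp
    · simp
  rw [h1, h2, sub_self]

/-- The tensor `v₁ ⊗ ⋯ ⊗ f₁ ⊗ ⋯` in coordinates. -/
def pureWords (v : P → L → ℚ) (f : Q → L → ℚ) : Words P Q L :=
  fun w => (∏ k, v k (w.1 k)) * ∏ l, f l (w.2 l)

theorem pureWords_mem_tracelessWords {v : P → L → ℚ} {f : Q → L → ℚ}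
    (h : ∀ k l, ∑ x, v k x * f l x = 0) : pureWords v f ∈ tracelessWords P Q L := by
  intro k l a c
  have e1 : ∀ x, ∏ k', v k' (update a k x k') =
      v k x * ∏ k' ∈ Finset.univ.erase k, v k' (a k') := by
    intro x
    rw [← Finset.mul_prod_erase _ _ (Finset.mem_univ k), update_self]
    congr 1
    exact Finset.prod_congr rfl fun k' hk' => by rw [update_of_ne (Finset.ne_of_mem_erase hk')]
  have e2 : ∀ x, ∏ l', f l' (update c l x l') =
      f l x * ∏ l' ∈ Finset.univ.erase l, f l' (c l') := by
    intro x
    rw [← Finset.mul_prod_erase _ _ (Finset.mem_univ l), update_self]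
    congr 1
    exact Finset.prod_congr rfl fun l' hl' => by rw [update_of_ne (Finset.ne_of_mem_erase hl')]
  simp only [pureWords, e1, e2, mul_mul_mul_comm, ← Finset.sum_mul, h k l, zero_mul]

theorem single_eq_pureWords (a : P → L) (c : Q → L) :
    (Pi.single (a, c) 1 : Words P Q L) =
      pureWords (fun k => Pi.single (a k) 1) (fun l => Pi.single (c l) 1) := by
  funext ⟨α, γ⟩
  simp only [pureWords, Pi.single_apply, Finset.prod_ite_zero, Finset.prod_const_one,
    Finset.mem_univ, true_imp_iff, Prod.mk.injEq, funext_iff]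
  split_ifs <;> simp_all

theorem single_mem_tracelessWords {a : P → L} {c : Q → L} (h : ∀ k l, a k ≠ c l) :
    (Pi.single (a, c) 1 : Words P Q L) ∈ tracelessWords P Q L := by
  rw [single_eq_pureWords]
  refine pureWords_mem_tracelessWords fun k l => Finset.sum_eq_zero fun x _ => ?_
  by_cases hx : x = a k
  · subst hx; simp [h k l]
  · simp [hx]

/-- A `gl`-stable subspace which contains the tensors with disjoint letters contains all traceless
tensors. -/
theorem tracelessWords_le {J : Submodule ℚ (Words P Q L)}
    (hE : ∀ x y, x ≠ y → ∀ F ∈ J, glOp x y F ∈ J)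
    (hJ : ∀ a c, (∀ k l, a k ≠ c l) → (Pi.single (a, c) 1 : Words P Q L) ∈ J)
    (hcard : Fintype.card P + Fintype.card Q ≤ Fintype.card L + 1) :
    tracelessWords P Q L ≤ J := by
  let b : LinearMap.BilinForm ℚ (Words P Q L) := Matrix.toBilin' 1
  have hb : ∀ F G, b F G = ∑ w, F w * G w := by
    intro F G
    simp [b, Matrix.toBilin'_apply, Matrix.one_apply]
  -- The form is positive definite over ℚ, hence nondegenerate on `K`, so `K` has an orthogonal
  -- complement. The part of that complement inside the traceless tensors is gl-stable by
  -- adjointness, and vanishes on disjoint words because the corresponding basis tensors lie in `K`.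
  let K := J ⊓ tracelessWords P Q L
  have hrefl : b.IsRefl := by
    intro F G h
    rw [hb] at h ⊢
    rw [← h]
    exact Finset.sum_congr rfl fun w _ => mul_comm _ _
  have hnd : (b.restrict K).Nondegenerate := by
    have hz : ∀ x : K, b.restrict K x x = 0 → x = 0 := by
      intro x hx
      replace hx : b x.1 x.1 = 0 := hx
      rw [hb, Finset.sum_eq_zero_iff_of_nonneg fun w _ => mul_self_nonneg _] at hx
      refine Subtype.ext (funext fun w => ?_)
      simpa using hx w (Finset.mem_univ w)
    exact ⟨fun x hx => hz x (hx x), fun x hx => hz x (hx x)⟩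
  have hcompl := (LinearMap.BilinForm.isCompl_orthogonal_of_restrict_nondegenerate hrefl hnd)
  have hN : b.orthogonal K ⊓ tracelessWords P Q L = ⊥ := by
    refine eq_bot_of_glOp_stable inf_le_right ?_ ?_ hcard
    · rintro x y hxy F ⟨hF, hFT⟩
      refine ⟨?_, glOp_mem_tracelessWords x y hFT⟩
      intro G hG
      have := hF (glOp y x G) ⟨hE y x hxy.symm G hG.1, glOp_mem_tracelessWords y x hG.2⟩
      change b _ _ = 0 at this ⊢
      rw [hb] at this ⊢
      rw [← this, glOp_adjoint]
    · rintro F ⟨hF, -⟩ a c h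
      have := hF _ ⟨hJ a c h, single_mem_tracelessWords h⟩
      change b _ _ = 0 at this
      rw [hb] at this
      simpa [Pi.single_apply] using this
  intro t ht
  obtain ⟨k, hk, o, ho, rfl⟩ := Submodule.mem_sup.1 (hcompl.sup_eq_top ▸ Submodule.mem_top (x := t))
  have : o ∈ b.orthogonal K ⊓ tracelessWords P Q L := by
    refine ⟨ho, ?_⟩
    have := Submodule.sub_mem _ ht hk.2
    rwa [add_sub_cancel_left] at this
  rw [hN, Submodule.mem_bot] at this
  rw [this, add_zero]
  exact hk.1

/-- As y occurs only at position k of the modified word, the operator changes it back in exactly one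
way; the dual term would need the letter `a k` in `c`, which disjointness excludes. -/
theorem glOp_single_left {a : P → L} {c : Q → L} (h : ∀ k l, a k ≠ c l) {k : P} {y : L}
    (hya : ∀ k', a k' ≠ y) :
    glOp (a k) y (Pi.single (update a k y, c) 1) = (Pi.single (a, c) 1 : Words P Q L) := by
  funext ⟨α, γ⟩
  rw [glOp_apply]
  have h2 : (∑ l, if γ l = y then
      (Pi.single (update a k y, c) 1 : Words P Q L) (α, update γ l (a k)) else 0) = 0 := by
    refine Finset.sum_eq_zero fun l _ => ?_
    refine ite_eq_right_iff.2 fun _ => ?_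
    rw [Pi.single_apply, if_neg]
    intro he
    have := congrFun (congrArg Prod.snd he) l
    simp only [update_self] at this
    exact h k l this
  rw [h2, sub_zero, Finset.sum_eq_single k]
  · rw [Pi.single_apply, Pi.single_apply]
    by_cases hα : (α, γ) = (a, c)
    · rw [Prod.mk.injEq] at hα
      obtain ⟨rfl, rfl⟩ := hα
      simp
    · rw [if_neg hα]
      split_ifs with h3 h4
      · rw [Prod.mk.injEq] at h4
        refine absurd (Prod.ext ?_ h4.2) hα
        funext k'
        by_cases hk : k' = k
        · rw [hk]; exact h3
        · have := congrFun h4.1 k'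
          simpa [hk] using this
      · rfl
      · rfl
  · intro k' _ hne
    rw [Pi.single_apply]
    split_ifs with h3 h4
    · have := congrFun (congrArg Prod.fst h4) k'
      simp only [update_self, update_of_ne hne] at this
      exact absurd this.symm (hya k')
    · rfl
    · rfl
  · simp

theorem glOp_single_right {a : P → L} {c : Q → L} (h : ∀ k l, a k ≠ c l) {l : Q} {y : L}
    (hyc : ∀ l', c l' ≠ y) :
    glOp y (c l) (Pi.single (a, update c l y) 1) = -(Pi.single (a, c) 1 : Words P Q L) := by
  funext ⟨α, γ⟩
  rw [glOp_apply]
  have h2 : (∑ k, if α k = y then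
      (Pi.single (a, update c l y) 1 : Words P Q L) (update α k (c l), γ) else 0) = 0 := by
    refine Finset.sum_eq_zero fun k _ => ?_
    refine ite_eq_right_iff.2 fun _ => ?_
    rw [Pi.single_apply, if_neg]
    intro he
    have := congrFun (congrArg Prod.fst he) k
    simp only [update_self] at this
    exact h k l this.symm
  rw [h2, zero_sub, Pi.neg_apply, neg_inj, Finset.sum_eq_single l]
  · rw [Pi.single_apply, Pi.single_apply]
    by_cases hα : (α, γ) = (a, c)
    · rw [Prod.mk.injEq] at hα
      obtain ⟨rfl, rfl⟩ := hα
      simp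
    · rw [if_neg hα]
      split_ifs with h3 h4
      · rw [Prod.mk.injEq] at h4
        refine absurd (Prod.ext h4.1 ?_) hα
        funext k'
        by_cases hk : k' = l
        · rw [hk]; exact h3
        · have := congrFun h4.2 k'
          simpa [hk] using this
      · rfl
      · rfl
  · intro k' _ hne
    rw [Pi.single_apply]
    split_ifs with h3 h4
    · have := congrFun (congrArg Prod.snd h4) k'
      simp only [update_self, update_of_ne hne] at this
      exact absurd this.symm (hyc k')
    · rfl
    · rfl
  · simp

theorem card_image_update {α : Type} [Fintype α] [DecidableEq α] {a : α → L} {k k' : α}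
    (hne : k ≠ k') (h : a k = a k') {y : L} (hy : ∀ k, a k ≠ y) :
    (Finset.univ.image a).card < (Finset.univ.image (update a k y)).card := by
  refine Finset.card_lt_card ((Finset.ssubset_iff_of_subset ?_).2
    ⟨y, Finset.mem_image.2 ⟨k, Finset.mem_univ k, update_self _ _ _⟩, by simpa using hy⟩)
  intro x hx
  obtain ⟨j, -, rfl⟩ := Finset.mem_image.1 hx
  by_cases hj : j = k
  · exact Finset.mem_image.2 ⟨k', Finset.mem_univ _, by rw [update_of_ne hne.symm, hj, h]⟩
  · exact Finset.mem_image.2 ⟨j, Finset.mem_univ _, by rw [update_of_ne hj]⟩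

/-- A repeated letter is recovered from a word with a fresh letter in its place by one elementary
operator. The induction is on the number of positions minus the number of distinct letters; as long
as this is positive, |P| + |Q| ≤ |L| leaves a letter unused. -/
theorem single_mem_of_injective {J : Submodule ℚ (Words P Q L)}
    (hE : ∀ x y, x ≠ y → ∀ F ∈ J, glOp x y F ∈ J)
    (hJ : ∀ a c, Injective a → Injective c → (∀ k l, a k ≠ c l) →
      (Pi.single (a, c) 1 : Words P Q L) ∈ J)
    (hcard : Fintype.card P + Fintype.card Q ≤ Fintype.card L)
    (a : P → L) (c : Q → L) (h : ∀ k l, a k ≠ c l) :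
    (Pi.single (a, c) 1 : Words P Q L) ∈ J := by
  induction hm : Fintype.card P + Fintype.card Q -
      ((Finset.univ.image a).card + (Finset.univ.image c).card) using Nat.strong_induction_on
    generalizing a c with
  | _ m ih =>
  have hPa : (Finset.univ.image a).card ≤ Fintype.card P := Finset.card_image_le
  have hQc : (Finset.univ.image c).card ≤ Fintype.card Q := Finset.card_image_le
  have hfresh : (Finset.univ.image a).card + (Finset.univ.image c).card <
      Fintype.card P + Fintype.card Q → ∃ y, (∀ k, a k ≠ y) ∧ ∀ l, c l ≠ y := by
    intro hlt
    by_contra! hall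
    have : Finset.univ.image a ∪ Finset.univ.image c = Finset.univ := by
      refine Finset.eq_univ_iff_forall.2 fun y => ?_
      by_cases hy : ∃ k, a k = y
      · exact Finset.mem_union_left _ (by simpa using hy)
      · exact Finset.mem_union_right _ (by simpa using hall y (by simpa using hy))
    have h2 := Finset.card_union_le (Finset.univ.image a) (Finset.univ.image c)
    rw [this, Finset.card_univ] at h2
    omega
  by_cases ha : Injective a
  · by_cases hc : Injective c
    · exact hJ a c ha hc h
    · have hlt : (Finset.univ.image c).card < Fintype.card Q := by
        refine lt_of_le_of_ne hQc fun he => hc ?_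
        rw [← Finset.card_univ, Finset.card_image_iff] at he
        simpa using he
      obtain ⟨y, hya, hyc⟩ := hfresh (by omega)
      simp only [Injective, not_forall] at hc
      obtain ⟨l, l', hll, hne⟩ := hc
      have h3 := card_image_update hne hll hyc
      have h4 : (Finset.univ.image (update c l y)).card ≤ Fintype.card Q := Finset.card_image_le
      have := hE y (c l) (hyc l).symm _ (ih _ (by omega) a (update c l y) (fun k' l'' => by
        by_cases hl : l'' = l
        · rw [hl, update_self]; exact hya k'
        · rw [update_of_ne hl]; exact h k' l'') rfl)
      rw [glOp_single_right h hyc] at this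
      simpa using this
  · have hlt : (Finset.univ.image a).card < Fintype.card P := by
      refine lt_of_le_of_ne hPa fun he => ha ?_
      rw [← Finset.card_univ, Finset.card_image_iff] at he
      simpa using he
    obtain ⟨y, hya, hyc⟩ := hfresh (by omega)
    simp only [Injective, not_forall] at ha
    obtain ⟨k, k', hkk, hne⟩ := ha
    have h3 := card_image_update hne hkk hya
    have h4 : (Finset.univ.image (update a k y)).card ≤ Fintype.card P := Finset.card_image_le
    have := hE (a k) y (hya k) _ (ih _ (by omega) (update a k y) c (fun k' l'' => by
      by_cases hl : k' = k
      · rw [hl, update_self]; exact (hyc l'').symm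
      · rw [update_of_ne hl]; exact h k' l'') rfl)
    rwa [glOp_single_left h hya] at this

end WordsDuality

/-! ### Traces along filtrations -/

section TraceLemmas

theorem trace_pi {ι : Type} [Fintype ι] [DecidableEq ι] {M : ι → Type} [∀ i, AddCommGroup (M i)]
    [∀ i, Module ℚ (M i)] [∀ i, FiniteDimensional ℚ (M i)] (φ : (∀ i, M i) →ₗ[ℚ] ∀ i, M i) :
    LinearMap.trace ℚ _ φ =
      ∑ i, LinearMap.trace ℚ (M i) (LinearMap.proj i ∘ₗ φ ∘ₗ LinearMap.single ℚ M i) := by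
  have h : φ = ∑ i, (φ ∘ₗ LinearMap.single ℚ M i) ∘ₗ LinearMap.proj i := by
    refine LinearMap.ext fun x => ?_
    simp only [LinearMap.coe_sum, Finset.sum_apply, LinearMap.comp_apply, LinearMap.proj_apply,
      ← map_sum, LinearMap.single_apply, Finset.univ_sum_single]
  conv_lhs => rw [h]
  rw [map_sum]
  exact Finset.sum_congr rfl fun i _ => LinearMap.trace_comp_comm' _ _

theorem trace_restrict_congr {X : Type} [AddCommGroup X] [Module ℚ X] {V V' : Submodule ℚ X}
    (h : V = V') (g : X →ₗ[ℚ] X) (hV : ∀ x ∈ V, g x ∈ V) (hV' : ∀ x ∈ V', g x ∈ V') :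
    LinearMap.trace ℚ V (g.restrict hV) = LinearMap.trace ℚ V' (g.restrict hV') := by
  subst h
  rfl

/-- Additivity of the trace along a step of a filtration whose quotient is a direct sum. -/
theorem trace_filtration_step {X : Type} [AddCommGroup X] [Module ℚ X] [FiniteDimensional ℚ X]
    {V V' : Submodule ℚ X} (hle : V' ≤ V) (g : X →ₗ[ℚ] X) (hV : ∀ x ∈ V, g x ∈ V)
    (hV' : ∀ x ∈ V', g x ∈ V') {ι : Type} [Fintype ι] [DecidableEq ι] {Y : ι → Type}
    [∀ i, AddCommGroup (Y i)] [∀ i, Module ℚ (Y i)] [∀ i, FiniteDimensional ℚ (Y i)]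
    (f : ∀ i, X →ₗ[ℚ] Y i) (T : ∀ i, Submodule ℚ (Y i)) (hf : ∀ x ∈ V, ∀ i, f i x ∈ T i)
    (hker : ∀ x ∈ V, x ∈ V' ↔ ∀ i, f i x = 0)
    (hsurj : ∀ i, ∀ u ∈ T i, ∃ x ∈ V, f i x = u ∧ ∀ i', i' ≠ i → f i' x = 0)
    (D : ∀ i, T i →ₗ[ℚ] T i)
    (hD : ∀ i, ∀ x (hx : x ∈ V), (∀ i', i' ≠ i → f i' x = 0) →
      f i (g x) = D i ⟨f i x, hf x hx i⟩) :
    LinearMap.trace ℚ V (g.restrict hV) =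
      LinearMap.trace ℚ V' (g.restrict hV') + ∑ i, LinearMap.trace ℚ (T i) (D i) := by
  -- The diagonal blocks are described by `hD` only on vectors whose other components vanish, so
  -- each section of f i has to take its values among these.
  let Vi : ι → Submodule ℚ X := fun i => V ⊓ ⨅ i' : {i' // i' ≠ i}, LinearMap.ker (f i')
  have hVi : ∀ i x, x ∈ Vi i ↔ x ∈ V ∧ ∀ i', i' ≠ i → f i' x = 0 := by
    intro i x
    simp [Vi, Submodule.mem_iInf]
  have hs : ∀ i, ∃ s : T i →ₗ[ℚ] Vi i, ∀ u, f i (s u) = u := by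
    intro i
    let q : Vi i →ₗ[ℚ] T i := (f i).restrict fun x hx => hf x ((hVi i x).1 hx).1 i
    have hq : LinearMap.range q = ⊤ := by
      rw [LinearMap.range_eq_top]
      rintro ⟨u, hu⟩
      obtain ⟨x, hx, hxu, hx0⟩ := hsurj i u hu
      exact ⟨⟨x, (hVi i x).2 ⟨hx, hx0⟩⟩, Subtype.ext hxu⟩
    obtain ⟨s, hs⟩ := q.exists_rightInverse_of_surjective hq
    exact ⟨s, fun u => congrArg Subtype.val (LinearMap.congr_fun hs u)⟩
  choose s hs using hs
  let F : V →ₗ[ℚ] ∀ i, T i := LinearMap.pi fun i => (f i).restrict fun x hx => hf x hx i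
  let S : (∀ i, T i) →ₗ[ℚ] V := LinearMap.lsum ℚ _ ℚ fun i =>
    Submodule.inclusion (show Vi i ≤ V from inf_le_left) ∘ₗ s i
  have hFapp : ∀ x i, (F x i : Y i) = f i x := fun _ _ => rfl
  have hSsingle : ∀ i u, (S (Pi.single i u) : X) = s i u := by
    intro i u
    simp only [S, LinearMap.lsum_piSingle]
    rfl
  have hFS : ∀ w, F (S w) = w := by
    intro w
    have : F ∘ₗ S = LinearMap.id := by
      refine LinearMap.pi_ext fun i u => ?_
      funext i'
      refine Subtype.ext ?_
      rw [LinearMap.comp_apply, hFapp, hSsingle]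
      by_cases hi : i' = i
      · subst hi; simp [hs]
      · rw [((hVi i _).1 (s i u).2).2 i' hi]
        simp [hi]
    exact LinearMap.congr_fun this w
  let r : V →ₗ[ℚ] V' := (V.subtype ∘ₗ (LinearMap.id - S ∘ₗ F)).codRestrict V' fun x => by
    change ((x - S (F x) : V) : X) ∈ V'
    refine (hker _ (x - S (F x)).2).2 fun i => ?_
    rw [← hFapp, map_sub, hFS, sub_self]
    rfl
  -- One summand factors through the direct sum of the T i and the other through V'; cyclicity of
  -- the trace moves each computation to the smaller space.
  have hdecomp : g.restrict hV =
      (g.restrict hV ∘ₗ S) ∘ₗ F + (g.restrict hV ∘ₗ Submodule.inclusion hle) ∘ₗ r := by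
    refine LinearMap.ext fun x => Subtype.ext ?_
    change g x = g (S (F x)) + g ((x : X) - S (F x))
    rw [← map_add, add_sub_cancel]
  rw [hdecomp, map_add, LinearMap.trace_comp_comm', LinearMap.trace_comp_comm' r, add_comm]
  congr 1
  · congr 1
    refine LinearMap.ext fun x => Subtype.ext ?_
    change g x - S (F ⟨g x, _⟩) = g x
    have : F ⟨g x, hV _ (hle x.2)⟩ = 0 := by
      funext i
      refine Subtype.ext ?_
      rw [hFapp]
      exact (hker _ (hV _ (hle x.2))).1 (hV' x x.2) i
    rw [this, map_zero]
    simp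
  · rw [trace_pi]
    refine Finset.sum_congr rfl fun i _ => ?_
    congr 1
    refine LinearMap.ext fun u => Subtype.ext ?_
    simp only [LinearMap.comp_apply, LinearMap.proj_apply, hFapp, LinearMap.coe_single,
      LinearMap.coe_restrict_apply, hSsingle]
    rw [hD i _ ((hVi i _).1 (s i u).2).1 ((hVi i _).1 (s i u).2).2]
    congr 2
    exact Subtype.ext (hs i u)

end TraceLemmas

/-! ### The branching rule for traceless tensors from n + 1 to n letters -/

section Branching

set_option linter.unusedSectionVars false

open Function

variable {P Q L : Type} [Fintype P] [DecidableEq P] [Fintype Q] [DecidableEq Q]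
  [Fintype L] [DecidableEq L]

/-- The word which spells `a` at the positions in `A` and has the additional letter elsewhere. -/
def extWord (A : Finset P) (a : A → L) : P → Option L :=
  fun k => if h : k ∈ A then some (a ⟨k, h⟩) else none

theorem extWord_mem {A : Finset P} (a : A → L) (k : A) : extWord A a k = some (a k) :=
  dif_pos k.2

theorem extWord_notMem {A : Finset P} (a : A → L) {k : P} (h : k ∉ A) :
    extWord A a k = none :=
  dif_neg h

theorem extWord_update {A : Finset P} (a : A → L) (k : A) (x : L) :
    extWord A (update a k x) = update (extWord A a) k (some x) := by
  funext k'
  by_cases h : k' ∈ A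
  · lift k' to A using h
    rw [extWord_mem]
    by_cases hk : k' = k
    · subst hk; simp
    · rw [update_of_ne hk, update_of_ne fun h => hk (Subtype.ext h), extWord_mem]
  · rw [extWord_notMem _ h, update_of_ne (by rintro rfl; exact h k.2), extWord_notMem _ h]

/-- The positions of the letters of `L` in a word. -/
def support (α : P → Option L) : Finset P := Finset.univ.filter fun k => (α k).isSome

theorem exists_extWord (α : P → Option L) : ∃ a : support α → L, extWord (support α) a = α := by
  refine ⟨fun k => (α k).get (Finset.mem_filter.1 k.2).2, funext fun k => ?_⟩
  by_cases h : k ∈ support α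
  · lift k to support α using h
    rw [extWord_mem, Option.some_get]
  · rw [extWord_notMem _ h]
    simp only [support, Finset.mem_filter, Finset.mem_univ, true_and] at h
    exact (Option.not_isSome_iff_eq_none.1 h).symm

theorem extWord_update_none {A : Finset P} (a : A → L) (k : A) :
    update (extWord A a) k none = extWord (A.erase k) fun j => a ⟨j, Finset.mem_of_mem_erase j.2⟩ := by
  funext j
  by_cases hj : j = k
  · subst hj
    rw [update_self, extWord_notMem]
    simp
  · rw [update_of_ne hj]
    by_cases hA : j ∈ A
    · simp [extWord, hA, hj]
    · simp [extWord, hA]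

/-- The component of a tensor with letters of `L` exactly at the positions in `A` and `B`. -/
def comp (A : Finset P) (B : Finset Q) : Words P Q (Option L) →ₗ[ℚ] Words A B L :=
  LinearMap.funLeft ℚ ℚ fun w => (extWord A w.1, extWord B w.2)

theorem comp_apply (A : Finset P) (B : Finset Q) (F : Words P Q (Option L)) (a : A → L)
    (c : B → L) : comp A B F (a, c) = F (extWord A a, extWord B c) := rfl

theorem comp_glOp (A : Finset P) (B : Finset Q) (x y : L) (F : Words P Q (Option L)) :
    comp A B (glOp (some x) (some y) F) = glOp x y (comp A B F) := by
  funext ⟨a, c⟩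
  simp only [comp_apply, glOp_apply, extWord_update]
  congr 1
  · rw [← Finset.sum_subset (Finset.subset_univ A), ← Finset.sum_coe_sort A]
    · refine Finset.sum_congr rfl fun k _ => ?_
      simp [extWord_mem]
    · intro k _ hk
      simp [extWord_notMem _ hk]
  · rw [← Finset.sum_subset (Finset.subset_univ B), ← Finset.sum_coe_sort B]
    · refine Finset.sum_congr rfl fun k _ => ?_
      simp [extWord_mem]
    · intro k _ hk
      simp [extWord_notMem _ hk]

theorem eq_zero_of_comp {F : Words P Q (Option L)} (h : ∀ A B, comp A B F = 0) : F = 0 := by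
  funext ⟨α, γ⟩
  obtain ⟨a, ha⟩ := exists_extWord α
  obtain ⟨c, hc⟩ := exists_extWord γ
  have := congrFun (h (support α) (support γ)) (a, c)
  rwa [comp_apply, ha, hc] at this

variable (P Q L) in
/-- The traceless tensors all of whose words contain at least `j` letters of `L`. -/
def letterFiltration (j : ℕ) : Submodule ℚ (Words P Q (Option L)) where
  carrier := {F | F ∈ tracelessWords P Q (Option L) ∧
    ∀ A B, A.card + B.card < j → comp A B F = 0}
  zero_mem' := ⟨zero_mem _, by simp⟩
  add_mem' hF hG := ⟨add_mem hF.1 hG.1, fun A B h => by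
    rw [map_add, hF.2 A B h, hG.2 A B h, add_zero]⟩
  smul_mem' r F hF := ⟨Submodule.smul_mem _ r hF.1, fun A B h => by
    rw [map_smul, hF.2 A B h, smul_zero]⟩

/-- A contraction over `Option L` has one more term than a contraction over L, at the letter `none`.
That term belongs to a component with two letters of L fewer, which vanishes at this stage of the
filtration. -/
theorem comp_mem_tracelessWords {A : Finset P} {B : Finset Q} {F : Words P Q (Option L)}
    (hF : F ∈ letterFiltration P Q L (A.card + B.card)) : comp A B F ∈ tracelessWords A B L := by
  intro k l a c
  have h := hF.1 k l (extWord A a) (extWord B c)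
  rw [Fintype.sum_option, extWord_update_none, extWord_update_none, ← comp_apply _ _ F,
    hF.2 _ _ (by
      rw [Finset.card_erase_of_mem k.2, Finset.card_erase_of_mem l.2]
      have := Finset.card_pos.2 ⟨_, k.2⟩
      have := Finset.card_pos.2 ⟨_, l.2⟩
      omega), Pi.zero_apply, zero_add] at h
  simpa only [comp_apply, extWord_update] using h

/-- The tensors with prescribed component at `(A, B)` and no other component of the same or of a
smaller size. -/
def leadingAt (A : Finset P) (B : Finset Q) : Submodule ℚ (Words P Q (Option L)) where
  carrier := {F | F ∈ tracelessWords P Q (Option L) ∧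
    ∀ A' B', A'.card + B'.card ≤ A.card + B.card → (A', B') ≠ (A, B) → comp A' B' F = 0}
  zero_mem' := ⟨zero_mem _, by simp⟩
  add_mem' hF hG := ⟨add_mem hF.1 hG.1, fun A B h h' => by
    rw [map_add, hF.2 A B h h', hG.2 A B h h', add_zero]⟩
  smul_mem' r F hF := ⟨Submodule.smul_mem _ r hF.1, fun A B h h' => by
    rw [map_smul, hF.2 A B h h', smul_zero]⟩

/-- The vector `e_none + ∑ ζ x e_x` outside `A`, and a basis vector on `A`. -/
def leadVec (A : Finset P) (a : A → L) (ζ : L → ℚ) (k : P) (x : Option L) : ℚ :=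
  if h : k ∈ A then (Pi.single (some (a ⟨k, h⟩)) 1 : Option L → ℚ) x else x.elim 1 ζ

theorem prod_leadVec_self (A : Finset P) (a b : A → L) (ζ : L → ℚ) :
    ∏ k, leadVec A a ζ k (extWord A b k) = if b = a then 1 else 0 := by
  have h1 : ∀ k, leadVec A a ζ k (extWord A b k) = if ∀ h : k ∈ A, b ⟨k, h⟩ = a ⟨k, h⟩ then 1 else 0 := by
    intro k
    by_cases h : k ∈ A <;> simp [leadVec, extWord, h, Pi.single_apply]
  simp only [h1, Finset.prod_ite_zero, Finset.prod_const_one, funext_iff, Subtype.forall,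
    Finset.mem_univ, true_imp_iff]

theorem prod_leadVec_ne_zero {A A' : Finset P} {a : A → L} {b : A' → L} {ζ : L → ℚ}
    (h : ∏ k, leadVec A a ζ k (extWord A' b k) ≠ 0) : A ⊆ A' := by
  intro k hk
  by_contra hk'
  refine h (Finset.prod_eq_zero (Finset.mem_univ k) ?_)
  simp [leadVec, extWord, hk, hk']

/-- Outside A and B the vectors e_none + ζ and the covectors e_none - ζ pair to 1 - ζ·ζ, which is
why ζ must be a unit vector as soon as both complements are nonempty. The other pairings vanish
because ζ is zero at the letters of `a` and `c`. -/
theorem sum_leadVec {A : Finset P} {B : Finset Q} {a : A → L} {c : B → L} {ζ : L → ℚ}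
    (hac : ∀ k l, a k ≠ c l) (ha : ∀ k, ζ (a k) = 0) (hc : ∀ l, ζ (c l) = 0)
    (hζ : (∃ k, k ∉ A) → (∃ l, l ∉ B) → ∑ x, ζ x * ζ x = 1) (k : P) (l : Q) :
    ∑ x, leadVec A a ζ k x * leadVec B c (-ζ) l x = 0 := by
  rw [Fintype.sum_option]
  by_cases hk : k ∈ A <;> by_cases hl : l ∈ B
  · simpa [leadVec, hk, hl, Pi.single_apply] using (hac ⟨k, hk⟩ ⟨l, hl⟩).symm
  · simp [leadVec, hk, hl, Pi.single_apply, ha]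
  · simp [leadVec, hk, hl, Pi.single_apply, hc]
  · simp [leadVec, hk, hl, hζ ⟨k, hk⟩ ⟨l, hl⟩]

/-- Every component of the associated graded space is fully attained. The image is gl-stable, so by
`tracelessWords_le` only basis tensors with disjoint letters need a lift. A pure tensor of
`leadVec`s serves: its nonzero components sit at pairs containing (A, B), so no other component of
the same or of smaller size appears. -/
theorem exists_leadingAt (hcard : Fintype.card P + Fintype.card Q ≤ Fintype.card L + 1)
    (A : Finset P) (B : Finset Q) :
    tracelessWords A B L ≤ (leadingAt A B).map (comp A B) := by
  have hA : A.card ≤ Fintype.card P := Finset.card_le_univ A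
  have hB : B.card ≤ Fintype.card Q := Finset.card_le_univ B
  refine tracelessWords_le ?_ ?_ ?_
  · rintro x y hxy _ ⟨F, hF, rfl⟩
    refine ⟨glOp (some x) (some y) F, ⟨glOp_mem_tracelessWords _ _ hF.1, fun A' B' h h' => ?_⟩,
      comp_glOp A B x y F⟩
    rw [comp_glOp, hF.2 A' B' h h', map_zero]
  · intro a c hac
    obtain ⟨ζ, ha, hc, hζ⟩ : ∃ ζ : L → ℚ, (∀ k, ζ (a k) = 0) ∧ (∀ l, ζ (c l) = 0) ∧
        ((∃ k, k ∉ A) → (∃ l, l ∉ B) → ∑ x, ζ x * ζ x = 1) := by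
      by_cases hp : (∃ k, k ∉ A) ∧ ∃ l, l ∉ B
      · obtain ⟨⟨k, hk⟩, ⟨l, hl⟩⟩ := hp
        -- With positions missing from both A and B, the two words have at most |P| + |Q| - 2 < |L|
        -- letters, and ζ can be the basis vector of an unused one.
        obtain ⟨z, hz⟩ : ∃ z, z ∉ Finset.univ.image a ∪ Finset.univ.image c := by
          by_contra! hall
          have h1 : Fintype.card L ≤ A.card + B.card := by
            rw [← Finset.card_univ, ← Finset.eq_univ_iff_forall.2 hall]
            refine (Finset.card_union_le _ _).trans (add_le_add ?_ ?_) <;>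
            · refine Finset.card_image_le.trans ?_
              simp
          have h2 := Finset.card_lt_univ_of_notMem hk
          have h3 := Finset.card_lt_univ_of_notMem hl
          omega
        simp only [Finset.mem_union, Finset.mem_image, Finset.mem_univ, true_and, not_or,
          not_exists] at hz
        exact ⟨Pi.single z 1, fun k => by simp [hz.1 k], fun l => by simp [hz.2 l],
          fun _ _ => by simp [Pi.single_apply]⟩
      · exact ⟨0, fun _ => rfl, fun _ => rfl, fun h1 h2 => absurd ⟨h1, h2⟩ hp⟩
    refine ⟨pureWords (leadVec A a ζ) (leadVec B c (-ζ)), ⟨pureWords_mem_tracelessWords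
      (sum_leadVec hac ha hc hζ), fun A' B' h h' => ?_⟩, ?_⟩
    · funext ⟨b, d⟩
      by_contra hne
      simp only [comp_apply, pureWords, Pi.zero_apply] at hne
      have h1 := prod_leadVec_ne_zero (left_ne_zero_of_mul hne)
      have h2 := prod_leadVec_ne_zero (right_ne_zero_of_mul hne)
      have h3 := Finset.card_le_card h1
      have h4 := Finset.card_le_card h2
      exact h' (Prod.ext (Finset.eq_of_subset_of_card_le h1 (by omega)).symm
        (Finset.eq_of_subset_of_card_le h2 (by omega)).symm)
    · funext ⟨b, d⟩
      simp only [comp_apply, pureWords, prod_leadVec_self, Pi.single_apply, Prod.mk.injEq]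
      split_ifs <;> simp_all
  · simp only [Fintype.card_coe]
    omega

/-- The permutation of the tensor factors. -/
def permOp (σ : Equiv.Perm P) (τ : Equiv.Perm Q) : Words P Q L →ₗ[ℚ] Words P Q L :=
  LinearMap.funLeft ℚ ℚ fun w => (w.1 ∘ σ, w.2 ∘ τ)

theorem permOp_apply (σ : Equiv.Perm P) (τ : Equiv.Perm Q) (F : Words P Q L) (a : P → L)
    (c : Q → L) : permOp σ τ F (a, c) = F (a ∘ σ, c ∘ τ) := rfl

theorem permOp_mem_tracelessWords (σ : Equiv.Perm P) (τ : Equiv.Perm Q) (F : Words P Q L)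
    (hF : F ∈ tracelessWords P Q L) : permOp σ τ F ∈ tracelessWords P Q L := by
  intro k l a c
  have h := hF (σ.symm k) (τ.symm l) (a ∘ σ) (c ∘ τ)
  rw [← h]
  refine Finset.sum_congr rfl fun x _ => ?_
  rw [permOp_apply, update_comp_equiv, update_comp_equiv]

variable (L) in
/-- The trace of a permutation of the tensor factors on the traceless tensors. -/
def permTrace (σ : Equiv.Perm P) (τ : Equiv.Perm Q) : ℚ :=
  LinearMap.trace ℚ (tracelessWords P Q L)
    ((permOp σ τ).restrict (permOp_mem_tracelessWords σ τ))

theorem extWord_comp (σ : Equiv.Perm P) (A : Finset P) (a : A → L) :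
    extWord A a ∘ σ = extWord (A.map σ.symm.toEmbedding) fun k => a ⟨σ k, by
      simpa [Finset.mem_map_equiv] using k.2⟩ := by
  funext k
  simp only [extWord, Finset.mem_map_equiv, Equiv.symm_symm]
  rfl

theorem comp_permOp_apply (σ : Equiv.Perm P) (τ : Equiv.Perm Q) (F : Words P Q (Option L))
    (A : Finset P) (B : Finset Q) (a : A → L) (c : B → L) :
    comp A B (permOp σ τ F) (a, c) =
      comp (A.map σ.symm.toEmbedding) (B.map τ.symm.toEmbedding) F
        (fun k => a ⟨σ k, by simpa [Finset.mem_map_equiv] using k.2⟩,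
          fun l => c ⟨τ l, by simpa [Finset.mem_map_equiv] using l.2⟩) := by
  rw [comp_apply, permOp_apply, extWord_comp, extWord_comp, comp_apply]

theorem permOp_mem_letterFiltration (σ : Equiv.Perm P) (τ : Equiv.Perm Q) (j : ℕ)
    (F : Words P Q (Option L)) (hF : F ∈ letterFiltration P Q L j) :
    permOp σ τ F ∈ letterFiltration P Q L j := by
  refine ⟨permOp_mem_tracelessWords σ τ F hF.1, fun A B h => ?_⟩
  funext ⟨a, c⟩
  rw [comp_permOp_apply, hF.2 _ _ (by simpa using h)]
  rfl

/-- The subset `A` is invariant under `σ`. -/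
abbrev Inv (σ : Equiv.Perm P) (A : Finset P) : Prop := ∀ k, σ k ∈ A ↔ k ∈ A

theorem map_symm_eq_iff (σ : Equiv.Perm P) (A : Finset P) :
    A.map σ.symm.toEmbedding = A ↔ Inv σ A := by
  rw [Finset.ext_iff]
  simp only [Finset.mem_map_equiv, Equiv.symm_symm]

/-- The summand of the trace at the component `(A, B)`. -/
def compEnd (σ : Equiv.Perm P) (τ : Equiv.Perm Q) (A : Finset P) (B : Finset Q) :
    tracelessWords A B L →ₗ[ℚ] tracelessWords A B L :=
  if h : Inv σ A ∧ Inv τ B then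
    (permOp (σ.subtypePerm h.1) (τ.subtypePerm h.2)).restrict (permOp_mem_tracelessWords _ _)
  else 0

/-- A permutation of the factors permutes the components, so it has a diagonal block at (A, B) only
if both subsets are invariant; otherwise the component comes from another pair of the same size,
where F vanishes. -/
theorem comp_permOp (σ : Equiv.Perm P) (τ : Equiv.Perm Q) {A : Finset P} {B : Finset Q}
    {F : Words P Q (Option L)} (hF : F ∈ letterFiltration P Q L (A.card + B.card))
    (h : ∀ A' B', A'.card + B'.card = A.card + B.card → (A', B') ≠ (A, B) → comp A' B' F = 0) :
    comp A B (permOp σ τ F) = compEnd σ τ A B ⟨comp A B F, comp_mem_tracelessWords hF⟩ := by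
  by_cases hst : Inv σ A ∧ Inv τ B
  · rw [compEnd, dif_pos hst]
    funext ⟨a, c⟩
    change F (extWord A a ∘ σ, extWord B c ∘ τ) = F (extWord A _, extWord B _)
    congr 1
    refine Prod.ext ?_ ?_
    · funext k
      simp only [Function.comp_apply, extWord, hst.1 k]
      rfl
    · funext k
      simp only [Function.comp_apply, extWord, hst.2 k]
      rfl
  · rw [compEnd, dif_neg hst]
    funext ⟨a, c⟩
    rw [comp_permOp_apply, h _ _ (by simp)]
    · rfl
    · intro he
      rw [Prod.mk.injEq, map_symm_eq_iff, map_symm_eq_iff] at he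
      exact hst he

theorem trace_letterFiltration_step
    (hcard : Fintype.card P + Fintype.card Q ≤ Fintype.card L + 1)
    (σ : Equiv.Perm P) (τ : Equiv.Perm Q) (j : ℕ) :
    LinearMap.trace ℚ (letterFiltration P Q L j)
        ((permOp σ τ).restrict (permOp_mem_letterFiltration σ τ j)) =
      LinearMap.trace ℚ (letterFiltration P Q L (j + 1))
        ((permOp σ τ).restrict (permOp_mem_letterFiltration σ τ (j + 1))) +
      ∑ s : {s : Finset P × Finset Q // s.1.card + s.2.card = j},
        LinearMap.trace ℚ _ (compEnd (L := L) σ τ s.1.1 s.1.2) := by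
  refine trace_filtration_step (ι := {s : Finset P × Finset Q // s.1.card + s.2.card = j})
    (Y := fun s => Words s.1.1 s.1.2 L)
    (show letterFiltration P Q L (j + 1) ≤ letterFiltration P Q L j from
      fun F hF => ⟨hF.1, fun A B h => hF.2 A B (by omega)⟩) _ _ _
    (fun s => comp s.1.1 s.1.2) (fun s => tracelessWords s.1.1 s.1.2 L) ?_ ?_ ?_ _ ?_
  · rintro F hF ⟨⟨A, B⟩, rfl⟩
    exact comp_mem_tracelessWords hF
  · intro F hF
    refine ⟨fun h s => h.2 _ _ (by omega), fun h => ⟨hF.1, fun A B hAB => ?_⟩⟩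
    rcases (Nat.lt_succ_iff_lt_or_eq.1 hAB) with hlt | heq
    · exact hF.2 A B hlt
    · exact h ⟨(A, B), heq⟩
  · rintro ⟨⟨A, B⟩, rfl⟩ u hu
    obtain ⟨F, hF, rfl⟩ := exists_leadingAt hcard A B hu
    refine ⟨F, ⟨hF.1, fun A' B' h => hF.2 A' B' h.le ?_⟩, rfl, ?_⟩
    · rintro ⟨⟩; exact lt_irrefl _ h
    · rintro ⟨⟨A', B'⟩, h⟩ hne
      exact hF.2 A' B' h.le fun he => hne (Subtype.ext he)
  · rintro ⟨⟨A, B⟩, rfl⟩ F hF h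
    exact comp_permOp σ τ hF fun A' B' hc hne =>
      h ⟨(A', B'), hc⟩ fun he => hne (congrArg Subtype.val he)

/-- The filtration by the number of letters of L starts at the whole space and reaches zero after
|P| + |Q| + 1 steps. Its graded pieces are the direct sums of the traceless spaces on the pairs (A,
B) of the given size, so the traces of the diagonal blocks add up. -/
theorem permTrace_option (hcard : Fintype.card P + Fintype.card Q ≤ Fintype.card L + 1)
    (σ : Equiv.Perm P) (τ : Equiv.Perm Q) :
    permTrace (Option L) σ τ =
      ∑ s : Finset P × Finset Q, LinearMap.trace ℚ _ (compEnd (L := L) σ τ s.1 s.2) := by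
  have htop : letterFiltration P Q L 0 = tracelessWords P Q (Option L) := by
    ext F
    exact ⟨fun h => h.1, fun h => ⟨h, by simp⟩⟩
  have hbot : letterFiltration P Q L (Fintype.card P + Fintype.card Q + 1) = ⊥ := by
    rw [Submodule.eq_bot_iff]
    intro F hF
    refine eq_zero_of_comp fun A B => hF.2 A B ?_
    have := Finset.card_le_univ A
    have := Finset.card_le_univ B
    omega
  have hind : ∀ m, LinearMap.trace ℚ (letterFiltration P Q L 0)
        ((permOp σ τ).restrict (permOp_mem_letterFiltration σ τ 0)) =
      LinearMap.trace ℚ (letterFiltration P Q L m)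
        ((permOp σ τ).restrict (permOp_mem_letterFiltration σ τ m)) +
      ∑ j ∈ Finset.range m, ∑ s : Finset P × Finset Q with s.1.card + s.2.card = j,
        LinearMap.trace ℚ _ (compEnd (L := L) σ τ s.1 s.2) := by
    intro m
    induction m with
    | zero => simp
    | succ m ih =>
      rw [ih, trace_letterFiltration_step hcard, Finset.sum_range_succ,
        ← Finset.sum_subtype (p := fun s : Finset P × Finset Q => s.1.card + s.2.card = m)
          (Finset.univ.filter fun s : Finset P × Finset Q => s.1.card + s.2.card = m)
          (by simp) fun s => LinearMap.trace ℚ _ (compEnd (L := L) σ τ s.1 s.2)]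
      ring
  have h0 : permTrace (Option L) σ τ = LinearMap.trace ℚ (letterFiltration P Q L 0)
        ((permOp σ τ).restrict (permOp_mem_letterFiltration σ τ 0)) := by
    exact trace_restrict_congr htop.symm _ _ _
  rw [h0, hind (Fintype.card P + Fintype.card Q + 1)]
  have h1 : LinearMap.trace ℚ (letterFiltration P Q L (Fintype.card P + Fintype.card Q + 1))
      ((permOp σ τ).restrict (permOp_mem_letterFiltration σ τ _)) = 0 := by
    have hs : Subsingleton (letterFiltration P Q L (Fintype.card P + Fintype.card Q + 1)) := by
      rw [hbot]; infer_instance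
    rw [Subsingleton.elim ((permOp σ τ).restrict (permOp_mem_letterFiltration σ τ _)) 0, map_zero]
  rw [h1, zero_add]
  refine Finset.sum_fiberwise_of_maps_to (fun s _ => ?_) _
  have := Finset.card_le_univ s.1
  have := Finset.card_le_univ s.2
  rw [Finset.mem_range]
  omega

end Branching

/-! ### Independence of the names of positions and letters -/

section Relabel

set_option linter.unusedSectionVars false

variable {P Q L P' Q' L' : Type} [Fintype P] [DecidableEq P] [Fintype Q] [DecidableEq Q]
  [Fintype L] [DecidableEq L] [Fintype P'] [DecidableEq P'] [Fintype Q'] [DecidableEq Q']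
  [Fintype L'] [DecidableEq L']

/-- Relabelling of the positions and of the alphabet. -/
def relabel (eP : P ≃ P') (eQ : Q ≃ Q') (eL : L ≃ L') : Words P Q L ≃ₗ[ℚ] Words P' Q' L' :=
  LinearEquiv.funCongrLeft ℚ ℚ
    ((Equiv.arrowCongr eP eL).prodCongr (Equiv.arrowCongr eQ eL)).symm

theorem relabel_apply (eP : P ≃ P') (eQ : Q ≃ Q') (eL : L ≃ L') (F : Words P Q L) (a : P' → L')
    (c : Q' → L') : relabel eP eQ eL F (a, c) = F (eL.symm ∘ a ∘ eP, eL.symm ∘ c ∘ eQ) := rfl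

theorem relabel_mem (eP : P ≃ P') (eQ : Q ≃ Q') (eL : L ≃ L') {F : Words P Q L}
    (hF : F ∈ tracelessWords P Q L) : relabel eP eQ eL F ∈ tracelessWords P' Q' L' := by
  intro k l a c
  rw [← hF (eP.symm k) (eQ.symm l) (eL.symm ∘ a ∘ eP) (eL.symm ∘ c ∘ eQ), ← eL.symm.sum_comp]
  refine Finset.sum_congr rfl fun x _ => ?_
  rw [relabel_apply, Function.update_comp_equiv, Function.update_comp_equiv,
    Function.comp_update, Function.comp_update]

theorem relabel_symm (eP : P ≃ P') (eQ : Q ≃ Q') (eL : L ≃ L') (F : Words P' Q' L') :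
    relabel eP.symm eQ.symm eL.symm F = (relabel eP eQ eL).symm F := by
  rw [LinearEquiv.eq_symm_apply]
  funext ⟨a, c⟩
  simp only [relabel_apply]
  refine congrArg F (Prod.ext (funext fun k => ?_) (funext fun k => ?_)) <;> simp

theorem map_relabel_tracelessWords (eP : P ≃ P') (eQ : Q ≃ Q') (eL : L ≃ L') :
    (tracelessWords P Q L).map (relabel eP eQ eL : Words P Q L →ₗ[ℚ] Words P' Q' L') =
      tracelessWords P' Q' L' := by
  refine le_antisymm ?_ fun F hF => ?_
  · rintro _ ⟨F, hF, rfl⟩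
    exact relabel_mem eP eQ eL hF
  · exact ⟨relabel eP.symm eQ.symm eL.symm F, relabel_mem _ _ _ hF, by
      rw [relabel_symm]; exact LinearEquiv.apply_symm_apply _ _⟩

theorem permTrace_relabel (eP : P ≃ P') (eQ : Q ≃ Q') (eL : L ≃ L') {σ : Equiv.Perm P}
    {τ : Equiv.Perm Q} {σ' : Equiv.Perm P'} {τ' : Equiv.Perm Q'}
    (hσ : ∀ k, σ' (eP k) = eP (σ k)) (hτ : ∀ k, τ' (eQ k) = eQ (τ k)) :
    permTrace L σ τ = permTrace L' σ' τ' := by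
  let e : tracelessWords P Q L ≃ₗ[ℚ] tracelessWords P' Q' L' :=
    LinearEquiv.ofSubmodules (relabel eP eQ eL) _ _ (map_relabel_tracelessWords eP eQ eL)
  rw [permTrace, permTrace, ← LinearMap.trace_conj' _ e]
  congr 1
  refine LinearMap.ext fun F => Subtype.ext ?_
  obtain ⟨F, rfl⟩ := e.surjective F
  rw [LinearEquiv.conj_apply_apply, LinearEquiv.symm_apply_apply]
  change relabel eP eQ eL (permOp σ τ F) = permOp σ' τ' (relabel eP eQ eL F)
  funext ⟨a, c⟩
  simp only [relabel_apply, permOp_apply]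
  refine congrArg F.1 (Prod.ext (funext fun k => ?_) (funext fun k => ?_)) <;> simp [hσ, hτ]

end Relabel

/-! ### Summation of polynomials -/

section Antidifference

open Polynomial

/-- The difference of X^(d+1) has degree d and leading coefficient d + 1; subtracting a multiple of
it from q lowers the degree bound. As d is only a bound, the coefficient at d + 1 is recorded
instead of a leading coefficient. -/
theorem exists_antidifference (d : ℕ) (q : ℚ[X]) (hq : q.natDegree ≤ d) :
    ∃ p : ℚ[X], p.natDegree ≤ d + 1 ∧ p.coeff (d + 1) = q.coeff d / (d + 1) ∧
      p.comp (X + 1) - p = q := by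
  have key : ∀ d : ℕ, ((X + 1 : ℚ[X]) ^ (d + 1) - X ^ (d + 1)).natDegree ≤ d ∧
      ((X + 1 : ℚ[X]) ^ (d + 1) - X ^ (d + 1)).coeff d = (d : ℚ) + 1 := by
    intro d
    refine ⟨?_, by simp [coeff_X_add_one_pow, coeff_X_pow]⟩
    rw [natDegree_le_iff_coeff_eq_zero]
    intro m hm
    rw [coeff_sub, coeff_X_add_one_pow, coeff_X_pow]
    rcases (Nat.succ_le_of_lt hm).eq_or_lt with h | h
    · simp [← h]
    · rw [Nat.choose_eq_zero_of_lt h, if_neg (by omega)]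
      simp
  induction d generalizing q with
  | zero =>
    refine ⟨C (q.coeff 0) * X, (natDegree_C_mul_le _ _).trans natDegree_X_le, by simp, ?_⟩
    conv_rhs => rw [eq_C_of_natDegree_le_zero hq]
    simp [mul_add]
  | succ d ih =>
    set c : ℚ := q.coeff (d + 1) / (d + 1 + 1) with hc
    obtain ⟨h1, h2⟩ := key (d + 1)
    set r : ℚ[X] := (X + 1 : ℚ[X]) ^ (d + 1 + 1) - X ^ (d + 1 + 1) with hr
    have hdeg : (q - C c * r).natDegree ≤ d := by
      rw [natDegree_le_iff_coeff_eq_zero]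
      intro m hm
      rw [coeff_sub, coeff_C_mul]
      rcases (Nat.succ_le_of_lt hm).eq_or_lt with h | h
      · rw [← h, h2, hc]
        push_cast
        field_simp
        ring
      · rw [natDegree_le_iff_coeff_eq_zero.1 hq m h, natDegree_le_iff_coeff_eq_zero.1 h1 m h]
        simp
    obtain ⟨p, hp1, hp2, hp3⟩ := ih _ hdeg
    refine ⟨p + C c * X ^ (d + 1 + 1), ?_, ?_, ?_⟩
    · exact natDegree_add_le_of_degree_le (hp1.trans (Nat.le_succ _)) (natDegree_C_mul_X_pow_le _ _)
    · rw [coeff_add, coeff_C_mul, coeff_X_pow, if_pos rfl,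
        natDegree_le_iff_coeff_eq_zero.1 hp1 _ (Nat.lt_succ_self _), hc]
      push_cast
      ring
    · simp only [add_comp, mul_comp, C_comp, pow_comp, X_comp]
      rw [add_sub_add_comm, hp3, ← mul_sub, ← hr]
      ring

/-- A function whose differences are polynomial is polynomial. -/
theorem exists_polynomial_of_difference {f : ℕ → ℚ} {d N : ℕ} {q : ℚ[X]} (hq : q.natDegree ≤ d)
    (h : ∀ n, N ≤ n → f (n + 1) = f n + q.eval (n : ℚ)) :
    ∃ p : ℚ[X], p.natDegree ≤ d + 1 ∧ p.coeff (d + 1) = q.coeff d / (d + 1) ∧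
      ∀ n, N ≤ n → f n = p.eval (n : ℚ) := by
  obtain ⟨p, hp1, hp2, hp3⟩ := exists_antidifference d q hq
  refine ⟨p + C (f N - p.eval (N : ℚ)), ?_, ?_, fun n hn => ?_⟩
  · exact natDegree_add_le_of_degree_le hp1 (by simp)
  · simp [hp2]
  · induction n, hn using Nat.le_induction with
    | base => simp
    | succ n hn ih =>
      rw [h n hn, ih, ← hp3]
      simp
      ring

end Antidifference

/-! ### Polynomiality of the traces of permutations -/

section TracePolynomial

set_option linter.unusedSectionVars false

open Polynomial

theorem trace_compEnd {P Q L : Type} [Fintype P] [DecidableEq P] [Fintype Q] [DecidableEq Q]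
    [Fintype L] [DecidableEq L] (σ : Equiv.Perm P) (τ : Equiv.Perm Q) (A : Finset P)
    (B : Finset Q) : LinearMap.trace ℚ _ (compEnd (L := L) σ τ A B) =
      if h : Inv σ A ∧ Inv τ B then permTrace L (σ.subtypePerm h.1) (τ.subtypePerm h.2) else 0 := by
  rw [compEnd]
  split_ifs
  · rfl
  · simp

/-- By the branching rule the difference in n is a sum over proper pairs (A, B) of traces with fewer
positions, polynomial of degree at most N - 1 by induction. In degree N - 1 only the N pairs missing
a single position matter, and they contribute 1 each when both permutations are trivial and 0
otherwise; summation divides N by N. The bound N ≤ n + 1 is the one under which the branching rule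
leads from n to n + 1. -/
theorem permTrace_eq_polynomial (N : ℕ) : ∀ (P Q : Type) [Fintype P] [DecidableEq P] [Fintype Q]
    [DecidableEq Q] (_ : Fintype.card P + Fintype.card Q = N) (σ : Equiv.Perm P)
    (τ : Equiv.Perm Q), ∃ p : ℚ[X], p.natDegree ≤ N ∧
      p.coeff N = (if σ = 1 ∧ τ = 1 then 1 else 0) ∧
      ∀ n : ℕ, N ≤ n + 1 → permTrace (Fin n) σ τ = p.eval (n : ℚ) := by
  induction N using Nat.strong_induction_on with
  | _ N ih =>
  intro P Q _ _ _ _ hN σ τ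
  rcases N with _ | d
  · refine ⟨1, by simp, ?_, fun n _ => ?_⟩
    · have : IsEmpty P := Fintype.card_eq_zero_iff.1 (by omega)
      have : IsEmpty Q := Fintype.card_eq_zero_iff.1 (by omega)
      rw [if_pos ⟨Subsingleton.elim _ _, Subsingleton.elim _ _⟩]
      simp
    · have : IsEmpty P := Fintype.card_eq_zero_iff.1 (by omega)
      have : IsEmpty Q := Fintype.card_eq_zero_iff.1 (by omega)
      have hT : tracelessWords P Q (Fin n) = ⊤ := by
        rw [eq_top_iff]
        intro F _ k
        exact isEmptyElim k
      have hid : (permOp σ τ).restrict (permOp_mem_tracelessWords (L := Fin n) σ τ) =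
          LinearMap.id := by
        refine LinearMap.ext fun F => Subtype.ext (funext fun w => ?_)
        exact congrArg F.1 (Subsingleton.elim _ _)
      rw [permTrace, hid, LinearMap.trace_id, hT, finrank_top, Module.finrank_fintype_fun_eq_card]
      simp
  · -- the polynomial of a proper component
    have hproper : ∀ s : Finset P × Finset Q, s ≠ (Finset.univ, Finset.univ) →
        s.1.card + s.2.card ≤ d := by
      rintro ⟨A, B⟩ hne
      by_contra! hlt
      replace hlt : d < A.card + B.card := hlt
      have h1 := Finset.card_le_univ A
      have h2 := Finset.card_le_univ B
      refine hne (Prod.ext ((Finset.card_eq_iff_eq_univ A).1 ?_)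
        ((Finset.card_eq_iff_eq_univ B).1 ?_)) <;> omega
    have hpoly : ∀ s : Finset P × Finset Q, ∃ p : ℚ[X],
        s ≠ (Finset.univ, Finset.univ) → p.natDegree ≤ d ∧
        p.coeff d = (if (σ = 1 ∧ τ = 1) ∧ s.1.card + s.2.card = d then 1 else 0) ∧
        ∀ n : ℕ, d ≤ n → LinearMap.trace ℚ _ (compEnd (L := Fin n) σ τ s.1 s.2) =
          p.eval (n : ℚ) := by
      rintro ⟨A, B⟩
      by_cases hs : (A, B) = (Finset.univ, Finset.univ)
      · exact ⟨0, fun h => absurd hs h⟩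
      have hd : A.card + B.card ≤ d := hproper _ hs
      by_cases hst : Inv σ A ∧ Inv τ B
      · obtain ⟨p, hp1, hp2, hp3⟩ := ih (A.card + B.card) (Nat.lt_succ_of_le hd) A B (by simp)
          (σ.subtypePerm hst.1) (τ.subtypePerm hst.2)
        refine ⟨p, fun _ => ⟨hp1.trans hd, ?_, fun n hn => ?_⟩⟩
        · by_cases hAB : A.card + B.card = d
          · rw [← hAB, hp2]
            congr 1
            simp only [and_true, eq_iff_iff]
            -- A permutation which fixes all points except possibly one is the identity, so
            -- restriction to such a component loses no information.
            have hinv : ∀ {R : Type} [Fintype R] [DecidableEq R] (ρ : Equiv.Perm R) (S : Finset R)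
                (hρ : Inv ρ S), Fintype.card R ≤ S.card + 1 → ρ.subtypePerm hρ = 1 → ρ = 1 := by
              intro R _ _ ρ S hρ hc h1
              have hmem : ∀ k ∈ S, ρ k = k := fun k hk =>
                congrArg Subtype.val (Equiv.Perm.ext_iff.1 h1 ⟨k, hk⟩)
              have hcompl : Sᶜ.card ≤ 1 := by rw [Finset.card_compl]; omega
              refine Equiv.ext fun k => ?_
              by_cases hk : k ∈ S
              · exact hmem k hk
              · exact Finset.card_le_one.1 hcompl _ (by simpa [hρ k] using hk) _ (by simpa using hk)
            have h1 := Finset.card_le_univ A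
            have h2 := Finset.card_le_univ B
            constructor
            · rintro ⟨h3, h4⟩
              exact ⟨hinv σ A hst.1 (by omega) h3, hinv τ B hst.2 (by omega) h4⟩
            · rintro ⟨rfl, rfl⟩
              exact ⟨rfl, rfl⟩
          · rw [if_neg (by tauto), coeff_eq_zero_of_natDegree_lt]
            exact lt_of_le_of_lt hp1 (lt_of_le_of_ne hd hAB)
        · rw [trace_compEnd, dif_pos hst, hp3 n (by omega)]
      · refine ⟨0, fun _ => ⟨by simp, ?_, fun n hn => ?_⟩⟩
        · rw [coeff_zero, if_neg]
          rintro ⟨⟨rfl, rfl⟩, _⟩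
          exact hst ⟨fun _ => Iff.rfl, fun _ => Iff.rfl⟩
        · rw [trace_compEnd, dif_neg hst, eval_zero]
    choose p hp using hpoly
    set S : Finset (Finset P × Finset Q) := Finset.univ.erase (Finset.univ, Finset.univ) with hS
    have hmemS : ∀ s ∈ S, s ≠ (Finset.univ, Finset.univ) := fun s hs => Finset.ne_of_mem_erase hs
    -- The summand at the full pair of subsets is the trace for n letters; all other summands have
    -- the polynomials `p s`.
    have hrec : ∀ n, d ≤ n → permTrace (Fin (n + 1)) σ τ =
        permTrace (Fin n) σ τ + (∑ s ∈ S, p s).eval (n : ℚ) := by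
      intro n hn
      rw [← permTrace_relabel (Equiv.refl P) (Equiv.refl Q) finSuccEquivLast.symm
        (fun _ => rfl) (fun _ => rfl) (L := Option (Fin n)) (σ := σ) (τ := τ),
        permTrace_option (by simpa using (by omega)),
        ← Finset.add_sum_erase _ _ (Finset.mem_univ (Finset.univ, Finset.univ)), ← hS,
        eval_finsetSum]
      congr 1
      · rw [trace_compEnd, dif_pos ⟨fun _ => by simp, fun _ => by simp⟩]
        exact permTrace_relabel (Equiv.subtypeUnivEquiv (by simp)) (Equiv.subtypeUnivEquiv (by simp))
          (Equiv.refl _) (fun _ => rfl) fun _ => rfl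
      · exact Finset.sum_congr rfl fun s hs => (hp s (hmemS s hs)).2.2 n hn
    have hdeg : (∑ s ∈ S, p s).natDegree ≤ d :=
      natDegree_sum_le_of_forall_le _ _ fun s hs => (hp s (hmemS s hs)).1
    have hcoeff : (∑ s ∈ S, p s).coeff d = if σ = 1 ∧ τ = 1 then (d : ℚ) + 1 else 0 := by
      rw [finsetSum_coeff, Finset.sum_congr rfl fun s hs => (hp s (hmemS s hs)).2.1]
      by_cases h1 : σ = 1 ∧ τ = 1
      · simp only [h1, true_and, and_self, if_true, Finset.sum_boole]
        -- A pair with exactly one position missing is determined by that position, an element of P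
        -- or of Q.
        have hbij : (S.filter fun s => s.1.card + s.2.card = d).card =
            (Finset.univ : Finset (P ⊕ Q)).card := by
          symm
          refine Finset.card_bij (fun x _ => x.elim (fun k => (Finset.univ.erase k, Finset.univ))
            fun l => (Finset.univ, Finset.univ.erase l)) ?_ ?_ ?_
          · rintro (k | l) -
            · have := Fintype.card_pos_iff.2 ⟨k⟩
              simp [hS, Finset.card_erase_of_mem]
              omega
            · have := Fintype.card_pos_iff.2 ⟨l⟩
              simp [hS, Finset.card_erase_of_mem]
              omega
          · rintro (k | l) - (k' | l') - h
            · simpa using (Finset.erase_inj _ (Finset.mem_univ k)).1 (congrArg Prod.fst h)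
            · simp at h
            · simp at h
            · simpa using (Finset.erase_inj _ (Finset.mem_univ l)).1 (congrArg Prod.snd h)
          · rintro ⟨A, B⟩ h
            simp only [hS, Finset.mem_filter, Finset.mem_erase, Finset.mem_univ, and_true] at h
            have e1 := Finset.card_add_card_compl A
            have e2 := Finset.card_add_card_compl B
            have e3 : Aᶜ.card + Bᶜ.card = 1 := by omega
            rcases Nat.add_eq_one_iff.1 e3 with ⟨e4, e5⟩ | ⟨e4, e5⟩
            · obtain ⟨l, hl⟩ := Finset.card_eq_one.1 e5
              refine ⟨Sum.inr l, Finset.mem_univ _, Prod.ext ?_ ?_⟩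
              · simpa using (compl_eq_bot.1 (Finset.card_eq_zero.1 e4)).symm
              · change Finset.univ.erase l = B
                rw [← compl_compl B, hl, Finset.compl_singleton]
            · obtain ⟨l, hl⟩ := Finset.card_eq_one.1 e4
              refine ⟨Sum.inl l, Finset.mem_univ _, Prod.ext ?_ ?_⟩
              · change Finset.univ.erase l = A
                rw [← compl_compl A, hl, Finset.compl_singleton]
              · simpa using (compl_eq_bot.1 (Finset.card_eq_zero.1 e5)).symm
        rw [hbij, Finset.card_univ, Fintype.card_sum, hN]
        push_cast
        rfl
      · simp [h1]
    obtain ⟨r, hr1, hr2, hr3⟩ := exists_polynomial_of_difference (f := fun n =>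
      permTrace (Fin n) σ τ) hdeg hrec
    refine ⟨r, hr1, ?_, fun n hn => hr3 n (by omega)⟩
    rw [hr2, hcoeff]
    split_ifs
    · field_simp
    · simp

end TracePolynomial

/-! ### Comparison of mixed tensors with their coordinates; elementary matrices -/

section Coordinates

open Function PiTensorProduct

variable {n p q : ℕ}

variable (n p q) in
/-- The coordinates of mixed tensors with respect to the standard basis. -/
def coords : Mixed n p q ≃ₗ[ℚ] Words (Fin p) (Fin q) (Fin n) :=
  ((Basis.piTensorProduct fun _ : Fin p => Pi.basisFun ℚ (Fin n)).tensorProduct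
    (Basis.piTensorProduct fun _ : Fin q => (Pi.basisFun ℚ (Fin n)).dualBasis)).equivFun

theorem coords_tmul (v : Fin p → H n) (f : Fin q → Module.Dual ℚ (H n)) :
    coords n p q (tprod ℚ v ⊗ₜ[ℚ] tprod ℚ f) =
      pureWords v fun l x => f l (Pi.single x 1) := by
  funext ⟨a, c⟩
  simp only [coords, Module.Basis.equivFun_apply, Module.Basis.tensorProduct_repr_tmul_apply,
    Basis.piTensorProduct_repr_tprod_apply, pureWords, Module.Basis.dualBasis_repr,
    Pi.basisFun_repr, Pi.basisFun_apply, smul_eq_mul]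
  ring

/-- The standard basis of mixed tensors. -/
def basisTensor (a : Fin p → Fin n) (c : Fin q → Fin n) : Mixed n p q :=
  tprod ℚ (fun k => (Pi.single (a k) 1 : H n)) ⊗ₜ[ℚ]
    tprod ℚ (fun l => (LinearMap.proj (c l) : Module.Dual ℚ (H n)))

theorem coords_basisTensor (a : Fin p → Fin n) (c : Fin q → Fin n) :
    coords n p q (basisTensor a c) = Pi.single (a, c) 1 := by
  rw [basisTensor, coords_tmul, single_eq_pureWords]
  congr 1
  funext l x
  simp [Pi.single_apply, eq_comm]

theorem coords_symm_single (w : (Fin p → Fin n) × (Fin q → Fin n)) (r : ℚ) :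
    (coords n p q).symm (Pi.single w r) = r • basisTensor w.1 w.2 := by
  rw [LinearEquiv.symm_apply_eq, map_smul, coords_basisTensor, ← Pi.single_smul, smul_eq_mul,
    mul_one]

theorem coords_symm_eq_sum (F : Words (Fin p) (Fin q) (Fin n)) :
    (coords n p q).symm F = ∑ w, F w • basisTensor w.1 w.2 := by
  conv_lhs => rw [← Finset.univ_sum_single F]
  rw [map_sum]
  exact Finset.sum_congr rfl fun w _ => coords_symm_single w _

theorem sum_dual_apply (f : Module.Dual ℚ (H n)) (v : H n) :
    ∑ x, v x * f (Pi.single x 1) = f v := by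
  conv_rhs => rw [← Finset.univ_sum_single v]
  rw [map_sum]
  refine Finset.sum_congr rfl fun x _ => ?_
  rw [← smul_eq_mul, ← map_smul, ← Pi.single_smul, smul_eq_mul, mul_one]

theorem coords_contraction (k : Fin (p + 1)) (l : Fin (q + 1)) (t : Mixed n (p + 1) (q + 1))
    (a : Fin p → Fin n) (c : Fin q → Fin n) :
    coords n p q (contraction n k l t) (a, c) =
      ∑ x, coords n (p + 1) (q + 1) t (k.insertNth x a, l.insertNth x c) := by
  have h : LinearMap.proj (a, c) ∘ₗ (coords n p q).toLinearMap ∘ₗ contraction n k l =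
      ∑ x, LinearMap.proj ((k.insertNth x a, l.insertNth x c) : (Fin (p + 1) → Fin n) × _) ∘ₗ
        (coords n (p + 1) (q + 1)).toLinearMap := by
    refine mixed_ext fun v f => ?_
    simp only [LinearMap.comp_apply, LinearMap.coe_sum, Finset.sum_apply, LinearEquiv.coe_coe,
      contraction_tmul, map_smul, coords_tmul, LinearMap.proj_apply, pureWords]
    rw [← sum_dual_apply]
    simp only [Fin.prod_univ_succAbove _ k, Fin.prod_univ_succAbove _ l,
      Fin.insertNth_apply_same, Fin.insertNth_apply_succAbove, smul_eq_mul, Finset.sum_mul]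
    exact Finset.sum_congr rfl fun x _ => by ring
  have := LinearMap.congr_fun h t
  simpa using this

theorem mem_traceless_iff : ∀ {p q : ℕ} {t : Mixed n p q},
    t ∈ traceless n p q ↔ coords n p q t ∈ tracelessWords (Fin p) (Fin q) (Fin n)
  | p + 1, q + 1, t => by
    simp only [traceless, Submodule.mem_iInf, LinearMap.mem_ker, mem_tracelessWords]
    constructor
    · intro h k l a c
      have := congrFun (congrArg (coords n p q) (h k l)) (k.removeNth a, l.removeNth c)
      rw [coords_contraction] at this
      simpa only [Fin.insertNth_removeNth, map_zero, Pi.zero_apply] using this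
    · intro h k l
      refine (coords n p q).injective (funext fun ⟨a, c⟩ => ?_)
      rw [coords_contraction, map_zero, Pi.zero_apply]
      rcases n with _ | n
      · simp
      · rw [← h k l (k.insertNth 0 a) (l.insertNth 0 c)]
        simp only [Fin.update_insertNth]
  | 0, q, t => by
    simp only [traceless, Submodule.mem_top, mem_tracelessWords, true_iff]
    exact fun k => k.elim0
  | p + 1, 0, t => by
    simp only [traceless, Submodule.mem_top, mem_tracelessWords, true_iff]
    exact fun _ l => l.elim0

theorem mixedMap_mul (g h : GL (Fin n) ℚ) :
    mixedMap n p q (g * h) = mixedMap n p q g ∘ₗ mixedMap n p q h := by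
  refine mixed_ext (E := Mixed n p q) fun v f => ?_
  simp only [mixedMap, LinearMap.comp_apply, TensorProduct.map_tmul, PiTensorProduct.map_tprod,
    map_mul, Module.End.mul_apply]

theorem mixedMap_one : mixedMap n p q (1 : GL (Fin n) ℚ) = LinearMap.id := by
  refine mixed_ext (E := Mixed n p q) fun v f => ?_
  simp only [mixedMap, TensorProduct.map_tmul, PiTensorProduct.map_tprod,
    map_one, Module.End.one_apply, LinearMap.id_apply]

/-- The elements of `GL(n, ℚ)` which map a space of mixed tensors into itself. -/
def mixedStabilizer (J : Submodule ℚ (Mixed n p q)) : Submonoid (GL (Fin n) ℚ) where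
  carrier := {g | ∀ t ∈ J, mixedMap n p q g t ∈ J}
  one_mem' t ht := by rwa [mixedMap_one]
  mul_mem' hg hh t ht := by
    rw [mixedMap_mul]
    exact hg _ (hh t ht)

theorem mem_mixedStabilizer {J : Submodule ℚ (Mixed n p q)} {g : GL (Fin n) ℚ} :
    g ∈ mixedStabilizer J ↔ ∀ t ∈ J, mixedMap n p q g t ∈ J := Iff.rfl

/-- The elementary matrices as elements of `GL(n, ℚ)`. -/
def elemGL {x y : Fin n} (h : x ≠ y) (t : ℚ) : GL (Fin n) ℚ where
  val := Matrix.transvection x y t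
  inv := Matrix.transvection x y (-t)
  val_inv := by rw [Matrix.transvection_mul_transvection_same _ _ h, add_neg_cancel,
    Matrix.transvection_zero]
  inv_val := by rw [Matrix.transvection_mul_transvection_same _ _ h, neg_add_cancel,
    Matrix.transvection_zero]

theorem elemGL_mul {x y : Fin n} (h : x ≠ y) (s t : ℚ) :
    elemGL h s * elemGL h t = elemGL h (s + t) :=
  Units.ext (Matrix.transvection_mul_transvection_same _ _ h s t)

theorem elemGL_inv {x y : Fin n} (h : x ≠ y) (t : ℚ) : (elemGL h t)⁻¹ = elemGL h (-t) :=
  Units.ext rfl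

theorem stdRep_elemGL {x y : Fin n} (h : x ≠ y) (t : ℚ) (v : H n) :
    stdRep n (elemGL h t) v = v + Pi.single x (t * v y) := by
  change Matrix.toLin' (Matrix.transvection x y t) v = _
  rw [Matrix.toLin'_apply, Matrix.transvection, Matrix.add_mulVec, Matrix.one_mulVec,
    Matrix.single_mulVec]
  rfl

theorem elemGL_nat_mem {J : Submodule ℚ (Mixed n p q)} {x y : Fin n} (h : x ≠ y)
    (hJ : elemGL h 1 ∈ mixedStabilizer J) (m : ℕ) : elemGL h (m : ℚ) ∈ mixedStabilizer J := by
  induction m with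
  | zero =>
    have : elemGL h ((0 : ℕ) : ℚ) = 1 := Units.ext (by simp [elemGL])
    rw [this]
    exact one_mem _
  | succ m ih =>
    rw [Nat.cast_succ, ← elemGL_mul]
    exact mul_mem ih hJ

end Coordinates

/-! ### From integral elementary matrices to rational ones and to the Lie algebra -/

section PolynomialFamilies

open Function PiTensorProduct Polynomial

variable {n p q : ℕ}

/-- A polynomial family of vectors whose values at the natural numbers lie in a subspace lies in
this subspace, and so does its derivative at zero. -/
theorem polynomial_family_mem {W : Type} [Fintype W] {J : Submodule ℚ (W → ℚ)} (r : W → ℚ[X])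
    (h : ∀ m : ℕ, (fun w => (r w).eval (m : ℚ)) ∈ J) :
    (∀ t : ℚ, (fun w => (r w).eval t) ∈ J) ∧ (fun w => (derivative (r w)).eval 0) ∈ J := by
  classical
  -- A functional which kills J turns the family into a polynomial vanishing at all natural numbers,
  -- hence zero. Its values and its derivative vanish too, and functionals killing J separate the
  -- points outside J.
  have key : ∀ φ : Module.Dual ℚ (W → ℚ), J.map φ = ⊥ →
      ∑ w, C (φ (Pi.single w 1)) * r w = 0 := by
    intro φ hφ
    refine Polynomial.eq_zero_of_infinite_isRoot _
      ((Set.infinite_range_of_injective (Nat.cast_injective (R := ℚ))).mono ?_)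
    rintro _ ⟨m, rfl⟩
    have h1 : φ (fun w => (r w).eval (m : ℚ)) = 0 := by
      rw [← Submodule.mem_bot ℚ, ← hφ]
      exact Submodule.mem_map_of_mem (h m)
    rw [Set.mem_ofPred_eq, IsRoot.def, eval_finsetSum, ← h1]
    conv_rhs => rw [← Finset.univ_sum_single fun w => (r w).eval (m : ℚ)]
    rw [map_sum]
    refine Finset.sum_congr rfl fun w _ => ?_
    rw [eval_mul, eval_C, mul_comm, ← smul_eq_mul, ← map_smul, ← Pi.single_smul, smul_eq_mul,
      mul_one]
  have hφ : ∀ (φ : Module.Dual ℚ (W → ℚ)) (F : W → ℚ),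
      φ F = ∑ w, φ (Pi.single w 1) * F w := by
    intro φ F
    conv_lhs => rw [← Finset.univ_sum_single F]
    rw [map_sum]
    refine Finset.sum_congr rfl fun w _ => ?_
    rw [mul_comm, ← smul_eq_mul, ← map_smul, ← Pi.single_smul, smul_eq_mul, mul_one]
  constructor
  · intro t
    by_contra hn
    obtain ⟨φ, h1, h2⟩ := Submodule.exists_dual_map_eq_bot_of_notMem hn inferInstance
    refine h1 ?_
    have := congrArg (Polynomial.eval t) (key φ h2)
    rw [hφ]
    simpa [eval_finsetSum] using this
  · by_contra hn
    obtain ⟨φ, h1, h2⟩ := Submodule.exists_dual_map_eq_bot_of_notMem hn inferInstance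
    refine h1 ?_
    have := congrArg (fun s => Polynomial.eval 0 (derivative s)) (key φ h2)
    rw [hφ]
    simpa [eval_finsetSum, derivative_sum] using this

/-- The coordinates of the image of a basis tensor under an elementary matrix, as polynomials in
the entry of the matrix. -/
def elemPoly (x y : Fin n) (w₀ w : (Fin p → Fin n) × (Fin q → Fin n)) : ℚ[X] :=
  (∏ k, (C ((Pi.single (w₀.1 k) 1 : H n) (w.1 k)) +
      X * C (if w.1 k = x then (Pi.single (w₀.1 k) 1 : H n) y else 0))) *
    ∏ l, (C ((Pi.single (w₀.2 l) 1 : H n) (w.2 l)) -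
      X * C (if w.2 l = y then (Pi.single (w₀.2 l) 1 : H n) x else 0))

theorem coords_mixedMap_elemGL {x y : Fin n} (h : x ≠ y) (t : ℚ)
    (w₀ w : (Fin p → Fin n) × (Fin q → Fin n)) :
    coords n p q (mixedMap n p q (elemGL h t) (basisTensor w₀.1 w₀.2)) w =
      (elemPoly x y w₀ w).eval t := by
  rw [basisTensor, mixedMap, TensorProduct.map_tmul, PiTensorProduct.map_tprod,
    PiTensorProduct.map_tprod, coords_tmul, pureWords, elemPoly, eval_mul, eval_prod, eval_prod]
  congr 1
  · refine Finset.prod_congr rfl fun k _ => ?_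
    rw [stdRep_elemGL]
    simp only [Pi.add_apply, eval_add, eval_mul, eval_C, eval_X, Pi.single_apply]
    split_ifs <;> simp
  · refine Finset.prod_congr rfl fun l _ => ?_
    change (stdRep n (elemGL h t)⁻¹ (Pi.single (w.2 l) 1)) (w₀.2 l) = _
    rw [elemGL_inv, stdRep_elemGL]
    simp only [Pi.add_apply, eval_sub, eval_mul, eval_C, eval_X, Pi.single_apply]
    by_cases h1 : w.2 l = y <;> by_cases h2 : w₀.2 l = x <;> by_cases h3 : w₀.2 l = w.2 l <;>
      simp_all [eq_comm]

/-- The product rule at the identity matrix yields one summand per tensor factor; the minus sign on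
the dual factors comes from the inverse matrix. -/
theorem derivative_elemPoly (x y : Fin n) (w₀ w : (Fin p → Fin n) × (Fin q → Fin n)) :
    (derivative (elemPoly x y w₀ w)).eval 0 = glOp x y (Pi.single w₀ 1) w := by
  have hw : (Pi.single w₀ 1 : Words (Fin p) (Fin q) (Fin n)) = pureWords
      (fun k => Pi.single (w₀.1 k) 1) (fun l => Pi.single (w₀.2 l) 1) :=
    single_eq_pureWords w₀.1 w₀.2
  obtain ⟨a, c⟩ := w
  rw [glOp_apply, hw]
  simp only [elemPoly, derivative_mul, derivative_prod_finset, eval_add, eval_mul,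
    eval_finsetSum, eval_prod, derivative_add, derivative_sub, derivative_C, derivative_X, one_mul, mul_zero,
    eval_sub, eval_C, eval_X, zero_mul, add_zero, sub_zero, zero_add, zero_sub, pureWords]
  rw [sub_eq_add_neg, Finset.sum_mul, Finset.mul_sum, ← Finset.sum_neg_distrib]
  congr 1
  · refine Finset.sum_congr rfl fun k _ => ?_
    have e : ∏ k' ∈ Finset.univ.erase k, (Pi.single (w₀.1 k') 1 : H n) (update a k y k') =
        ∏ k' ∈ Finset.univ.erase k, (Pi.single (w₀.1 k') 1 : H n) (a k') :=
      Finset.prod_congr rfl fun k' hk' => by rw [update_of_ne (Finset.ne_of_mem_erase hk')]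
    rw [← Finset.mul_prod_erase _ (fun k' => (Pi.single (w₀.1 k') 1 : H n) (update a k y k'))
      (Finset.mem_univ k), update_self, e]
    split_ifs
    · ring
    · ring
  · refine Finset.sum_congr rfl fun l _ => ?_
    have e : ∏ k' ∈ Finset.univ.erase l, (Pi.single (w₀.2 k') 1 : H n) (update c l x k') =
        ∏ k' ∈ Finset.univ.erase l, (Pi.single (w₀.2 k') 1 : H n) (c k') :=
      Finset.prod_congr rfl fun k' hk' => by rw [update_of_ne (Finset.ne_of_mem_erase hk')]
    rw [← Finset.mul_prod_erase _ (fun k' => (Pi.single (w₀.2 k') 1 : H n) (update c l x k'))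
      (Finset.mem_univ l), update_self, e]
    split_ifs
    · simp only [eval_neg, eval_C]; ring
    · simp

/-- Powers of the matrix with entry 1 give stability for all natural entries, and the image of a
tensor has coordinates polynomial in the entry. By `polynomial_family_mem` this forces stability for
rational entries, and the derivative at zero is the operator `glOp x y`. -/
theorem elemGL_stable {J : Submodule ℚ (Mixed n p q)} {x y : Fin n} (h : x ≠ y)
    (hJ : elemGL h 1 ∈ mixedStabilizer J) :
    (∀ t, elemGL h t ∈ mixedStabilizer J) ∧
      ∀ F ∈ J.map (coords n p q).toLinearMap, glOp x y F ∈ J.map (coords n p q).toLinearMap := by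
  have key : ∀ Z ∈ J, (∀ t, mixedMap n p q (elemGL h t) Z ∈ J) ∧
      glOp x y (coords n p q Z) ∈ J.map (coords n p q).toLinearMap := by
    intro Z hZ
    let r : (Fin p → Fin n) × (Fin q → Fin n) → ℚ[X] := fun w =>
      ∑ w₀, C (coords n p q Z w₀) * elemPoly x y w₀ w
    have hZs : Z = ∑ w, coords n p q Z w • basisTensor w.1 w.2 := by
      rw [← coords_symm_eq_sum, LinearEquiv.symm_apply_apply]
    have hr : ∀ t, coords n p q (mixedMap n p q (elemGL h t) Z) = fun w => (r w).eval t := by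
      intro t
      funext w
      conv_lhs => rw [hZs]
      simp only [map_sum, map_smul, Finset.sum_apply, Pi.smul_apply, coords_mixedMap_elemGL,
        r, eval_finsetSum, eval_mul, eval_C, smul_eq_mul]
    have hd : (fun w => (derivative (r w)).eval 0) = glOp x y (coords n p q Z) := by
      funext w
      conv_rhs => rw [← Finset.univ_sum_single (coords n p q Z)]
      simp only [r, eval_finsetSum, derivative_C_mul, eval_mul, eval_C,
        derivative_elemPoly, map_sum, Finset.sum_apply]
      refine Finset.sum_congr rfl fun w₀ _ => ?_
      rw [← smul_eq_mul, ← Pi.smul_apply, ← map_smul, ← Pi.single_smul, smul_eq_mul, mul_one]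
    obtain ⟨h1, h2⟩ := polynomial_family_mem (J := J.map (coords n p q).toLinearMap) r fun m => by
      rw [← hr]
      exact ⟨_, elemGL_nat_mem h hJ m Z hZ, rfl⟩
    refine ⟨fun t => ?_, hd ▸ h2⟩
    obtain ⟨Z', hZ', he⟩ := h1 t
    rw [← hr] at he
    rwa [← (coords n p q).injective he]
  refine ⟨fun t Z hZ => (key Z hZ).1 t, ?_⟩
  rintro _ ⟨Z, hZ, rfl⟩
  exact (key Z hZ).2

/-- For `n ≥ p + q`, a space of mixed tensors which is stable under the elementary matrices and
contains the basis tensors with distinct letters contains all traceless tensors. -/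
theorem traceless_le {J : Submodule ℚ (Mixed n p q)}
    (hJ : ∀ x y (h : x ≠ y), elemGL h 1 ∈ mixedStabilizer J)
    (hinj : ∀ a c, Injective a → Injective c → (∀ k l, a k ≠ c l) → basisTensor a c ∈ J)
    (hn : p + q ≤ n) : traceless n p q ≤ J := by
  have hE : ∀ x y, x ≠ y → ∀ F ∈ J.map (coords n p q).toLinearMap,
      glOp x y F ∈ J.map (coords n p q).toLinearMap := fun x y h => (elemGL_stable h (hJ x y h)).2
  have hle := tracelessWords_le hE (single_mem_of_injective hE (fun a c ha hc hac =>
    ⟨_, hinj a c ha hc hac, coords_basisTensor a c⟩) (by simpa using hn))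
    (by simp only [Fintype.card_fin]; omega)
  intro t ht
  obtain ⟨t', ht', he⟩ := hle (mem_traceless_iff.1 ht)
  rwa [← (coords n p q).injective he]

/-- For `n ≥ p + q`, the traceless tensors are spanned by decomposable ones. -/
theorem traceless_le_span (hn : p + q ≤ n) : traceless n p q ≤ Submodule.span ℚ
    {t | ∃ (v : Fin p → H n) (f : Fin q → Module.Dual ℚ (H n)), (∀ k l, f l (v k) = 0) ∧
      tprod ℚ v ⊗ₜ[ℚ] tprod ℚ f = t} := by
  -- The span is stable since the group preserves the pairings f_l(v_k), and it contains the basis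
  -- tensors with disjoint letters.
  refine traceless_le (fun x y h => ?_) (fun a c _ _ hac => ?_) hn
  · rw [mem_mixedStabilizer]
    intro t ht
    induction ht using Submodule.span_induction with
    | mem t ht =>
      obtain ⟨v, f, hvf, rfl⟩ := ht
      refine Submodule.subset_span ⟨_, _, fun k l => ?_, (by
        rw [mixedMap, TensorProduct.map_tmul, PiTensorProduct.map_tprod,
          PiTensorProduct.map_tprod])⟩
      rw [← hvf k l]
      change f l (stdRep n _ (stdRep n _ (v k))) = f l (v k)
      rw [← Module.End.mul_apply, ← map_mul, inv_mul_cancel, map_one, Module.End.one_apply]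
    | zero => rw [map_zero]; exact zero_mem _
    | add s t _ _ hs ht => rw [map_add]; exact add_mem hs ht
    | smul r t _ ht => rw [map_smul]; exact Submodule.smul_mem _ r ht
  · refine Submodule.subset_span ⟨_, _, fun k l => ?_, rfl⟩
    simp [(hac k l).symm]

end PolynomialFamilies

/-! ### From elementary matrices to all of GL(n, ℚ) -/

section DiagonalMatrices

open Function PiTensorProduct Polynomial

/-- A space of functions which is stable under multiplication by `α` is stable under
multiplication by all functions which factor through `α`. -/
theorem mul_mem_of_factorsThrough {W : Type} [Fintype W] {J : Submodule ℚ (W → ℚ)} {α β : W → ℚ}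
    (hα : ∀ F ∈ J, α * F ∈ J) (hβ : β.FactorsThrough α) : ∀ F ∈ J, β * F ∈ J := by
  classical
  have key : ∀ (f : ℚ[X]), ∀ F ∈ J, (fun w => f.eval (α w)) * F ∈ J := by
    intro f
    induction f using Polynomial.induction_on' with
    | add f g hf hg =>
      intro F hF
      have : (fun w => (f + g).eval (α w)) * F =
          (fun w => f.eval (α w)) * F + (fun w => g.eval (α w)) * F := by
        funext w; simp [add_mul]
      rw [this]
      exact add_mem (hf F hF) (hg F hF)
    | monomial m a =>
      induction m with
      | zero =>
        intro F hF
        have : (fun w => (monomial 0 a).eval (α w)) * F = a • F := by funext w; simp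
        rw [this]
        exact J.smul_mem a hF
      | succ m ih =>
        intro F hF
        have : (fun w => (monomial (m + 1) a).eval (α w)) * F =
            (fun w => (monomial m a).eval (α w)) * (α * F) := by
          funext w; simp [pow_succ]; ring
        rw [this]
        exact ih _ (hα F hF)
  intro F hF
  -- On the finite set of values of α, any function of α agrees with a polynomial in α.
  convert key (Lagrange.interpolate (Finset.univ.image α) id (extend α β 0)) F hF using 2
  funext w
  have h := Lagrange.eval_interpolate_at_node (v := id) (extend α β 0) injective_id.injOn
    (Finset.mem_image_of_mem α (Finset.mem_univ w))
  rw [hβ.extend_apply, id] at h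
  exact h.symm

variable {n p q : ℕ}

/-- The diagonal matrices as elements of `GL(n, ℚ)`. -/
def diagGL (n : ℕ) : (Fin n → ℚˣ) →* GL (Fin n) ℚ :=
  (Units.map (Matrix.diagonalRingHom (Fin n) ℚ).toMonoidHom).comp
    (MulEquiv.piUnits.symm : (Fin n → ℚˣ) ≃* _).toMonoidHom

theorem diagGL_val (u : Fin n → ℚˣ) :
    (diagGL n u : Matrix (Fin n) (Fin n) ℚ) = Matrix.diagonal fun x => (u x : ℚ) := rfl

theorem stdRep_diagGL (u : Fin n → ℚˣ) (v : H n) (x : Fin n) :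
    stdRep n (diagGL n u) v x = u x * v x := by
  change Matrix.toLin' (diagGL n u : Matrix (Fin n) (Fin n) ℚ) v x = _
  rw [Matrix.toLin'_apply, diagGL_val, Matrix.mulVec_diagonal]

theorem stdRep_injective (n : ℕ) : Injective (stdRep n) :=
  fun _ _ h => Units.ext (Matrix.toLin'.injective h)

/-- The product of elementary matrices which is diagonal with entries `2` and `1 / 2`. -/
theorem diagGL_eq_mul_elemGL {x y : Fin n} (h : x ≠ y) :
    diagGL n (Pi.mulSingle x (Units.mk0 2 two_ne_zero) * Pi.mulSingle y (Units.mk0 2 two_ne_zero)⁻¹) =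
      elemGL h.symm (-1 / 2) * elemGL h 1 * elemGL h.symm 1 * elemGL h (-1 / 2) := by
  refine stdRep_injective n (LinearMap.ext fun v => funext fun z => ?_)
  rw [stdRep_diagGL]
  simp only [map_mul, Module.End.mul_apply, stdRep_elemGL, Pi.add_apply, Pi.mul_apply,
    Pi.single_apply, Pi.mulSingle_apply, if_true, if_neg h, if_neg h.symm]
  by_cases h1 : z = x
  · subst h1
    simp [h]
    ring
  · by_cases h2 : z = y
    · subst h2
      simp [h1]
      ring
    · simp [h1, h2]

/-- The weight of a word, as a character of the diagonal matrices. -/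
def weight (w : (Fin p → Fin n) × (Fin q → Fin n)) : (Fin n → ℚˣ) →* ℚˣ :=
  (∏ k, Pi.evalMonoidHom (fun _ => ℚˣ) (w.1 k)) / ∏ l, Pi.evalMonoidHom (fun _ => ℚˣ) (w.2 l)

theorem weight_apply (w : (Fin p → Fin n) × (Fin q → Fin n)) (u : Fin n → ℚˣ) :
    weight w u = (∏ k, u (w.1 k)) / ∏ l, u (w.2 l) := by
  simp [weight, MonoidHom.div_apply]

theorem coords_mixedMap_diagGL (u : Fin n → ℚˣ) (t : Mixed n p q) :
    coords n p q (mixedMap n p q (diagGL n u) t) =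
      (fun w => (weight w u : ℚ)) * coords n p q t := by
  have h : (coords n p q).toLinearMap ∘ₗ mixedMap n p q (diagGL n u) =
      LinearMap.mulLeft ℚ (fun w => (weight w u : ℚ)) ∘ₗ (coords n p q).toLinearMap := by
    refine mixed_ext fun v f => funext fun w => ?_
    have hd : ∀ (f : Module.Dual ℚ (H n)) x, (stdRep n).dual (diagGL n u) f (Pi.single x 1) =
        (u x : ℚ)⁻¹ * f (Pi.single x 1) := by
      intro f x
      change f (stdRep n (diagGL n u)⁻¹ (Pi.single x 1)) = _
      rw [← map_inv, ← smul_eq_mul, ← map_smul]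
      congr 1
      funext z
      rw [stdRep_diagGL]
      by_cases hz : z = x
      · subst hz; simp
      · simp [hz]
    simp only [LinearMap.comp_apply, mixedMap, TensorProduct.map_tmul, PiTensorProduct.map_tprod,
      LinearEquiv.coe_coe, coords_tmul, LinearMap.mulLeft_apply, Pi.mul_apply, pureWords,
      stdRep_diagGL, hd, Finset.prod_mul_distrib, weight_apply, Units.val_div_eq_div_val,
      Units.coe_prod, Finset.prod_inv_distrib]
    ring
  exact LinearMap.congr_fun h t

theorem diagGL_mem_iff {J : Submodule ℚ (Mixed n p q)} {u : Fin n → ℚˣ} :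
    diagGL n u ∈ mixedStabilizer J ↔ ∀ F ∈ J.map (coords n p q).toLinearMap,
      (fun w => (weight w u : ℚ)) * F ∈ J.map (coords n p q).toLinearMap := by
  rw [mem_mixedStabilizer]
  constructor
  · rintro h _ ⟨t, ht, rfl⟩
    exact ⟨_, h t ht, coords_mixedMap_diagGL u t⟩
  · intro h t ht
    obtain ⟨t', ht', he⟩ := h _ ⟨t, ht, rfl⟩
    replace he := he.trans (coords_mixedMap_diagGL u t).symm
    rwa [← (coords n p q).injective he]

theorem weight_mulSingle (x : Fin n) :
    ∃ m : (Fin p → Fin n) × (Fin q → Fin n) → ℤ, ∀ w s, weight w (Pi.mulSingle x s) = s ^ m w := by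
  refine ⟨fun w => (Finset.univ.filter fun k => w.1 k = x).card -
    (Finset.univ.filter fun l => w.2 l = x).card, fun w s => ?_⟩
  rw [weight_apply, zpow_sub, zpow_natCast, zpow_natCast]
  simp only [Pi.mulSingle_apply, Finset.prod_ite, Finset.prod_const, one_pow, mul_one]
  rw [div_eq_mul_inv]

/-- Elementary matrices have determinant 1, so diagonal matrices of other determinants need an
argument. The product over y of the matrices with 2 at x and 1/2 at y is diagonal with 2^n at x,
times the scalar 1/2. On mixed tensors the scalar acts by one constant, so this product separates
the exponents of the entry at x. Interpolation then gives every diagonal matrix which differs from 1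
only at x. -/
theorem diagGL_mem {J : Submodule ℚ (Mixed n p q)}
    (hJ : ∀ x y (h : x ≠ y), elemGL h 1 ∈ mixedStabilizer J) (u : Fin n → ℚˣ) :
    diagGL n u ∈ mixedStabilizer J := by
  suffices hs : ∀ x s, diagGL n (Pi.mulSingle x s) ∈ mixedStabilizer J by
    have : u ∈ (mixedStabilizer J).comap (diagGL n) := by
      rw [← Finset.univ_prod_mulSingle u]
      exact Submonoid.prod_mem _ fun x _ => hs x (u x)
    exact this
  intro x s
  set two : ℚˣ := Units.mk0 2 two_ne_zero with htwo
  have hxy : ∀ y, (Pi.mulSingle x two * Pi.mulSingle y two⁻¹ : Fin n → ℚˣ) ∈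
      (mixedStabilizer J).comap (diagGL n) := by
    intro y
    rw [Submonoid.mem_comap]
    by_cases h : x = y
    · subst h
      rw [← Pi.mulSingle_mul, mul_inv_cancel, Pi.mulSingle_one, map_one]
      exact one_mem _
    · rw [diagGL_eq_mul_elemGL h]
      have h1 := (elemGL_stable h (hJ x y h)).1
      have h2 := (elemGL_stable (Ne.symm h) (hJ y x (Ne.symm h))).1
      exact mul_mem (mul_mem (mul_mem (h2 _) (h1 _)) (h2 _)) (h1 _)
  have hprod := Submonoid.prod_mem _ fun y (_ : y ∈ Finset.univ) => hxy y
  rw [Finset.prod_mul_distrib, Finset.prod_const, Finset.card_univ, Fintype.card_fin,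
    Finset.univ_prod_mulSingle (fun _ : Fin n => two⁻¹), Submonoid.mem_comap] at hprod
  obtain ⟨m, hm⟩ := weight_mulSingle (p := p) (q := q) x
  rw [diagGL_mem_iff] at hprod ⊢
  refine mul_mem_of_factorsThrough hprod fun w w' hww' => ?_
  have hn : (n : ℤ) ≠ 0 := by have := x.2; omega
  have hc : ∀ w : (Fin p → Fin n) × (Fin q → Fin n),
      weight w (fun _ : Fin n => two⁻¹) = two⁻¹ ^ p / two⁻¹ ^ q := fun w => by
    simp [weight_apply]
  simp only [map_mul, map_pow, hm, hc] at hww'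
  have h2 := mul_right_cancel (Units.ext hww')
  rw [← zpow_natCast, ← zpow_natCast, ← zpow_mul, ← zpow_mul] at h2
  have h3 := congrArg Units.val h2
  rw [Units.val_zpow_eq_zpow_val, Units.val_zpow_eq_zpow_val] at h3
  have h4 := zpow_right_injective₀ (a := (two : ℚ)) (by norm_num [htwo]) (by norm_num [htwo]) h3
  have h5 := mul_right_cancel₀ hn h4
  simp only [hm, h5]

/-- A space of mixed tensors which is stable under the elementary matrices with entries `1` is
stable under `GL(n, ℚ)`. -/
theorem mixedStabilizer_eq_top {J : Submodule ℚ (Mixed n p q)}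
    (hJ : ∀ x y (h : x ≠ y), elemGL h 1 ∈ mixedStabilizer J) : mixedStabilizer J = ⊤ := by
  rw [eq_top_iff]
  rintro g -
  refine Matrix.diagonal_transvection_induction_of_det_ne_zero
    (fun M => ∀ g : GL (Fin n) ℚ, (g : Matrix (Fin n) (Fin n) ℚ) = M → g ∈ mixedStabilizer J)
    (g : Matrix (Fin n) (Fin n) ℚ) ?_ ?_ ?_ ?_ g rfl
  · exact (Matrix.isUnit_iff_isUnit_det _).1 g.isUnit |>.ne_zero
  · intro D hD g hg
    rw [Matrix.det_diagonal] at hD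
    have hD' := fun x => (Finset.prod_ne_zero_iff.1 hD) x (Finset.mem_univ x)
    have : g = diagGL n fun x => Units.mk0 (D x) (hD' x) := Units.ext hg
    rw [this]
    exact diagGL_mem hJ _
  · rintro ⟨x, y, h, c⟩ g hg
    have : g = elemGL h c := Units.ext hg
    rw [this]
    exact (elemGL_stable h (hJ x y h)).1 c
  · intro A B hA hB h1 h2 g hg
    have : g = Matrix.GeneralLinearGroup.mkOfDetNeZero A hA *
        Matrix.GeneralLinearGroup.mkOfDetNeZero B hB := Units.ext hg
    rw [this]
    exact mul_mem (h1 _ rfl) (h2 _ rfl)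

end DiagonalMatrices

/-! ### The splitting of H from U and injectivity on the traceless part -/

section TracelessProjection

open PiTensorProduct

/-- The contraction `U = Hom(H, ⋀² H) → H`. -/
def contractU (n : ℕ) : U n →ₗ[ℚ] H n :=
  LinearMap.pi fun z => ∑ x : Fin n,
    exteriorPower.pairingDual ℚ (H n) 2
      (exteriorPower.ιMulti ℚ 2 ![LinearMap.proj x, LinearMap.proj z]) ∘ₗ
      LinearMap.applyₗ (Pi.single x 1)

theorem contractU_apply {n : ℕ} (f : U n) (z : Fin n) :
    contractU n f z = ∑ x : Fin n, exteriorPower.pairingDual ℚ (H n) 2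
      (exteriorPower.ιMulti ℚ 2 ![LinearMap.proj x, LinearMap.proj z]) (f (Pi.single x 1)) := by
  simp [contractU]

theorem pairingDual_wedge {n : ℕ} (x z : Fin n) (a b : H n) :
    exteriorPower.pairingDual ℚ (H n) 2
      (exteriorPower.ιMulti ℚ 2 ![LinearMap.proj x, LinearMap.proj z]) (wedge (H n) a b) =
      a x * b z - b x * a z := by
  rw [wedge_apply, exteriorPower.pairingDual_ιMulti_ιMulti, Matrix.det_fin_two]
  simp
  ring

theorem contractU_smulRight {n : ℕ} (f : Module.Dual ℚ (H n)) (a b : H n) :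
    contractU n (f.smulRight (wedge (H n) a b)) = f a • b - f b • a := by
  funext z
  rw [contractU_apply]
  simp only [LinearMap.smulRight_apply, map_smul, pairingDual_wedge, smul_eq_mul, Pi.sub_apply,
    Pi.smul_apply]
  rw [← sum_dual_apply f a, ← sum_dual_apply f b, Finset.sum_mul, Finset.sum_mul,
    ← Finset.sum_sub_distrib]
  exact Finset.sum_congr rfl fun x _ => by ring

/-- Contracting x ↦ h ∧ x gives h once, from the first factor, minus the trace n of the identity
times h. The factor is nonzero for n ≠ 1, so H is then a direct summand. -/
theorem contractU_wedge {n : ℕ} (h : H n) : contractU n (wedge (H n) h) = (1 - n : ℚ) • h := by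
  funext z
  rw [contractU_apply]
  simp only [pairingDual_wedge, Finset.sum_sub_distrib, Pi.smul_apply, smul_eq_mul,
    Pi.single_apply]
  simp [sub_mul]

/-- The projection of `U` onto the kernel of the contraction. -/
def kernelProj (n : ℕ) : U n →ₗ[ℚ] U n :=
  LinearMap.id - (1 - n : ℚ)⁻¹ • wedge (H n) ∘ₗ contractU n

theorem kernelProj_smulRight {n : ℕ} {f : Module.Dual ℚ (H n)} {a b : H n} (ha : f a = 0)
    (hb : f b = 0) :
    kernelProj n (f.smulRight (wedge (H n) a b)) = f.smulRight (wedge (H n) a b) := by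
  simp [kernelProj, contractU_smulRight, ha, hb]

theorem hInU_le_ker_kernelProj {n : ℕ} (hn : n ≠ 1) : hInU n ≤ LinearMap.ker (kernelProj n) := by
  rintro _ ⟨h, rfl⟩
  have hn' : (1 - n : ℚ) ≠ 0 := sub_ne_zero.2 (by exact_mod_cast hn.symm)
  simp [kernelProj, contractU_wedge, smul_smul, hn']

/-- By `traceless_le_span` it suffices to treat decomposable tensors all of whose pairings vanish;
each factor (a ∧ b) ⊗ f then has contraction zero. -/
theorem map_kernelProj_of_mem_tl {n i : ℕ} (hn : 3 * i ≤ n) {x : ⋀[ℚ]^i (U n)}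
    (hx : x ∈ (tl n i).toSubmodule) : exteriorPower.map i (kernelProj n) x = x := by
  obtain ⟨t, ht, rfl⟩ := hx
  have ht' := traceless_le_span (n := n) (p := 2 * i) (q := i) (by omega) ht
  clear ht
  induction ht' using Submodule.span_induction with
  | mem t ht =>
    obtain ⟨v, f, hvf, rfl⟩ := ht
    rw [toExtU_tmul, exteriorPower.map_apply_ιMulti]
    congr 1
    funext j
    exact kernelProj_smulRight (hvf _ _) (hvf _ _)
  | zero => simp
  | add s t _ _ hs ht => rw [map_add, map_add, hs, ht]
  | smul r t _ ht => rw [map_smul, map_smul, ht]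

/-- For `n ≥ 3i` the projection `⋀^i U → ⋀^i Uᴼ` is injective on the traceless part. -/
theorem map_mkQ_injOn_tl {n i : ℕ} (hn : 3 * i ≤ n) :
    Set.InjOn (exteriorPower.map i (hInU n).mkQ) (tl n i).toSubmodule := by
  rcases Nat.eq_zero_or_pos i with rfl | hi
  -- For i = 0 the value n = 1 is allowed, where H does not split off; but the zeroth exterior power
  -- does not depend on the space.
  · have h := exteriorPower.zeroEquiv_naturality (R := ℚ) (hInU n).mkQ
    intro x _ y _ hxy
    refine (exteriorPower.zeroEquiv ℚ (U n)).injective ?_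
    have h1 := LinearMap.congr_fun h x
    have h2 := LinearMap.congr_fun h y
    simp only [LinearMap.comp_apply, LinearEquiv.coe_coe] at h1 h2
    rw [← h1, ← h2, hxy]
  · have h : kernelProj n = (hInU n).liftQ (kernelProj n)
        (hInU_le_ker_kernelProj (by omega)) ∘ₗ (hInU n).mkQ := by
      rw [Submodule.liftQ_mkQ]
    intro x hx y hy hxy
    rw [← map_kernelProj_of_mem_tl hn hx, ← map_kernelProj_of_mem_tl hn hy, h,
      exteriorPower.map_comp, LinearMap.comp_apply, LinearMap.comp_apply, hxy]

end TracelessProjection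

/-! ### The dimension of the traceless part through a signed symmetrizer -/

section Symmetrizer

open PiTensorProduct

/-- After division by m the endomorphism ι ∘ π of T is idempotent with the same kernel as π on T, so
its trace is the dimension of π(T). -/
theorem finrank_map_eq_trace_div {V W : Type} [AddCommGroup V] [Module ℚ V] [FiniteDimensional ℚ V]
    [AddCommGroup W] [Module ℚ W] {π : V →ₗ[ℚ] W} {ι : W →ₗ[ℚ] V} {m : ℚ} (hm : m ≠ 0)
    (h : π ∘ₗ ι ∘ₗ π = m • π) {T : Submodule ℚ V} (hT : ∀ x ∈ T, (ι ∘ₗ π) x ∈ T) :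
    m * Module.finrank ℚ (T.map π) = LinearMap.trace ℚ T ((ι ∘ₗ π).restrict hT) := by
  have h' : ∀ x, π (ι (π x)) = m • π x := fun x => LinearMap.congr_fun h x
  set e : T →ₗ[ℚ] T := m⁻¹ • (ι ∘ₗ π).restrict hT with he
  have hval : ∀ x : T, (e x : V) = m⁻¹ • ι (π x) := fun x => rfl
  have hπe : ∀ x : T, π (e x) = π x := fun x => by
    rw [hval, map_smul, h', inv_smul_smul₀ hm]
  have hker : LinearMap.ker e = LinearMap.ker (π.domRestrict T) := by
    ext x
    rw [LinearMap.mem_ker, LinearMap.mem_ker, LinearMap.domRestrict_apply]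
    constructor
    · intro hx
      rw [← hπe, hx, Submodule.coe_zero, map_zero]
    · intro hx
      ext
      rw [hval, hx, map_zero, smul_zero, Submodule.coe_zero]
  have hproj : LinearMap.IsProj (LinearMap.range e) e := by
    refine ⟨fun x => ⟨x, rfl⟩, ?_⟩
    rintro _ ⟨x, rfl⟩
    ext
    rw [hval, hπe, hval]
  have h1 := hproj.trace
  have h2 := LinearMap.finrank_range_add_finrank_ker e
  have h3 := LinearMap.finrank_range_add_finrank_ker (π.domRestrict T)
  rw [hker] at h2
  rw [LinearMap.range_domRestrict] at h3
  have h4 : Module.finrank ℚ (LinearMap.range e) = Module.finrank ℚ (T.map π) := by omega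
  rw [← h4, ← h1, he, map_smul, smul_eq_mul, mul_inv_cancel_left₀ hm]

/-- The `2i` positions of the vectors, arranged in `i` blocks of two. -/
def blockEquiv (i : ℕ) : Fin i × Fin 2 ≃ Fin (2 * i) :=
  finProdFinEquiv.trans (finCongr (Nat.mul_comm i 2))

theorem blockEquiv_zero {i : ℕ} (j : Fin i) : blockEquiv i (j, 0) = evenIdx j :=
  Fin.ext (by simp [blockEquiv, evenIdx])

theorem blockEquiv_one {i : ℕ} (j : Fin i) : blockEquiv i (j, 1) = oddIdx j :=
  Fin.ext (by simp [blockEquiv, oddIdx, add_comm])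

/-- The permutations of the blocks and of the positions within each block. -/
abbrev BlockPerm (i : ℕ) : Type := Equiv.Perm (Fin i) × (Fin i → Equiv.Perm (Fin 2))

/-- The permutation of the `2i` positions given by a permutation of the blocks and permutations
within each block. -/
def BlockPerm.toPerm {i : ℕ} (g : BlockPerm i) : Equiv.Perm (Fin (2 * i)) :=
  (blockEquiv i).permCongr (Equiv.prodShear g.1 g.2)

theorem BlockPerm.toPerm_apply {i : ℕ} (g : BlockPerm i) (j : Fin i) (b : Fin 2) :
    g.toPerm (blockEquiv i (j, b)) = blockEquiv i (g.1 j, g.2 j b) := by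
  simp [BlockPerm.toPerm, Equiv.permCongr_apply, Equiv.prodShear]

/-- The product of the signs of all permutations involved. -/
def BlockPerm.sgn {i : ℕ} (g : BlockPerm i) : ℤˣ :=
  Equiv.Perm.sign g.1 * ∏ j, Equiv.Perm.sign (g.2 j)

theorem BlockPerm.toPerm_eq_one {i : ℕ} (g : BlockPerm i) :
    (g.toPerm⁻¹ = 1 ∧ g.1⁻¹ = 1) ↔ g = 1 := by
  rw [inv_eq_one, inv_eq_one]
  constructor
  · rintro ⟨h1, h2⟩
    refine Prod.ext h2 (funext fun j => Equiv.ext fun b => ?_)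
    have := BlockPerm.toPerm_apply g j b
    rw [h1, Equiv.Perm.one_apply] at this
    exact ((Prod.ext_iff.1 ((blockEquiv i).injective this)).2).symm
  · rintro rfl
    refine ⟨Equiv.ext fun k => ?_, rfl⟩
    obtain ⟨⟨j, b⟩, rfl⟩ := (blockEquiv i).surjective k
    rw [BlockPerm.toPerm_apply]
    rfl

variable {n i : ℕ}

theorem toExtU_tmul_blocks (v : Fin (2 * i) → H n) (f : Fin i → Module.Dual ℚ (H n)) :
    toExtU n i (tprod ℚ v ⊗ₜ[ℚ] tprod ℚ f) = exteriorPower.ιMulti ℚ i fun j =>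
      (f j).smulRight (exteriorPower.ιMulti ℚ 2 fun b => v (blockEquiv i (j, b))) := by
  rw [toExtU_tmul]
  congr 1
  funext j
  rw [wedge_apply, ← blockEquiv_zero, ← blockEquiv_one]
  congr 2
  funext b
  fin_cases b <;> rfl

theorem permOp_coords_tmul (g : BlockPerm i) (v : Fin (2 * i) → H n)
    (f : Fin i → Module.Dual ℚ (H n)) :
    permOp g.toPerm⁻¹ g.1⁻¹ (coords n (2 * i) i (tprod ℚ v ⊗ₜ[ℚ] tprod ℚ f)) =
      coords n (2 * i) i (tprod ℚ (v ∘ g.toPerm) ⊗ₜ[ℚ] tprod ℚ (f ∘ g.1)) := by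
  funext ⟨a, c⟩
  rw [permOp_apply, coords_tmul, coords_tmul, pureWords, pureWords]
  dsimp only
  congr 1
  · rw [← Equiv.prod_comp g.toPerm]
    simp
  · rw [← Equiv.prod_comp g.1]
    simp

/-- The map π is alternating in the i blocks and in the two vectors of each block, so a block
permutation acts through the product of all the signs. The covectors have to move along with the
blocks. -/
theorem toExtU_permOp (g : BlockPerm i) (F : Words (Fin (2 * i)) (Fin i) (Fin n)) :
    toExtU n i ((coords n (2 * i) i).symm (permOp g.toPerm⁻¹ g.1⁻¹ F)) =
      (g.sgn : ℚ) • toExtU n i ((coords n (2 * i) i).symm F) := by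
  have h : toExtU n i ∘ₗ (coords n (2 * i) i).symm.toLinearMap ∘ₗ permOp g.toPerm⁻¹ g.1⁻¹ ∘ₗ
      (coords n (2 * i) i).toLinearMap = (g.sgn : ℚ) • toExtU n i := by
    refine mixed_ext fun v f => ?_
    simp only [LinearMap.comp_apply, LinearEquiv.coe_coe, permOp_coords_tmul,
      LinearEquiv.symm_apply_apply, toExtU_tmul_blocks, LinearMap.smul_apply, Function.comp_apply,
      BlockPerm.toPerm_apply]
    have h1 : ∀ j, (f (g.1 j)).smulRight (exteriorPower.ιMulti ℚ 2 fun b =>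
        v (blockEquiv i (g.1 j, g.2 j b))) = ((Equiv.Perm.sign (g.2 j) : ℤ) : ℚ) •
          (fun j => (f j).smulRight (exteriorPower.ιMulti ℚ 2 fun b => v (blockEquiv i (j, b))))
            (g.1 j) := by
      intro j
      have h2 := (exteriorPower.ιMulti ℚ 2).map_perm (fun b => v (blockEquiv i (g.1 j, b))) (g.2 j)
      refine LinearMap.ext fun x => ?_
      simp only [LinearMap.smulRight_apply, LinearMap.smul_apply]
      rw [smul_comm]
      congr 1
    simp only [h1]
    rw [← AlternatingMap.coe_multilinearMap, MultilinearMap.map_smul_univ,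
      AlternatingMap.coe_multilinearMap]
    have h3 := (exteriorPower.ιMulti ℚ i).map_perm (fun j =>
      (f j).smulRight (exteriorPower.ιMulti ℚ 2 fun b => v (blockEquiv i (j, b)))) g.1
    refine (congrArg _ h3).trans ?_
    rw [Units.smul_def, ← Int.cast_smul_eq_zsmul ℚ, smul_smul]
    congr 1
    simp [BlockPerm.sgn, mul_comm]
  have := LinearMap.congr_fun h ((coords n (2 * i) i).symm F)
  simpa using this

variable (n i) in
/-- The map from `⋀^i U` to words given by evaluation of determinants. -/
def detWords : ⋀[ℚ]^i (U n) →ₗ[ℚ] Words (Fin (2 * i)) (Fin i) (Fin n) :=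
  LinearMap.pi fun w => exteriorPower.pairingDual ℚ (U n) i (exteriorPower.ιMulti ℚ i fun l =>
    exteriorPower.pairingDual ℚ (H n) 2 (exteriorPower.ιMulti ℚ 2 fun b =>
      LinearMap.proj (w.1 (blockEquiv i (l, b)))) ∘ₗ LinearMap.applyₗ (Pi.single (w.2 l) 1))

/-- The Leibniz formula for the outer i × i determinant and for the 2 × 2 determinants inside it;
the choices of permutations are exactly the elements of `BlockPerm i`. -/
theorem detWords_toExtU (F : Words (Fin (2 * i)) (Fin i) (Fin n)) :
    detWords n i (toExtU n i ((coords n (2 * i) i).symm F)) =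
      ∑ g : BlockPerm i, (g.sgn : ℚ) • permOp g.toPerm⁻¹ g.1⁻¹ F := by
  have h : detWords n i ∘ₗ toExtU n i = (∑ g : BlockPerm i, (g.sgn : ℚ) •
      permOp g.toPerm⁻¹ g.1⁻¹) ∘ₗ (coords n (2 * i) i).toLinearMap := by
    refine mixed_ext fun v f => funext fun w => ?_
    simp only [LinearMap.comp_apply, LinearEquiv.coe_coe, LinearMap.coe_sum, Finset.sum_apply,
      LinearMap.smul_apply, permOp_coords_tmul]
    simp only [Pi.smul_apply, coords_tmul, detWords, LinearMap.pi_apply, toExtU_tmul_blocks]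
    rw [exteriorPower.pairingDual_ιMulti_ιMulti, Matrix.det_apply, Fintype.sum_prod_type]
    refine Finset.sum_congr rfl fun s _ => ?_
    simp only [Matrix.of_apply, LinearMap.comp_apply, LinearMap.applyₗ_apply_apply,
      LinearMap.smulRight_apply, map_smul, exteriorPower.pairingDual_ιMulti_ιMulti,
      Matrix.det_apply, LinearMap.proj_apply, smul_eq_mul, Finset.prod_mul_distrib]
    rw [Finset.prod_univ_sum, Fintype.piFinset_univ, Finset.mul_sum, Finset.smul_sum]
    refine Finset.sum_congr rfl fun ε _ => ?_
    rw [pureWords, ← Equiv.prod_comp (blockEquiv i), Fintype.prod_prod_type]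
    simp only [Function.comp_apply, BlockPerm.toPerm_apply, BlockPerm.sgn, Units.smul_def,
      ← Int.cast_smul_eq_zsmul ℚ, smul_eq_mul, Finset.prod_mul_distrib]
    push_cast
    ring
  have := LinearMap.congr_fun h ((coords n (2 * i) i).symm F)
  simpa using this

/-- The signed symmetrizer preserves the traceless words. Each of its summands is undone by π, as
both signs multiply to 1, so π ∘ `detWords` ∘ π is the group order times π and
`finrank_map_eq_trace_div` applies. -/
theorem card_mul_finrank_tl :
    (Fintype.card (BlockPerm i) : ℚ) * Module.finrank ℚ (tl n i).toSubmodule =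
      ∑ g : BlockPerm i, (g.sgn : ℚ) * permTrace (Fin n) g.toPerm⁻¹ g.1⁻¹ := by
  set T := tracelessWords (Fin (2 * i)) (Fin i) (Fin n) with hT
  set π := toExtU n i ∘ₗ (coords n (2 * i) i).symm.toLinearMap with hπ
  have hsum : ∀ F, (detWords n i ∘ₗ π) F =
      ∑ g : BlockPerm i, (g.sgn : ℚ) • permOp g.toPerm⁻¹ g.1⁻¹ F := detWords_toExtU
  have hmem : ∀ F ∈ T, (detWords n i ∘ₗ π) F ∈ T := by
    intro F hF
    rw [hsum]
    exact Submodule.sum_mem _ fun g _ => T.smul_mem _ (permOp_mem_tracelessWords _ _ F hF)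
  have hmap : (tl n i).toSubmodule = T.map π := by
    ext x
    constructor
    · rintro ⟨t, ht, rfl⟩
      exact ⟨_, mem_traceless_iff.1 ht, by simp [hπ]⟩
    · rintro ⟨F, hF, rfl⟩
      exact ⟨_, mem_traceless_iff.2 (by simpa using hF), rfl⟩
  rw [hmap, finrank_map_eq_trace_div (ι := detWords n i) (by exact_mod_cast Fintype.card_ne_zero)
    ?_ hmem]
  · have : (detWords n i ∘ₗ π).restrict hmem = ∑ g : BlockPerm i, (g.sgn : ℚ) •
        (permOp g.toPerm⁻¹ g.1⁻¹).restrict (permOp_mem_tracelessWords (L := Fin n) _ _) := by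
      refine LinearMap.ext fun F => Subtype.ext ?_
      rw [LinearMap.coe_restrict_apply, hsum]
      simp
    rw [this, map_sum]
    exact Finset.sum_congr rfl fun g _ => by rw [map_smul, smul_eq_mul, permTrace]
  · refine LinearMap.ext fun F => ?_
    change π ((detWords n i ∘ₗ π) F) = _
    rw [hsum, map_sum, LinearMap.smul_apply]
    have h1 : ∀ g : BlockPerm i, π ((g.sgn : ℚ) • permOp g.toPerm⁻¹ g.1⁻¹ F) = π F := by
      intro g
      rw [map_smul]
      change _ • toExtU n i ((coords n (2 * i) i).symm (permOp g.toPerm⁻¹ g.1⁻¹ F)) = _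
      rw [toExtU_permOp, smul_smul]
      have : ((g.sgn : ℤ) : ℚ) * ((g.sgn : ℤ) : ℚ) = 1 := by
        rw [← Int.cast_mul, ← Units.val_mul, Int.units_mul_self]; simp
      rw [this, one_smul]
      rfl
    simp only [h1, Finset.sum_const, Finset.card_univ, ← Nat.cast_smul_eq_nsmul ℚ]

/-- For `n ≥ 3i` the dimension of the traceless part of `⋀^i U` is a polynomial in `n` of
degree `3i`. -/
theorem exists_polynomial_finrank_tl (i : ℕ) : ∃ P : Polynomial ℚ,
    P.degree = ((3 * i : ℕ) : WithBot ℕ) ∧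
      ∀ n : ℕ, 3 * i ≤ n → P.eval (n : ℚ) = Module.finrank ℚ (tl n i).toSubmodule := by
  classical
  choose p hdeg hcoeff heval using fun g : BlockPerm i => permTrace_eq_polynomial (3 * i)
    (Fin (2 * i)) (Fin i) (by simp only [Fintype.card_fin]; omega) g.toPerm⁻¹ g.1⁻¹
  have hm : (Fintype.card (BlockPerm i) : ℚ) ≠ 0 := by exact_mod_cast Fintype.card_ne_zero
  refine ⟨Polynomial.C (Fintype.card (BlockPerm i) : ℚ)⁻¹ *
    ∑ g : BlockPerm i, Polynomial.C (g.sgn : ℚ) * p g, ?_, fun n hn => ?_⟩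
  · rw [Polynomial.degree_C_mul (inv_ne_zero hm)]
    refine Polynomial.degree_eq_of_le_of_coeff_ne_zero ?_ ?_
    · refine (Polynomial.degree_sum_le _ _).trans (Finset.sup_le fun g _ => ?_)
      exact Polynomial.degree_le_of_natDegree_le
        ((Polynomial.natDegree_C_mul_le _ _).trans (hdeg g))
    -- The coefficient of degree 3i receives a contribution only from g = 1, namely 1, so no
    -- cancellation can occur.
    · rw [Polynomial.finsetSum_coeff]
      simp only [Polynomial.coeff_C_mul, hcoeff, BlockPerm.toPerm_eq_one]
      simp [BlockPerm.sgn]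
  · rw [Polynomial.eval_mul, Polynomial.eval_C, Polynomial.eval_finsetSum,
      inv_mul_eq_iff_eq_mul₀ hm, card_mul_finrank_tl]
    refine Finset.sum_congr rfl fun g _ => ?_
    rw [Polynomial.eval_mul, Polynomial.eval_C, heval g n (by omega)]

end Symmetrizer

/-! ### Homology classes of commuting elements -/

section HomologyClasses

open CategoryTheory

variable {G K : Type} [Group G] [Group K] {V W : Type} [AddCommGroup V] [Module ℚ V]
  [AddCommGroup W] [Module ℚ W]

theorem homologyMap_comp {L : Type} [Group L] (f : G →* K) (g : K →* L) (i : ℕ) :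
    homologyMap (g.comp f) i = homologyMap g i ∘ₗ homologyMap f i :=
  congrArg ModuleCat.Hom.hom (groupHomology.map_comp (A := Rep.trivial ℚ G ℚ)
    (B := Rep.trivial ℚ K ℚ) (C := Rep.trivial ℚ L ℚ) f g
    (Rep.ofHom ⟨LinearMap.id, fun _ => rfl⟩) (Rep.ofHom ⟨LinearMap.id, fun _ => rfl⟩) i)

/-- The map `Hᵢ(G; ℚ) → ⋀^i V` induced by a homomorphism `G → V`. -/
def homologyHom (f : G →* Multiplicative V) (i : ℕ) : Homology G i →ₗ[ℚ] ⋀[ℚ]^i V :=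
  homologyToExt V i ∘ₗ homologyMap f i

theorem homologyHom_comp (f : K →* Multiplicative V) (h : G →* K) (i : ℕ) :
    homologyHom (f.comp h) i = homologyHom f i ∘ₗ homologyMap h i := by
  rw [homologyHom, homologyMap_comp, homologyHom, LinearMap.comp_assoc]

/-- Brings the map down to inhomogeneous chains, where classes can be evaluated explicitly. -/
theorem homologyHom_π (f : G →* Multiplicative V) (i : ℕ)
    (z : groupHomology.cycles (Rep.trivial ℚ G ℚ) i) :
    homologyHom f i (groupHomology.π (Rep.trivial ℚ G ℚ) i z) = extChain V i
      (Finsupp.lmapDomain ℚ ℚ (f ∘ ·) (groupHomology.iCycles (Rep.trivial ℚ G ℚ) i z)) := by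
  have h1 := congrArg (fun φ => φ.hom z) (groupHomology.π_map (A := Rep.trivial ℚ G ℚ)
    (B := Rep.trivial ℚ (Multiplicative V) ℚ) f (Rep.ofHom ⟨LinearMap.id, fun _ => rfl⟩) i)
  refine (congrArg (homologyToExt V i) h1).trans ((homologyToExt_π V i _).trans ?_)
  have h2 := congrArg (fun φ => φ.hom z) (HomologicalComplex.cyclesMap_i
    (groupHomology.chainsMap (A := Rep.trivial ℚ G ℚ) (B := Rep.trivial ℚ (Multiplicative V) ℚ) f
      (Rep.ofHom ⟨LinearMap.id, fun _ => rfl⟩)) i)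
  refine congrArg (extChain V i) (h2.trans ?_)
  refine Finsupp.ext fun w => ?_
  rfl

theorem extChain_map (φ : V →ₗ[ℚ] W) (i : ℕ) (F : (Fin i → Multiplicative V) →₀ ℚ) :
    extChain W i (Finsupp.lmapDomain ℚ ℚ (AddMonoidHom.toMultiplicative φ.toAddMonoidHom ∘ ·) F) =
      exteriorPower.map i φ (extChain V i F) := by
  have h : extChain W i ∘ₗ
      Finsupp.lmapDomain ℚ ℚ (AddMonoidHom.toMultiplicative φ.toAddMonoidHom ∘ ·) =
      exteriorPower.map i φ ∘ₗ extChain V i := by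
    refine Finsupp.lhom_ext fun v a => ?_
    simp only [LinearMap.comp_apply, Finsupp.lmapDomain_apply, Finsupp.mapDomain_single,
      extChain_single, map_smul, exteriorPower.map_apply_ιMulti]
    rfl
  exact LinearMap.congr_fun h F

theorem homologyHom_map (f : G →* Multiplicative V) (φ : V →ₗ[ℚ] W) (i : ℕ) :
    homologyHom ((AddMonoidHom.toMultiplicative φ.toAddMonoidHom).comp f) i =
      exteriorPower.map i φ ∘ₗ homologyHom f i := by
  refine LinearMap.ext fun x => ?_
  induction x using groupHomology_induction_on with
  | h z =>
    rw [homologyHom_π, LinearMap.comp_apply, homologyHom_π, ← extChain_map]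
    congr 1
    simp only [Finsupp.lmapDomain_apply]
    rw [← Finsupp.mapDomain_comp]
    rfl

/-- The chain `∑_s sgn(s) [g_{s(1)} | ⋯ | g_{s(i)}]`. -/
def antisymChain {i : ℕ} (g : Fin i → G) : (Fin i → G) →₀ ℚ :=
  ∑ s : Equiv.Perm (Fin i), ((Equiv.Perm.sign s : ℤ) : ℚ) • Finsupp.single (g ∘ s) 1

theorem contractNth_comp_swap {m : ℕ} {v : Fin (m + 1) → G} (hv : ∀ j k, Commute (v j) (v k))
    (j : Fin m) : Fin.contractNth j.castSucc (· * ·) (v ∘ Equiv.swap j.castSucc j.succ) =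
      Fin.contractNth j.castSucc (· * ·) v := by
  funext k
  rcases lt_trichotomy (k : ℕ) j with h | h | h
  · rw [Fin.contractNth_apply_of_lt _ _ _ _ (by simpa using h),
      Fin.contractNth_apply_of_lt _ _ _ _ (by simpa using h), Function.comp_apply,
      Equiv.swap_apply_of_ne_of_ne]
    · intro e; have := congrArg Fin.val e; simp at this; omega
    · intro e; have := congrArg Fin.val e; simp at this; omega
  · rw [Fin.contractNth_apply_of_eq _ _ _ _ (by simpa using h),
      Fin.contractNth_apply_of_eq _ _ _ _ (by simpa using h), Fin.ext h]
    simp only [Function.comp_apply, Equiv.swap_apply_left, Equiv.swap_apply_right]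
    exact hv _ _
  · rw [Fin.contractNth_apply_of_gt _ _ _ _ (by simpa using h),
      Fin.contractNth_apply_of_gt _ _ _ _ (by simpa using h), Function.comp_apply,
      Equiv.swap_apply_of_ne_of_ne]
    · intro e; have := congrArg Fin.val e; simp at this; omega
    · intro e; have := congrArg Fin.val e; simp at this; omega

/-- Transposing the two neighbours which are multiplied leaves the face unchanged, by commutativity,
and reverses the sign: the sum is its own negative. -/
theorem sum_sign_contractNth_castSucc {m : ℕ} {g : Fin (m + 1) → G}
    (hg : ∀ j k, Commute (g j) (g k)) (j : Fin m) :
    ∑ s : Equiv.Perm (Fin (m + 1)), ((Equiv.Perm.sign s : ℤ) : ℚ) •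
      Finsupp.single (Fin.contractNth j.castSucc (· * ·) (g ∘ s)) (1 : ℚ) = 0 := by
  have hne : j.castSucc ≠ j.succ := fun e => by have := congrArg Fin.val e; simp at this
  have h := Equiv.sum_comp (Equiv.mulRight (Equiv.swap j.castSucc j.succ))
    fun s : Equiv.Perm (Fin (m + 1)) => ((Equiv.Perm.sign s : ℤ) : ℚ) •
      Finsupp.single (Fin.contractNth j.castSucc (· * ·) (g ∘ s)) (1 : ℚ)
  have h2 : ∀ s : Equiv.Perm (Fin (m + 1)),
      ((Equiv.Perm.sign (s * Equiv.swap j.castSucc j.succ) : ℤ) : ℚ) •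
      Finsupp.single (Fin.contractNth j.castSucc (· * ·)
        (g ∘ (s * Equiv.swap j.castSucc j.succ : Equiv.Perm _))) (1 : ℚ) =
      - (((Equiv.Perm.sign s : ℤ) : ℚ) •
      Finsupp.single (Fin.contractNth j.castSucc (· * ·) (g ∘ s)) (1 : ℚ)) := by
    intro s
    rw [Equiv.Perm.coe_mul, ← Function.comp_assoc, contractNth_comp_swap (v := g ∘ s) fun _ _ => hg _ _,
      Equiv.Perm.sign_mul, Equiv.Perm.sign_swap hne]
    simp
  simp only [Equiv.coe_mulRight, h2, Finset.sum_neg_distrib] at h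
  exact self_eq_neg.1 h.symm

/-- Reindexing by the cyclic rotation, of sign (-1)^m, turns the last face into the first one. -/
theorem sum_sign_contractNth_last {m : ℕ} (g : Fin (m + 1) → G) :
    ∑ s : Equiv.Perm (Fin (m + 1)), ((Equiv.Perm.sign s : ℤ) : ℚ) •
      Finsupp.single (Fin.contractNth (Fin.last m) (· * ·) (g ∘ s)) (1 : ℚ) =
    (-1 : ℚ) ^ m • ∑ s : Equiv.Perm (Fin (m + 1)), ((Equiv.Perm.sign s : ℤ) : ℚ) •
      Finsupp.single (fun k : Fin m => g (s k.succ)) (1 : ℚ) := by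
  rw [← Equiv.sum_comp (Equiv.mulRight (finRotate (m + 1))), Finset.smul_sum]
  refine Finset.sum_congr rfl fun s _ => ?_
  rw [Equiv.coe_mulRight, Equiv.Perm.sign_mul, sign_finRotate, smul_smul]
  have : Fin.contractNth (Fin.last m) (· * ·) (g ∘ (s * finRotate (m + 1) : Equiv.Perm _)) =
      fun k : Fin m => g (s k.succ) := by
    funext k
    rw [Fin.contractNth_apply_of_lt _ _ _ _ (by simp)]
    simp [Fin.coeSucc_eq_succ]
  rw [this]
  congr 1
  push_cast
  rw [mul_comm]

/-- The inner faces vanish one by one, and the last face cancels the first since (-1)^(m+1) (-1)^m =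
-1. -/
theorem d_antisymChain {m : ℕ} {g : Fin (m + 1) → G} (hg : ∀ j k, Commute (g j) (g k)) :
    groupHomology.inhomogeneousChains.d (Rep.trivial ℚ G ℚ) m (antisymChain g) = 0 := by
  have h1 : groupHomology.inhomogeneousChains.d (Rep.trivial ℚ G ℚ) m (antisymChain g) =
      ∑ s : Equiv.Perm (Fin (m + 1)), ((Equiv.Perm.sign s : ℤ) : ℚ) •
        (Finsupp.single (fun k : Fin m => g (s k.succ)) (1 : ℚ) +
          ∑ j : Fin (m + 1), (-1 : ℚ) ^ ((j : ℕ) + 1) •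
            Finsupp.single (Fin.contractNth j (· * ·) (g ∘ s)) (1 : ℚ)) := by
    rw [antisymChain]
    refine (map_sum (groupHomology.inhomogeneousChains.d (Rep.trivial ℚ G ℚ) m).hom _ _).trans ?_
    refine Finset.sum_congr rfl fun s _ => ?_
    refine (map_smul (groupHomology.inhomogeneousChains.d (Rep.trivial ℚ G ℚ) m).hom _ _).trans ?_
    congr 1
    exact groupHomology.inhomogeneousChains.d_single (A := Rep.trivial ℚ G ℚ) m (g ∘ s) (1 : ℚ)
  refine h1.trans ?_
  simp only [smul_add, Finset.sum_add_distrib, Finset.smul_sum]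
  have h2 : ∀ j : Fin (m + 1), ∑ s : Equiv.Perm (Fin (m + 1)), ((Equiv.Perm.sign s : ℤ) : ℚ) •
      (-1 : ℚ) ^ ((j : ℕ) + 1) • Finsupp.single (Fin.contractNth j (· * ·) (g ∘ s)) (1 : ℚ) =
      (-1 : ℚ) ^ ((j : ℕ) + 1) • ∑ s : Equiv.Perm (Fin (m + 1)),
        ((Equiv.Perm.sign s : ℤ) : ℚ) •
          Finsupp.single (Fin.contractNth j (· * ·) (g ∘ s)) (1 : ℚ) := by
    intro j
    rw [Finset.smul_sum]
    exact Finset.sum_congr rfl fun s _ => smul_comm _ _ _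
  rw [Finset.sum_comm (s := Finset.univ (α := Equiv.Perm (Fin (m + 1)))),
    Finset.sum_congr rfl fun j _ => h2 j, Fin.sum_univ_castSucc]
  simp only [sum_sign_contractNth_castSucc hg, sum_sign_contractNth_last, smul_zero,
    Finset.sum_const_zero, zero_add, Fin.val_last]
  rw [smul_smul, ← pow_add, Odd.neg_one_pow ⟨m, by ring⟩, neg_one_smul, add_neg_cancel]

/-- The product of the images of pairwise commuting elements lies in the image of homology. -/
theorem ιMulti_mem_range_homologyHom (f : G →* Multiplicative V) {i : ℕ} {g : Fin i → G}
    (hg : ∀ j k, Commute (g j) (g k)) :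
    exteriorPower.ιMulti ℚ i (fun j => (f (g j)).toAdd) ∈ LinearMap.range (homologyHom f i) := by
  have hz : ∃ z : groupHomology.cycles (Rep.trivial ℚ G ℚ) i,
      groupHomology.iCycles (Rep.trivial ℚ G ℚ) i z = antisymChain g := by
    rcases i with _ | m
    -- In degree zero every chain is a cycle, the outgoing differential being zero.
    · exact ⟨groupHomology.cyclesMk 0 0 (by simp) _ (by
        rw [HomologicalComplex.shape _ _ _ (by simp)]; rfl), groupHomology.iCycles_mk _ _ _⟩
    · exact ⟨groupHomology.cyclesMk (m + 1) m (ChainComplex.next_nat_succ m) _ (by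
        rw [groupHomology.inhomogeneousChains.d_def]
        exact d_antisymChain hg), groupHomology.iCycles_mk _ _ _⟩
  obtain ⟨z, hz⟩ := hz
  refine ⟨groupHomology.π _ i z, ?_⟩
  rw [homologyHom_π, hz, antisymChain, map_sum, map_sum]
  have h : ∀ s : Equiv.Perm (Fin i), extChain V i (Finsupp.lmapDomain ℚ ℚ (f ∘ ·)
      (((Equiv.Perm.sign s : ℤ) : ℚ) • Finsupp.single (g ∘ s) 1)) =
      (1 / (i.factorial : ℚ)) • exteriorPower.ιMulti ℚ i (fun j => (f (g j)).toAdd) := by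
    intro s
    rw [map_smul, map_smul, Finsupp.lmapDomain_apply, Finsupp.mapDomain_single, extChain_single,
      one_smul, smul_comm]
    congr 1
    have h1 := (exteriorPower.ιMulti ℚ i).map_perm (fun j => (f (g j)).toAdd) s
    refine (congrArg _ h1).trans ?_
    rw [Units.smul_def, ← Int.cast_smul_eq_zsmul ℚ, smul_smul, ← Int.cast_mul, ← Units.val_mul,
      Int.units_mul_self]
    simp
  -- All i! permutations contribute the same vector, which compensates the factor 1 / i! of
  -- `extChain`.
  rw [Finset.sum_congr rfl fun s _ => h s, Finset.sum_const, Finset.card_univ, Fintype.card_perm,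
    Fintype.card_fin, ← Nat.cast_smul_eq_nsmul ℚ, smul_smul, mul_one_div_cancel
    (by exact_mod_cast i.factorial_ne_zero), one_smul]

end HomologyClasses

/-! ### Explicit automorphisms and equivariance of the Johnson homomorphism -/

section Automorphisms

variable {n : ℕ}

/-- The endomorphism of `Fₙ` which multiplies the generator `x_z` by `w` on the left and fixes
the other generators. -/
def leftMulEnd (z : Fin n) (w : Fr n) : Fr n →* Fr n :=
  FreeGroup.lift (Function.update FreeGroup.of z (w * FreeGroup.of z))

theorem leftMulEnd_of_self (z : Fin n) (w : Fr n) :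
    leftMulEnd z w (FreeGroup.of z) = w * FreeGroup.of z := by
  simp [leftMulEnd]

theorem leftMulEnd_of_ne {z x : Fin n} (h : x ≠ z) (w : Fr n) :
    leftMulEnd z w (FreeGroup.of x) = FreeGroup.of x := by
  simp [leftMulEnd, h]

theorem leftMulEnd_comp {z : Fin n} {w w' : Fr n} (h : leftMulEnd z w w' = w') :
    (leftMulEnd z w).comp (leftMulEnd z w') = leftMulEnd z (w' * w) := by
  refine FreeGroup.ext_hom _ _ fun x => ?_
  rw [MonoidHom.comp_apply]
  by_cases hx : x = z
  · subst hx
    rw [leftMulEnd_of_self, map_mul, h, leftMulEnd_of_self, leftMulEnd_of_self, mul_assoc]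
  · rw [leftMulEnd_of_ne hx, leftMulEnd_of_ne hx, leftMulEnd_of_ne hx]

theorem leftMulEnd_one (z : Fin n) : leftMulEnd z 1 = MonoidHom.id (Fr n) := by
  refine FreeGroup.ext_hom _ _ fun x => ?_
  by_cases hx : x = z
  · subst hx
    rw [leftMulEnd_of_self, one_mul, MonoidHom.id_apply]
  · rw [leftMulEnd_of_ne hx, MonoidHom.id_apply]

/-- The automorphism of `Fₙ` which multiplies the generator `x_z` on the left by a word `w` in
the other generators. -/
def leftMul (z : Fin n) (w : Fr n) (h : ∀ w', leftMulEnd z w' w = w) : MulAut (Fr n) :=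
  MonoidHom.toMulEquiv (leftMulEnd z w) (leftMulEnd z w⁻¹)
    (by rw [leftMulEnd_comp (h _), mul_inv_cancel, leftMulEnd_one])
    (by rw [leftMulEnd_comp (by rw [map_inv, h]), inv_mul_cancel, leftMulEnd_one])

theorem leftMul_apply (z : Fin n) (w : Fr n) (h : ∀ w', leftMulEnd z w' w = w) (v : Fr n) :
    leftMul z w h v = leftMulEnd z w v := rfl

theorem leftMul_mem_IA {z : Fin n} {w : Fr n} (h : ∀ w', leftMulEnd z w' w = w)
    (hw : Abelianization.of w = 1) : leftMul z w h ∈ IA n := by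
  refine mem_IA.2 fun v => ?_
  have : (Abelianization.of (G := Fr n)).comp (leftMulEnd z w) = Abelianization.of := by
    refine FreeGroup.ext_hom _ _ fun x => ?_
    rw [MonoidHom.comp_apply]
    by_cases hx : x = z
    · subst hx
      rw [leftMulEnd_of_self, map_mul, hw, one_mul]
    · rw [leftMulEnd_of_ne hx]
  exact DFunLike.congr_fun this v

/-- The automorphisms change different generators, and neither affects the word used by the other.
-/
theorem leftMul_commute {z z' : Fin n} {w w' : Fr n} (h : ∀ v, leftMulEnd z v w = w)
    (h' : ∀ v, leftMulEnd z' v w' = w') (hzz : z ≠ z') (hw : leftMulEnd z' w' w = w)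
    (hw' : leftMulEnd z w w' = w') : Commute (leftMul z w h) (leftMul z' w' h') := by
  have : (leftMulEnd z w).comp (leftMulEnd z' w') = (leftMulEnd z' w').comp (leftMulEnd z w) := by
    refine FreeGroup.ext_hom _ _ fun x => ?_
    rw [MonoidHom.comp_apply, MonoidHom.comp_apply]
    by_cases hx : x = z
    · subst hx
      rw [leftMulEnd_of_self, leftMulEnd_of_ne hzz, leftMulEnd_of_self, map_mul, hw,
        leftMulEnd_of_ne hzz]
    · rw [leftMulEnd_of_ne hx]
      by_cases hx' : x = z'
      · subst hx'
        rw [leftMulEnd_of_self, map_mul, hw', leftMulEnd_of_ne hx]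
      · rw [leftMulEnd_of_ne hx', leftMulEnd_of_ne hx]
  exact MulEquiv.ext fun v => DFunLike.congr_fun this v

theorem johnsonFun_leftMul {z : Fin n} {w : Fr n} (h : ∀ w', leftMulEnd z w' w = w) :
    johnsonFun n (leftMul z w h) =
      (LinearMap.proj z : Module.Dual ℚ (H n)).smulRight (theta n w).snd := by
  refine (Pi.basisFun ℚ (Fin n)).ext fun x => ?_
  rw [Pi.basisFun_apply, johnsonFun_single, leftMul_apply, LinearMap.smulRight_apply,
    LinearMap.proj_apply]
  by_cases hx : x = z
  · subst hx
    rw [leftMulEnd_of_self, mul_inv_cancel_right, Pi.single_eq_same, one_smul]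
  · rw [leftMulEnd_of_ne hx, mul_inv_cancel, map_one, Nil.one_snd,
      Pi.single_eq_of_ne (Ne.symm hx), zero_smul]

/-- The commutator of two generators. -/
def genComm (a b : Fin n) : Fr n :=
  FreeGroup.of a * FreeGroup.of b * (FreeGroup.of a)⁻¹ * (FreeGroup.of b)⁻¹

theorem theta_genComm (a b : Fin n) :
    (theta n (genComm a b)).snd = wedge (H n) (Pi.single a 1) (Pi.single b 1) := by
  simp only [genComm, map_mul, map_inv, theta_of, Nil.mul_snd, Nil.mul_fst, Nil.inv_fst, Nil.inv_snd,
    map_neg, map_add, LinearMap.add_apply, LinearMap.neg_apply, wedge_self]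
  rw [wedge_swap (Pi.single a 1) (Pi.single b 1)]
  module

/-- The endomorphism `(a, u) ↦ (g a, ⋀² g u + T a)`. -/
def Nil.affine (g : H n →ₗ[ℚ] H n) (T : U n) : Nil n →* Nil n where
  toFun x := ⟨g x.fst, exteriorPower.map 2 g x.snd + T x.fst⟩
  map_one' := by
    ext1
    · exact map_zero g
    · change exteriorPower.map 2 g 0 + T 0 = 0
      rw [map_zero, map_zero, add_zero]
  map_mul' x y := by
    ext1
    · exact map_add g _ _
    · simp only [Nil.mul_snd, Nil.mul_fst, map_add, map_smul, map_wedge]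
      abel

/-- The Johnson homomorphism is equivariant under automorphisms of `Fₙ`. -/
theorem johnsonFun_conj {φ ψ : MulAut (Fr n)} (hφ : φ ∈ IA n) {g : GL (Fin n) ℚ}
    (hψ : ∀ x, (theta n (ψ (FreeGroup.of x))).fst = stdRep n g (Pi.single x 1)) :
    johnsonFun n (ψ * φ * ψ⁻¹) = uRep n g (johnsonFun n φ) := by
  have hconj : ψ * φ * ψ⁻¹ ∈ IA n := by
    rw [IA]
    exact (MonoidHom.normal_ker _).conj_mem φ hφ ψ
  set T : U n := (Pi.basisFun ℚ (Fin n)).constr ℚ fun x => (theta n (ψ (FreeGroup.of x))).snd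
    with hT
  have hT' : ∀ x, T (Pi.single x 1) = (theta n (ψ (FreeGroup.of x))).snd := by
    intro x
    rw [← Pi.basisFun_apply, hT, Module.Basis.constr_basis]
  -- On the two-step nilpotent quotient ψ acts by g up to a shear `T`. The shear cancels in the
  -- conjugate, which leaves only the action of g.
  have hθ : ∀ w, theta n (ψ w) = Nil.affine (stdRep n g) T (theta n w) := by
    intro w
    have : (theta n).comp ψ.toMonoidHom = (Nil.affine (stdRep n g) T).comp (theta n) := by
      refine FreeGroup.ext_hom _ _ fun x => ?_
      change theta n (ψ (FreeGroup.of x)) = Nil.affine (stdRep n g) T (theta n (FreeGroup.of x))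
      rw [theta_of]
      ext1
      · exact hψ x
      · change _ = exteriorPower.map 2 (stdRep n g) 0 + T (Pi.single x 1)
        rw [map_zero, zero_add, hT']
    exact DFunLike.congr_fun this w
  have key : johnsonFun n (ψ * φ * ψ⁻¹) ∘ₗ stdRep n g =
      exteriorPower.map 2 (stdRep n g) ∘ₗ johnsonFun n φ := by
    refine (Pi.basisFun ℚ (Fin n)).ext fun x => ?_
    rw [Pi.basisFun_apply, LinearMap.comp_apply, LinearMap.comp_apply]
    have h1 := theta_IA hconj (ψ (FreeGroup.of x))
    have h2 : (ψ * φ * ψ⁻¹) (ψ (FreeGroup.of x)) = ψ (φ (FreeGroup.of x)) := by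
      simp [MulAut.mul_apply]
    rw [h2, hθ, hθ, theta_IA hφ, theta_of] at h1
    have h3 := congrArg Nil.snd h1
    change exteriorPower.map 2 (stdRep n g) (0 + johnsonFun n φ (Pi.single x 1)) +
      T (Pi.single x 1) = (exteriorPower.map 2 (stdRep n g) 0 + T (Pi.single x 1)) +
        johnsonFun n (ψ * φ * ψ⁻¹) (stdRep n g (Pi.single x 1)) at h3
    rw [zero_add, map_zero, zero_add, add_comm] at h3
    exact (add_left_cancel h3).symm
  refine LinearMap.ext fun v => ?_
  have := LinearMap.congr_fun key (stdRep n g⁻¹ v)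
  rw [LinearMap.comp_apply, ← Module.End.mul_apply (stdRep n g), ← map_mul, mul_inv_cancel,
    map_one, Module.End.one_apply] at this
  rw [this]
  rfl

theorem exists_mulAut_elemGL {x y : Fin n} (h : x ≠ y) : ∃ ψ : MulAut (Fr n), ∀ z,
    (theta n (ψ (FreeGroup.of z))).fst = stdRep n (elemGL h 1) (Pi.single z 1) := by
  refine ⟨leftMul y (FreeGroup.of x) fun _ => leftMulEnd_of_ne h _, fun z => ?_⟩
  rw [leftMul_apply, stdRep_elemGL]
  by_cases hz : z = y
  · subst hz
    rw [leftMulEnd_of_self, map_mul, theta_of, theta_of, Nil.mul_fst, Pi.single_eq_same, one_mul,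
      add_comm]
  · rw [leftMulEnd_of_ne hz, theta_of, Pi.single_eq_of_ne (Ne.symm hz), mul_zero, Pi.single_zero,
      add_zero]

end Automorphisms

/-! ### The image of the Albanese homology in the exterior power -/

section AlbaneseImage

open PiTensorProduct

variable (n i : ℕ)

/-- The image of the Albanese homology of `IOₙ` in `⋀^i Uᴼ`. -/
def albaneseImage : Submodule ℚ (⋀[ℚ]^i (UO n)) := LinearMap.range (homologyHom (johnsonOut n) i)

/-- As the target of τᴼ is abelian, τᴼ factors through the abelianization; so Albanese homology and
the homology of IOₙ have the same image. -/
theorem map_johnsonHom_albanese :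
    (Albanese (OutIA n) i).map (johnsonHom n i) = albaneseImage n i := by
  have : johnsonOut n = (Abelianization.lift (johnsonOut n)).comp Abelianization.of :=
    MonoidHom.ext fun x => (Abelianization.lift_apply_of _ _).symm
  rw [Albanese, ← LinearMap.range_comp, albaneseImage]
  conv_rhs => rw [this, homologyHom_comp]
  rfl

variable {n i}

theorem uoRep_comp_mkQ (g : GL (Fin n) ℚ) :
    uoRep n g ∘ₗ (hInU n).mkQ = (hInU n).mkQ ∘ₗ uRep n g := rfl

/-- An automorphism of Fₙ which induces the elementary matrix acts on IOₙ by conjugation.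
Equivariance of τᴼ turns the induced map on homology into the matrix action on the image. -/
theorem extRep_elemGL_mem_albaneseImage {x y : Fin n} (h : x ≠ y) {v : ⋀[ℚ]^i (UO n)}
    (hv : v ∈ albaneseImage n i) : extRep (uoRep n) i (elemGL h 1) v ∈ albaneseImage n i := by
  obtain ⟨ψ, hψ⟩ := exists_mulAut_elemGL h
  obtain ⟨z, rfl⟩ := hv
  have : (OutIA n).Normal := MonoidHom.normal_ker _
  set c : OutIA n →* OutIA n :=
    (MulAut.conjNormal (H := OutIA n) (QuotientGroup.mk' (Inn n) ψ)).toMonoidHom with hc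
  have key : (AddMonoidHom.toMultiplicative (uoRep n (elemGL h 1)).toAddMonoidHom).comp
      (johnsonOut n) = (johnsonOut n).comp c := by
    refine MonoidHom.ext fun u => ?_
    obtain ⟨φ, rfl⟩ := projIA_surjective n u
    have hconj : ψ * φ * ψ⁻¹ ∈ IA n := (MonoidHom.normal_ker (autToAb n)).conj_mem φ φ.2 ψ
    have h1 : c (projIA n φ) = projIA n ⟨ψ * φ * ψ⁻¹, hconj⟩ := by
      refine Subtype.ext ?_
      refine (MulAut.conjNormal_apply _ _).trans ?_
      rfl
    rw [MonoidHom.comp_apply, MonoidHom.comp_apply, h1, johnsonOut_projIA, johnsonOut_projIA,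
      johnsonFun_conj φ.2 hψ]
    rfl
  have h2 := homologyHom_map (johnsonOut n) (uoRep n (elemGL h 1)) i
  rw [key, homologyHom_comp] at h2
  exact ⟨_, LinearMap.congr_fun h2 z⟩

/-- Lets GL(n, ℚ)-stability, which is proved for spaces of mixed tensors, be transported to the
image in ⋀^i Uᴼ. -/
theorem toExtU_surjective (n i : ℕ) : Function.Surjective (toExtU n i) := by
  have hspan : Submodule.span ℚ {f : U n | ∃ (φ : Module.Dual ℚ (H n)) (a b : H n),
      φ.smulRight (wedge (H n) a b) = f} = ⊤ := by
    rw [eq_top_iff]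
    rintro f -
    have hf : f = ∑ x, (LinearMap.proj x : Module.Dual ℚ (H n)).smulRight (f (Pi.single x 1)) := by
      refine (Pi.basisFun ℚ (Fin n)).ext fun y => ?_
      rw [Pi.basisFun_apply, LinearMap.sum_apply, Finset.sum_eq_single y]
      · simp
      · intro x _ hx
        simp [hx]
      · simp
    rw [hf]
    refine Submodule.sum_mem _ fun x _ => ?_
    have hu : f (Pi.single x 1) ∈ Submodule.span ℚ (Set.range (exteriorPower.ιMulti ℚ 2)) := by
      rw [exteriorPower.ιMulti_span]; trivial
    generalize f (Pi.single x 1) = u at hu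
    induction hu using Submodule.span_induction with
    | mem u hu =>
      obtain ⟨v, rfl⟩ := hu
      refine Submodule.subset_span ⟨LinearMap.proj x, v 0, v 1, ?_⟩
      rw [wedge_apply]
      congr 2
      funext b
      fin_cases b <;> rfl
    | zero => rw [LinearMap.smulRight_zero]; exact zero_mem _
    | add u w _ _ hu hw =>
      have : (LinearMap.proj x : Module.Dual ℚ (H n)).smulRight (u + w) =
          (LinearMap.proj x).smulRight u + (LinearMap.proj x).smulRight w :=
        LinearMap.ext fun _ => smul_add _ _ _
      rw [this]
      exact add_mem hu hw
    | smul r u _ hu =>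
      have : (LinearMap.proj x : Module.Dual ℚ (H n)).smulRight (r • u) =
          r • (LinearMap.proj x).smulRight u :=
        LinearMap.ext fun _ => smul_comm _ _ _
      rw [this]
      exact Submodule.smul_mem _ _ hu
  rw [← LinearMap.range_eq_top, eq_top_iff, ← exteriorPower.ιMulti_span_of_span ℚ i (U n) hspan,
    Submodule.span_le]
  rintro _ ⟨f, hf, rfl⟩
  choose φ a b hφ using fun j => hf ⟨j, rfl⟩
  refine ⟨tprod ℚ (fun k => ![a, b] ((blockEquiv i).symm k).2 ((blockEquiv i).symm k).1) ⊗ₜ[ℚ]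
    tprod ℚ φ, ?_⟩
  rw [toExtU_tmul]
  congr 1
  funext j
  rw [← hφ, ← blockEquiv_zero, ← blockEquiv_one]
  simp

theorem mkQ_toExtU_mixedMap (g : GL (Fin n) ℚ) (t : Mixed n (2 * i) i) :
    exteriorPower.map i (hInU n).mkQ (toExtU n i (mixedMap n (2 * i) i g t)) =
      extRep (uoRep n) i g (exteriorPower.map i (hInU n).mkQ (toExtU n i t)) := by
  have h1 := LinearMap.congr_fun (toExtU_equivariant n i g) t
  rw [LinearMap.comp_apply, LinearMap.comp_apply] at h1
  rw [h1]
  change (exteriorPower.map i _ ∘ₗ exteriorPower.map i _) _ =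
    (exteriorPower.map i _ ∘ₗ exteriorPower.map i _) _
  rw [← exteriorPower.map_comp, ← exteriorPower.map_comp, uoRep_comp_mkQ]

variable (n i) in
/-- The mixed tensors whose image in `⋀^i Uᴼ` lies in the image of the Albanese homology. -/
def albanesePreimage : Submodule ℚ (Mixed n (2 * i) i) :=
  (albaneseImage n i).comap (exteriorPower.map i (hInU n).mkQ ∘ₗ toExtU n i)

theorem mem_albanesePreimage {t : Mixed n (2 * i) i} : t ∈ albanesePreimage n i ↔
    exteriorPower.map i (hInU n).mkQ (toExtU n i t) ∈ albaneseImage n i := Iff.rfl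

theorem elemGL_mem_mixedStabilizer_albanesePreimage (x y : Fin n) (h : x ≠ y) :
    elemGL h 1 ∈ mixedStabilizer (albanesePreimage n i) := by
  intro t ht
  rw [mem_albanesePreimage, mkQ_toExtU_mixedMap]
  exact extRep_elemGL_mem_albaneseImage h ht

/-- The image of the Albanese homology in `⋀^i Uᴼ` is stable under `GL(n, ℚ)`. -/
theorem extRep_mem_albaneseImage (g : GL (Fin n) ℚ) {v : ⋀[ℚ]^i (UO n)}
    (hv : v ∈ albaneseImage n i) : extRep (uoRep n) i g v ∈ albaneseImage n i := by
  obtain ⟨u, rfl⟩ := exteriorPower.map_surjective (n := i) (hInU n).mkQ_surjective v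
  obtain ⟨t, rfl⟩ := toExtU_surjective n i u
  have hg : g ∈ mixedStabilizer (albanesePreimage n i) := by
    rw [mixedStabilizer_eq_top elemGL_mem_mixedStabilizer_albanesePreimage]
    trivial
  have := hg t hv
  rwa [mem_albanesePreimage, mkQ_toExtU_mixedMap] at this

/-- The commutators of generators x_{a_j} and x_{b_j} involve none of the x_{c_l}, and the c_l are
distinct, so left multiplication of each x_{c_j} by its commutator gives commuting elements of IAₙ.
The class of their antisymmetrised cycle has the required image. -/
theorem basisTensor_mem_albanesePreimage {a : Fin (2 * i) → Fin n} {c : Fin i → Fin n}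
    (hc : Function.Injective c) (hac : ∀ k l, a k ≠ c l) :
    basisTensor a c ∈ albanesePreimage n i := by
  rw [mem_albanesePreimage, basisTensor, toExtU_tmul, exteriorPower.map_apply_ιMulti]
  set w : Fin i → Fr n := fun j =>
    genComm (a (evenIdx j)) (a (oddIdx j)) with hw
  have hfix : ∀ j l v, leftMulEnd (c l) v (w j) = w j := by
    intro j l v
    simp only [hw, genComm, map_mul, map_inv, leftMulEnd_of_ne (hac _ _)]
  have hab : ∀ j, Abelianization.of (w j) = 1 := by
    intro j
    simp only [hw, genComm, map_mul, map_inv]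
    rw [mul_inv_cancel_comm, mul_inv_cancel]
  have hcomm : ∀ j k, Commute
      (projIA n ⟨leftMul (c j) (w j) (hfix j j), leftMul_mem_IA _ (hab j)⟩)
      (projIA n ⟨leftMul (c k) (w k) (hfix k k), leftMul_mem_IA _ (hab k)⟩) := by
    intro j k
    refine Commute.map (Subtype.ext ?_) (projIA n)
    by_cases hjk : j = k
    · subst hjk; rfl
    · exact leftMul_commute (hfix j j) (hfix k k) (fun e => hjk (hc e)) (hfix _ _ _) (hfix _ _ _)
  have h := ιMulti_mem_range_homologyHom (johnsonOut n) hcomm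
  have e : (fun j => (hInU n).mkQ ((LinearMap.proj (c j) : Module.Dual ℚ (H n)).smulRight
      (wedge (H n) (Pi.single (a (evenIdx j)) 1) (Pi.single (a (oddIdx j)) 1)))) =
      fun j => (johnsonOut n
        (projIA n ⟨leftMul (c j) (w j) (hfix j j), leftMul_mem_IA _ (hab j)⟩)).toAdd := by
    funext j
    rw [johnsonOut_projIA, johnsonFun_leftMul, theta_genComm]
    rfl
  rw [← e] at h
  exact h

/-- For `n ≥ 3i` the image of the Albanese homology in `⋀^i Uᴼ` contains the image of the
traceless part of `⋀^i U`. -/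
theorem map_mkQ_tl_le (hn : 3 * i ≤ n) :
    (tl n i).toSubmodule.map (exteriorPower.map i (hInU n).mkQ) ≤ albaneseImage n i := by
  rintro _ ⟨_, ⟨t, ht, rfl⟩, rfl⟩
  exact traceless_le elemGL_mem_mixedStabilizer_albanesePreimage
    (fun a c _ hc hac => basisTensor_mem_albanesePreimage hc hac) (by omega) ht

end AlbaneseImage

/-! ### Transport of the group action along a map with stable range -/

section StableRange

variable {G V E D : Type} [Group G] [AddCommGroup V] [Module ℚ V] [AddCommGroup E] [Module ℚ E]
  [AddCommGroup D] [Module ℚ D]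

/-- If the range of `j : V → E` is stable under a representation on `E`, then `V` has an action
for which `j` is equivariant and has an equivariant section over its range. -/
theorem exists_representation_of_range_stable (j : V →ₗ[ℚ] E) (R : Representation ℚ G E)
    (hR : ∀ g, ∀ v ∈ LinearMap.range j, R g v ∈ LinearMap.range j) :
    ∃ (ρ : Representation ℚ G V) (s : LinearMap.range j →ₗ[ℚ] V),
      (∀ g x, j (ρ g x) = R g (j x)) ∧ (∀ y, j (s y) = y) ∧
        ∀ g y, ρ g (s y) = s ⟨R g y, hR g y y.2⟩ := by
  obtain ⟨s, hs⟩ := j.rangeRestrict.exists_rightInverse_of_surjective j.range_rangeRestrict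
  have hs' : ∀ y, j.rangeRestrict (s y) = y := fun y => LinearMap.congr_fun hs y
  have hs'' : ∀ y, j (s y) = y := fun y => congrArg Subtype.val (hs' y)
  -- With respect to the decomposition of V into the kernel of j and the image of s, the group acts
  -- trivially on the kernel and through R on the other summand.
  let r : G → (V →ₗ[ℚ] V) := fun g =>
    LinearMap.id - s ∘ₗ j.rangeRestrict + s ∘ₗ ((R g).restrict (hR g)) ∘ₗ j.rangeRestrict
  have hr : ∀ g v, r g v = v - s (j.rangeRestrict v) + s ((R g).restrict (hR g) (j.rangeRestrict v)) :=
    fun _ _ => rfl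
  have hj : ∀ g v, j.rangeRestrict (r g v) = (R g).restrict (hR g) (j.rangeRestrict v) := by
    intro g v
    rw [hr, map_add, map_sub, hs', hs', sub_self, zero_add]
  refine ⟨⟨⟨r, ?_⟩, ?_⟩, s, fun g v => congrArg Subtype.val (hj g v), hs'', fun g y => ?_⟩
  · refine LinearMap.ext fun v => ?_
    have : (R 1).restrict (hR 1) (j.rangeRestrict v) = j.rangeRestrict v :=
      Subtype.ext (by rw [LinearMap.coe_restrict_apply, map_one, Module.End.one_apply])
    rw [hr, this, sub_add_cancel, Module.End.one_apply]
  · intro g h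
    refine LinearMap.ext fun v => ?_
    have : (R (g * h)).restrict (hR (g * h)) (j.rangeRestrict v) =
        (R g).restrict (hR g) ((R h).restrict (hR h) (j.rangeRestrict v)) :=
      Subtype.ext (by rw [LinearMap.coe_restrict_apply, map_mul, Module.End.mul_apply]; rfl)
    rw [Module.End.mul_apply, hr g (r h v), hj, hr (g * h), this]
    simp only [hr h]
    abel
  · change r g (s y) = _
    rw [hr, hs', sub_self, zero_add]
    rfl

/-- An equivariant lift, along a map with stable range, of an injective equivariant map. -/
theorem exists_equiv_subrepresentation (j : V →ₗ[ℚ] E) (R : Representation ℚ G E)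
    (hR : ∀ g, ∀ v ∈ LinearMap.range j, R g v ∈ LinearMap.range j) (S : Representation ℚ G D)
    (f : D →ₗ[ℚ] E) (hf : Function.Injective f) (hfS : ∀ g x, f (S g x) = R g (f x))
    (hfj : ∀ x, f x ∈ LinearMap.range j) :
    ∃ ρ : Representation ℚ G V, (∀ g x, j (ρ g x) = R g (j x)) ∧
      ∃ (W : Subrepresentation ρ) (e : Representation.Equiv S W.toRepresentation),
        ∀ x, j (e x : W.toSubmodule) = f x := by
  obtain ⟨ρ, s, h1, h2, h3⟩ := exists_representation_of_range_stable j R hR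
  let F : D →ₗ[ℚ] V := s ∘ₗ f.codRestrict (LinearMap.range j) hfj
  have hjF : ∀ x, j (F x) = f x := fun x => h2 _
  have hFinj : Function.Injective F := fun x y hxy => hf (by rw [← hjF, ← hjF, hxy])
  have hFS : ∀ g x, F (S g x) = ρ g (F x) := by
    intro g x
    refine Eq.trans ?_ (h3 g _).symm
    exact congrArg s (Subtype.ext (hfS g x))
  refine ⟨ρ, h1, ⟨LinearMap.range F, ?_⟩, Representation.Equiv.mk
    (LinearEquiv.ofInjective F hFinj) fun g => LinearMap.ext fun x => Subtype.ext (hFS g x), hjF⟩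
  rintro g _ ⟨x, rfl⟩
  exact ⟨S g x, hFS g x⟩

end StableRange

end OuterTorelli

end

open OuterTorelli in
theorem theorem9p3 :
    ∀ i : ℕ, ∃ P : Polynomial ℚ, P.degree = ((3 * i : ℕ) : WithBot ℕ) ∧
      ∀ n : ℕ, 3 * i ≤ n →
        (∃ ρ : Representation ℚ (GL (Fin n) ℚ) (Albanese (OutIA n) i),
          (∀ (g : GL (Fin n) ℚ) (x : Albanese (OutIA n) i),
            johnsonHom n i (ρ g x) = extRep (uoRep n) i g (johnsonHom n i x)) ∧
          ∃ (W : Subrepresentation ρ)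
            (e : Representation.Equiv (tl n i).toRepresentation W.toRepresentation),
            ∀ x : (tl n i).toSubmodule,
              johnsonHom n i ((e x : W.toSubmodule) : Albanese (OutIA n) i) =
                exteriorPower.map i (hInU n).mkQ (x : ⋀[ℚ]^i (U n))) ∧
        ∃ d : ℕ, P.eval (n : ℚ) = (d : ℚ) ∧
          Module.finrank ℚ (tl n i).toSubmodule = d ∧
          (d : Cardinal) ≤ Module.rank ℚ (Albanese (OutIA n) i) := by
  intro i
  obtain ⟨P, hdeg, hP⟩ := exists_polynomial_finrank_tl i
  refine ⟨P, hdeg, fun n hn => ?_⟩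
  have hrange : LinearMap.range ((johnsonHom n i).domRestrict (Albanese (OutIA n) i)) =
      albaneseImage n i := by
    rw [LinearMap.range_domRestrict, map_johnsonHom_albanese]
  obtain ⟨ρ, h1, W, e, h2⟩ := exists_equiv_subrepresentation
    ((johnsonHom n i).domRestrict (Albanese (OutIA n) i)) (extRep (uoRep n) i)
    (by
      rw [hrange]
      exact fun g v hv => extRep_mem_albaneseImage g hv)
    (tl n i).toRepresentation
    ((exteriorPower.map i (hInU n).mkQ).domRestrict (tl n i).toSubmodule)
    (fun x y hxy => Subtype.ext (map_mkQ_injOn_tl hn x.2 y.2 hxy))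
    (fun g x => by
      change (exteriorPower.map i _ ∘ₗ exteriorPower.map i _) _ =
        (exteriorPower.map i _ ∘ₗ exteriorPower.map i _) _
      rw [← exteriorPower.map_comp, ← exteriorPower.map_comp, uoRep_comp_mkQ])
    (fun x => by
      rw [hrange]
      exact map_mkQ_tl_le hn ⟨x, x.2, rfl⟩)
  refine ⟨⟨ρ, h1, W, e, h2⟩, _, hP n hn, rfl, ?_⟩
  -- The comparison is made between cardinal ranks, so finite dimensionality of the Albanese
  -- homology is not required.
  rw [Module.finrank_eq_rank]
  exact e.toLinearEquiv.rank_eq.trans_le (Submodule.rank_le W.toSubmodule)
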